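/- Let $\gamma>0$ and let $\Theta:\mathbb R^2\to\mathbb R$ satisfy $\Theta(tx,ty)=t^{\gamma}\Theta(x,y)$ for all $x,y\in\mathbb R$ and $t>0$, $\Theta(x,y)=\Theta(y,x)$ for all $x,y\in\mathbb R$, and $c\le\Theta(x,y)\le C$ whenever $x^2+y^2=1$, for some constants $0<c\le C$. Put $\theta(x)=\Theta(x,x)$, so that $\theta(x)=|x|^{\gamma}\Theta(1,1)$ for $x\ge 0$ and $\theta(x)=|x|^{\gamma}\Theta(-1,-1)$ for $x<0$. Let $|D_x|$ be the operator in the complex space $L^2(\mathbb R)$ acting as multiplication by $|\xi|$ on the side of the Fourier transform $\hat u(\xi)=(2\pi)^{-1/2}\int e^{-i\xi x}u(x)\,dx$, with domain $H^1(\mathbb R)$, and let $$\mathbf A=|D_x|+\tfrac12\theta(x),\qquad D(\mathbf A)=H^1(\mathbb R)\cap L^2(\mathbb R,|x|^{2\gamma}dx)=\{u\in H^1(\mathbb R):\theta u\in L^2(\mathbb R)\}.$$ Then: 1. There is exactly one strongly continuous semigroup $(e^{-t\mathbf A})_{t\ge 0}$ of bounded operators on $L^2(\mathbb R)$ with infinitesimal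 generator $-\mathbf A$, and $e^{-t\mathbf A}$ is positivity improving for every $t>0$: if $u\in L^2(\mathbb R)$, $u\ge 0$ a.e. and $u\neq 0$, then $e^{-t\mathbf A}u>0$ a.e. on $\mathbb R$. 2. $\mathbf A$ has a lowest eigenvalue $\lambda_1$. It is non-degenerate, i.e. $\dim\ker(\mathbf A-\lambda_1)=1$, and it has a normalized eigenfunction $\phi_1$ with $\phi_1(x)>0$ for a.e. $x\in\mathbb R$. -/

import Mathlib

open MeasureTheory Filter Topology FourierTransform
open scoped NNReal ENNReal

noncomputable section

/-- The complex Hilbert space `L²(ℝ)`. -/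
abbrev L2R : Type := Lp ℂ 2 (volume : Measure ℝ)

/-- The (unbounded) operator of multiplication by the real function `f` in `L²(ℝ)`, on its maximal
domain `{u ∈ L² : f u ∈ L²}`. -/
def mulOp (f : ℝ → ℝ) : L2R →ₗ.[ℂ] L2R where
  domain :=
    { carrier := {u | MemLp (fun x => (f x : ℂ) * u x) 2 volume}
      zero_mem' := by
        refine (MemLp.zero (p := 2) (μ := (volume : Measure ℝ)) (ε := ℂ)).ae_eq ?_
        filter_upwards [Lp.coeFn_zero ℂ 2 (volume : Measure ℝ)] with x hx
        simp only [hx, Pi.zero_apply, mul_zero]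
      add_mem' := by
        intro u v hu hv
        refine (MemLp.add hu hv).ae_eq ?_
        filter_upwards [Lp.coeFn_add u v] with x hx
        simp only [hx, Pi.add_apply, mul_add]
      smul_mem' := by
        intro c u hu
        refine (MemLp.const_smul hu c).ae_eq ?_
        filter_upwards [Lp.coeFn_smul c u] with x hx
        simp only [hx, Pi.smul_apply, smul_eq_mul, mul_left_comm] }
  toFun :=
    { toFun := fun u => MemLp.toLp (fun x => (f x : ℂ) * (u : L2R) x) u.2
      map_add' := by
        intro u v
        refine Eq.trans ?_ (MemLp.toLp_add u.2 v.2)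
        rw [MemLp.toLp_eq_toLp_iff]
        filter_upwards [Lp.coeFn_add (u : L2R) (v : L2R)] with x hx
        simp only [Submodule.coe_add, hx, Pi.add_apply, mul_add]
      map_smul' := by
        intro c u
        refine Eq.trans ?_ (MemLp.toLp_const_smul c u.2)
        rw [MemLp.toLp_eq_toLp_iff]
        filter_upwards [Lp.coeFn_smul c (u : L2R)] with x hx
        simp only [Submodule.coe_smul, hx, Pi.smul_apply, smul_eq_mul, mul_left_comm] }

/-- The operator `|D_x|` in `L²(ℝ)`, on its domain `H¹(ℝ) = {u ∈ L² : |ξ| û(ξ) ∈ L²}`.  Mathlib's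
Fourier transform is `𝓕 u (ξ) = ∫ exp (-2πixξ) u(x) dx`, for which `D_x = -i d/dx` becomes
multiplication by `2πξ`, so `|D_x| = 𝓕⁻¹ ∘ (2π|ξ|) ∘ 𝓕`. -/
def absD : L2R →ₗ.[ℂ] L2R where
  domain := (mulOp fun ξ => 2 * Real.pi * |ξ|).domain.comap
    (Lp.fourierTransformₗᵢ ℝ ℂ).toLinearEquiv.toLinearMap
  toFun := (Lp.fourierTransformₗᵢ ℝ ℂ).symm.toLinearEquiv.toLinearMap ∘ₗ
    (mulOp fun ξ => 2 * Real.pi * |ξ|).toFun ∘ₗ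
    (Lp.fourierTransformₗᵢ ℝ ℂ).toLinearEquiv.toLinearMap.submoduleComap
      (mulOp fun ξ => 2 * Real.pi * |ξ|).domain

/-- The model operator `A = |D_x| + θ / 2` in `L²(ℝ)`.  The sum of partially defined operators has
the intersection `D(|D_x|) ∩ D(θ)` as its domain. -/
def modelOperator (θ : ℝ → ℝ) : L2R →ₗ.[ℂ] L2R :=
  absD + (1 / 2 : ℂ) • mulOp θ

/-- `T` is the semigroup `T t = e^{-tA}`, `t ≥ 0`: the strongly continuous one-parameter semigroup
of bounded operators whose infinitesimal generator is exactly `-A`. -/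
structure IsExpSemigroup {E : Type*} [NormedAddCommGroup E] [NormedSpace ℂ E]
    (A : E →ₗ.[ℂ] E) (T : ℝ≥0 → E →L[ℂ] E) : Prop where
  zero : T 0 = ContinuousLinearMap.id ℂ E
  add : ∀ s t : ℝ≥0, T (s + t) = (T s).comp (T t)
  continuous : ∀ u : E, Continuous fun t : ℝ≥0 => T t u
  generator : ∀ u v : E,
    Tendsto (fun t : ℝ≥0 => ((t⁻¹ : ℝ≥0) : ℂ) • (u - T t u)) (𝓝[>] (0 : ℝ≥0)) (𝓝 v) ↔
      ∃ h : u ∈ A.domain, A ⟨u, h⟩ = v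

/-- `u` is (real and) non-negative almost everywhere. -/
def AENonneg (u : L2R) : Prop := ∀ᵐ x, 0 ≤ (u x).re ∧ (u x).im = 0

/-- `u` is (real and) strictly positive almost everywhere. -/
def AEPos (u : L2R) : Prop := ∀ᵐ x, 0 < (u x).re ∧ (u x).im = 0

/-- A bounded operator on `L²(ℝ)` is positivity improving if it sends every non-negative non-zero
function to a function that is strictly positive almost everywhere. -/
def PositivityImproving (S : L2R →L[ℂ] L2R) : Prop :=
  ∀ u : L2R, AENonneg u → u ≠ 0 → AEPos (S u)

/-- The eigenspace `ker (A - μ)` of a partially defined operator. -/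
def pmapEigenspace {E : Type*} [AddCommGroup E] [Module ℂ E] (A : E →ₗ.[ℂ] E) (μ : ℂ) :
    Submodule ℂ E where
  carrier := {u | ∃ h : u ∈ A.domain, A ⟨u, h⟩ = μ • u}
  zero_mem' := ⟨A.domain.zero_mem, by
    rw [smul_zero]
    exact A.map_zero⟩
  add_mem' := by
    rintro u v ⟨hu, hu'⟩ ⟨hv, hv'⟩
    refine ⟨A.domain.add_mem hu hv, ?_⟩
    rw [smul_add, ← hu', ← hv', ← A.map_add]
    rfl
  smul_mem' := by
    rintro c u ⟨hu, hu'⟩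
    refine ⟨A.domain.smul_mem c hu, ?_⟩
    rw [smul_comm, ← hu', ← A.map_smul]
    rfl

/-- The set of real eigenvalues of a partially defined operator. -/
def realEigenvalues {E : Type*} [AddCommGroup E] [Module ℂ E] (A : E →ₗ.[ℂ] E) : Set ℝ :=
  {μ | pmapEigenspace A (μ : ℂ) ≠ ⊥}

end

/-! Write the operator as `|D| + V` with `V x = Θ x x / 2`; homogeneity makes `V` comparable to `|x|
^ γ`. Everything follows from three facts: `|D| + V` is nonnegative and self-adjoint on the
intersection of the two domains, its resolvent is compact, and `|D|` generates a semigroup with a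
strictly positive kernel.

Self-adjointness on this domain is the analytic core. It suffices to solve `(|D| + V + 1) u = f`
with both `|D| u` and `V u` in `L²`. The separation estimate tests the equation with `h² u`, where
`h²` is comparable to `V + 1`. The double commutator of `e^{-t|D|}` with `h` is an integral against
`(h x - h y)²` times the Poisson kernel. For slowly varying `h` it costs only `ε ‖h² u‖² + C ‖u‖²`
(`exists_re_inner_weight_absD`). The bound is uniform over truncated weights, so the solutions for
truncated potentials form a Cauchy sequence whose limit solves the full equation
(`ComparablePotential.exists_solution`).

The semigroup is then the continuous functional calculus of the resolvent `R = (A + 1)⁻¹`, applied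
to `r ↦ e^{-t(1/r - 1)}` (`IsNonnegSelfAdjoint.heat`). Uniqueness is the energy estimate for `z' =
-A z`.

Positivity: the distance of an orbit to the cone of nonnegative functions is nonincreasing. Strict
positivity comes from nonlocality: if `p, q ≥ 0` are nonzero and orthogonal, then `⟨p, A q⟩ < 0`
(`re_inner_absDAdd_neg`), because `V` contributes nothing on disjoint supports and `|D|` has a
strictly negative off-diagonal kernel. If `⟨T_s v, q⟩` vanished, it would be at a minimum in time,
which forces the opposite sign.

For the ground state, `R` is compact because the weight bound controls tails and the Poisson
semigroup gives local compactness. Hence `‖R‖` is an eigenvalue, and `1 / ‖R‖ - 1` is the lowest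
eigenvalue of `A`. Positive parts of its eigenfunctions are again eigenfunctions, and by nonlocality
they vanish or are positive almost everywhere. Two such functions cannot be orthogonal, so the
eigenvalue is simple. -/

/-! ### Multiplication operators in `L²`. -/

/-- Measurable bounded real functions. -/
structure BddMeas (g : ℝ → ℝ) : Prop where
  meas : Measurable g
  bdd : ∃ C, ∀ x, |g x| ≤ C

theorem BddMeas.memLp {g : ℝ → ℝ} (hg : BddMeas g) (u : L2R) :
    MemLp (fun x => (g x : ℂ) * u x) 2 volume := by
  obtain ⟨C, hC⟩ := hg.bdd
  refine MemLp.of_le_mul (c := C) (Lp.memLp u) ?_ ?_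
  · exact (Complex.measurable_ofReal.comp hg.meas).aestronglyMeasurable.mul
      (Lp.aestronglyMeasurable u)
  · refine Eventually.of_forall fun x => ?_
    rw [norm_mul, Complex.norm_real]
    exact mul_le_mul_of_nonneg_right (hC x) (norm_nonneg _)

theorem BddMeas.mul {g h : ℝ → ℝ} (hg : BddMeas g) (hh : BddMeas h) :
    BddMeas (fun x => g x * h x) := by
  obtain ⟨C, hC⟩ := hg.bdd
  obtain ⟨D, hD⟩ := hh.bdd
  refine ⟨hg.meas.mul hh.meas, C * D, fun x => ?_⟩
  rw [abs_mul]
  exact mul_le_mul (hC x) (hD x) (abs_nonneg _) ((abs_nonneg _).trans (hC x))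

/-- The bounded operator of multiplication by a bounded measurable function. -/
noncomputable def mulL {g : ℝ → ℝ} (hg : BddMeas g) : L2R →L[ℂ] L2R :=
  LinearMap.mkContinuousOfExistsBound
    { toFun := fun u => (hg.memLp u).toLp
      map_add' := by
        intro u v
        refine Eq.trans ?_ (MemLp.toLp_add (hg.memLp u) (hg.memLp v))
        rw [MemLp.toLp_eq_toLp_iff]
        filter_upwards [Lp.coeFn_add u v] with x hx
        simp only [hx, Pi.add_apply, mul_add]
      map_smul' := by
        intro c u
        refine Eq.trans ?_ (MemLp.toLp_const_smul c (hg.memLp u))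
        rw [MemLp.toLp_eq_toLp_iff]
        filter_upwards [Lp.coeFn_smul c u] with x hx
        simp only [hx, Pi.smul_apply, smul_eq_mul, mul_left_comm] }
    (by
      obtain ⟨C, hC⟩ := hg.bdd
      refine ⟨C, fun u => ?_⟩
      refine Lp.norm_le_mul_norm_of_ae_le_mul ?_
      filter_upwards [(hg.memLp u).coeFn_toLp] with x hx
      simp only [LinearMap.coe_mk, AddHom.coe_mk, hx, norm_mul, Complex.norm_real]
      exact mul_le_mul_of_nonneg_right (hC x) (norm_nonneg _))

theorem coeFn_mulL {g : ℝ → ℝ} (hg : BddMeas g) (u : L2R) :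
    mulL hg u =ᵐ[volume] fun x => (g x : ℂ) * u x :=
  (hg.memLp u).coeFn_toLp

theorem norm_mulL_le {g : ℝ → ℝ} (hg : BddMeas g) {C : ℝ} (hC : ∀ x, |g x| ≤ C) (u : L2R) :
    ‖mulL hg u‖ ≤ C * ‖u‖ := by
  refine Lp.norm_le_mul_norm_of_ae_le_mul ?_
  filter_upwards [coeFn_mulL hg u] with x hx
  rw [hx, norm_mul, Complex.norm_real]
  exact mul_le_mul_of_nonneg_right (hC x) (norm_nonneg _)

theorem norm_mulL_le_norm_mulL {g h : ℝ → ℝ} (hg : BddMeas g) (hh : BddMeas h)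
    (hgh : ∀ x, |g x| ≤ |h x|) (u : L2R) : ‖mulL hg u‖ ≤ ‖mulL hh u‖ := by
  refine Lp.norm_le_norm_of_ae_le ?_
  filter_upwards [coeFn_mulL hg u, coeFn_mulL hh u] with x hx hy
  rw [hx, hy, norm_mul, norm_mul, Complex.norm_real, Complex.norm_real]
  exact mul_le_mul_of_nonneg_right (hgh x) (norm_nonneg _)

theorem mulL_mulL {g h : ℝ → ℝ} (hg : BddMeas g) (hh : BddMeas h) (u : L2R) :
    mulL hg (mulL hh u) = mulL (hg.mul hh) u := by
  apply Lp.ext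
  filter_upwards [coeFn_mulL hg (mulL hh u), coeFn_mulL hh u, coeFn_mulL (hg.mul hh) u]
    with x h1 h2 h3
  rw [h1, h2, h3]
  push_cast
  ring

theorem integrable_conj_mul (u v : L2R) :
    Integrable (fun x => (starRingEnd ℂ) (u x) * v x) volume := by
  refine (L2.integrable_inner (𝕜 := ℂ) u v).congr (Eventually.of_forall fun x => ?_)
  simp only [RCLike.inner_apply]
  ring

theorem inner_eq_integral (u v : L2R) :
    inner ℂ u v = ∫ x, (starRingEnd ℂ) (u x) * v x := by
  rw [L2.inner_def]
  refine integral_congr_ae (Eventually.of_forall fun x => ?_)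
  simp only [RCLike.inner_apply]
  ring

theorem re_inner_eq_integral (u v : L2R) :
    (inner ℂ u v).re = ∫ x, ((starRingEnd ℂ) (u x) * v x).re := by
  rw [inner_eq_integral]
  exact (integral_re (𝕜 := ℂ) (integrable_conj_mul u v)).symm

theorem norm_sq_eq_integral (u : L2R) : ‖u‖ ^ 2 = ∫ x, ‖u x‖ ^ 2 := by
  have h := re_inner_eq_integral u u
  have h2 : (inner ℂ u u).re = ‖u‖ ^ 2 := inner_self_eq_norm_sq (𝕜 := ℂ) u
  rw [← h2, h]
  refine integral_congr_ae (Eventually.of_forall fun x => ?_)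
  simp only
  rw [← Complex.normSq_eq_conj_mul_self, Complex.ofReal_re, Complex.normSq_eq_norm_sq]

theorem integrable_norm_sq (u : L2R) : Integrable (fun x => ‖u x‖ ^ 2) volume :=
  (Lp.memLp u).integrable_norm_pow (by norm_num)

theorem inner_mulL_left {g : ℝ → ℝ} (hg : BddMeas g) (u v : L2R) :
    inner ℂ (mulL hg u) v = inner ℂ u (mulL hg v) := by
  rw [inner_eq_integral, inner_eq_integral]
  refine integral_congr_ae ?_
  filter_upwards [coeFn_mulL hg u, coeFn_mulL hg v] with x h1 h2
  rw [h1, h2, map_mul, Complex.conj_ofReal]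
  ring

theorem re_conj_mul_ofReal_mul_self (c : ℝ) (z : ℂ) :
    ((starRingEnd ℂ) z * ((c : ℂ) * z)).re = c * ‖z‖ ^ 2 := by
  rw [mul_left_comm, ← Complex.normSq_eq_conj_mul_self, ← Complex.ofReal_mul,
    Complex.ofReal_re, Complex.normSq_eq_norm_sq]

theorem re_inner_mulL_nonneg {g : ℝ → ℝ} (hg : BddMeas g) (h0 : ∀ x, 0 ≤ g x) (u : L2R) :
    0 ≤ (inner ℂ u (mulL hg u)).re := by
  rw [re_inner_eq_integral]
  refine integral_nonneg_of_ae ?_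
  filter_upwards [coeFn_mulL hg u] with x h1
  rw [h1, re_conj_mul_ofReal_mul_self]
  exact mul_nonneg (h0 x) (sq_nonneg _)

/-- Dominated convergence. It is applied to the Fourier multipliers `expQuot` as `t → 0` and to
spatial cutoffs. -/
theorem tendsto_mulL {ι : Type*} {l : Filter ι} [l.IsCountablyGenerated] {g : ι → ℝ → ℝ}
    (hg : ∀ i, BddMeas (g i)) {C : ℝ} (hC : ∀ᶠ i in l, ∀ x, |g i x| ≤ C)
    (hlim : ∀ x, Tendsto (fun i => g i x) l (𝓝 1)) (u : L2R) :
    Tendsto (fun i => mulL (hg i) u) l (𝓝 u) := by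
  rw [tendsto_iff_norm_sub_tendsto_zero]
  have key : Tendsto (fun i => ‖mulL (hg i) u - u‖ ^ 2) l (𝓝 0) := by
    have h1 : ∀ i, ‖mulL (hg i) u - u‖ ^ 2 = ∫ x, (g i x - 1) ^ 2 * ‖u x‖ ^ 2 := by
      intro i
      rw [norm_sq_eq_integral]
      refine integral_congr_ae ?_
      filter_upwards [coeFn_mulL (hg i) u, Lp.coeFn_sub (mulL (hg i) u) u] with x h1 h2
      rw [h2, Pi.sub_apply, h1]
      have : (g i x : ℂ) * u x - u x = ((g i x - 1 : ℝ) : ℂ) * u x := by push_cast; ring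
      rw [this, norm_mul, mul_pow, Complex.norm_real, Real.norm_eq_abs, sq_abs]
    simp_rw [h1]
    have h0 : (0 : ℝ) = ∫ x : ℝ, (0 : ℝ) := by simp
    rw [h0]
    refine tendsto_integral_filter_of_dominated_convergence
      (fun x => (C + 1) ^ 2 * ‖u x‖ ^ 2) ?_ ?_ ((integrable_norm_sq u).const_mul _) ?_
    · refine Eventually.of_forall fun i => ?_
      exact (((hg i).meas.sub_const 1).pow_const 2).aestronglyMeasurable.mul
        (integrable_norm_sq u).aestronglyMeasurable
    · filter_upwards [hC] with i hi
      refine Eventually.of_forall fun x => ?_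
      rw [norm_mul, norm_pow, norm_pow, norm_norm, Real.norm_eq_abs]
      gcongr
      exact (abs_sub _ _).trans (by simpa using hi x)
    · refine Eventually.of_forall fun x => ?_
      have := (((hlim x).sub_const 1).pow 2).mul_const (‖u x‖ ^ 2)
      simpa using this
  have := (Real.continuous_sqrt.tendsto 0).comp key
  simpa [Function.comp_def, Real.sqrt_sq (norm_nonneg _)] using this

theorem mem_mulOp_domain {f : ℝ → ℝ} {u : L2R} :
    u ∈ (mulOp f).domain ↔ MemLp (fun x => (f x : ℂ) * u x) 2 volume := Iff.rfl

theorem coeFn_mulOp {f : ℝ → ℝ} (u : (mulOp f).domain) :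
    mulOp f u =ᵐ[volume] fun x => (f x : ℂ) * (u : L2R) x :=
  MemLp.coeFn_toLp u.2

theorem inner_mulOp_left {f : ℝ → ℝ} (u v : (mulOp f).domain) :
    inner ℂ (mulOp f u) (v : L2R) = inner ℂ (u : L2R) (mulOp f v) := by
  rw [inner_eq_integral, inner_eq_integral]
  refine integral_congr_ae ?_
  filter_upwards [coeFn_mulOp u, coeFn_mulOp v] with x h1 h2
  rw [h1, h2, map_mul, Complex.conj_ofReal]
  ring

theorem re_inner_mulOp_nonneg {f : ℝ → ℝ} (h0 : ∀ x, 0 ≤ f x) (u : (mulOp f).domain) :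
    0 ≤ (inner ℂ (u : L2R) (mulOp f u)).re := by
  rw [re_inner_eq_integral]
  refine integral_nonneg_of_ae ?_
  filter_upwards [coeFn_mulOp u] with x h1
  rw [h1, re_conj_mul_ofReal_mul_self]
  exact mul_nonneg (h0 x) (sq_nonneg _)

/-! ### Fourier multipliers, `|D|` and its semigroup. -/

/-- The Fourier transform on `L²(ℝ)`. -/
noncomputable abbrev fourierL2 : L2R ≃ₗᵢ[ℂ] L2R := Lp.fourierTransformₗᵢ ℝ ℂ

/-- The symbol of `|D|`. -/
noncomputable abbrev absSymbol (ξ : ℝ) : ℝ := 2 * Real.pi * |ξ|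

theorem absSymbol_nonneg (ξ : ℝ) : 0 ≤ absSymbol ξ := by
  have := Real.pi_pos
  unfold absSymbol
  positivity

theorem continuous_absSymbol : Continuous absSymbol := by
  unfold absSymbol
  fun_prop

/-- The Fourier multiplier with a bounded measurable symbol. -/
noncomputable def fourierMul {g : ℝ → ℝ} (hg : BddMeas g) : L2R →L[ℂ] L2R :=
  (fourierL2.symm.toContinuousLinearEquiv : L2R →L[ℂ] L2R) ∘L mulL hg ∘L
    (fourierL2.toContinuousLinearEquiv : L2R →L[ℂ] L2R)

theorem fourierMul_apply {g : ℝ → ℝ} (hg : BddMeas g) (u : L2R) :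
    fourierMul hg u = fourierL2.symm (mulL hg (fourierL2 u)) := rfl

theorem inner_fourierL2_symm (u v : L2R) :
    inner ℂ (fourierL2.symm u) v = inner ℂ u (fourierL2 v) := by
  rw [← fourierL2.inner_map_map, LinearIsometryEquiv.apply_symm_apply]

theorem inner_fourierL2_symm_right (u v : L2R) :
    inner ℂ u (fourierL2.symm v) = inner ℂ (fourierL2 u) v := by
  rw [← fourierL2.inner_map_map, LinearIsometryEquiv.apply_symm_apply]

theorem inner_fourierMul_left {g : ℝ → ℝ} (hg : BddMeas g) (u v : L2R) :
    inner ℂ (fourierMul hg u) v = inner ℂ u (fourierMul hg v) := by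
  rw [fourierMul_apply, fourierMul_apply, inner_fourierL2_symm, inner_fourierL2_symm_right,
    inner_mulL_left]

theorem norm_fourierMul_le {g : ℝ → ℝ} (hg : BddMeas g) {C : ℝ} (hC : ∀ x, |g x| ≤ C) (u : L2R) :
    ‖fourierMul hg u‖ ≤ C * ‖u‖ := by
  rw [fourierMul_apply, LinearIsometryEquiv.norm_map, ← fourierL2.norm_map u]
  exact norm_mulL_le hg hC _

theorem mem_absD_domain {u : L2R} : u ∈ absD.domain ↔ fourierL2 u ∈ (mulOp absSymbol).domain :=
  Iff.rfl

theorem absD_apply (u : absD.domain) :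
    absD u = fourierL2.symm (mulOp absSymbol ⟨fourierL2 (u : L2R), mem_absD_domain.1 u.2⟩) := rfl

theorem coeFn_fourierL2_absD (u : absD.domain) :
    fourierL2 (absD u) =ᵐ[volume] fun ξ => (absSymbol ξ : ℂ) * fourierL2 (u : L2R) ξ := by
  rw [absD_apply, LinearIsometryEquiv.apply_symm_apply]
  exact coeFn_mulOp (f := absSymbol) ⟨fourierL2 (u : L2R), mem_absD_domain.1 u.2⟩

theorem inner_absD_left (u v : absD.domain) :
    inner ℂ (absD u) (v : L2R) = inner ℂ (u : L2R) (absD v) := by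
  rw [absD_apply, absD_apply, inner_fourierL2_symm, inner_fourierL2_symm_right]
  exact inner_mulOp_left (f := absSymbol) ⟨fourierL2 (u : L2R), mem_absD_domain.1 u.2⟩
    ⟨fourierL2 (v : L2R), mem_absD_domain.1 v.2⟩

theorem re_inner_absD_nonneg (u : absD.domain) : 0 ≤ (inner ℂ (u : L2R) (absD u)).re := by
  rw [absD_apply, inner_fourierL2_symm_right]
  exact re_inner_mulOp_nonneg absSymbol_nonneg ⟨fourierL2 (u : L2R), mem_absD_domain.1 u.2⟩

theorem bddMeas_exp_absSymbol {t : ℝ} (ht : 0 ≤ t) :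
    BddMeas (fun ξ => Real.exp (-(t * absSymbol ξ))) := by
  refine ⟨by have := continuous_absSymbol; fun_prop, 1, fun ξ => ?_⟩
  rw [abs_of_pos (Real.exp_pos _), Real.exp_le_one_iff, neg_nonpos]
  exact mul_nonneg ht (absSymbol_nonneg ξ)

/-- The Poisson semigroup `e^{-t|D|}`. -/
noncomputable def poissonOp {t : ℝ} (ht : 0 ≤ t) : L2R →L[ℂ] L2R :=
  fourierMul (bddMeas_exp_absSymbol ht)

theorem norm_poissonOp_le {t : ℝ} (ht : 0 ≤ t) (u : L2R) : ‖poissonOp ht u‖ ≤ ‖u‖ := by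
  rw [← one_mul ‖u‖]
  refine norm_fourierMul_le _ (fun ξ => ?_) u
  rw [abs_of_pos (Real.exp_pos _), Real.exp_le_one_iff, neg_nonpos]
  exact mul_nonneg ht (absSymbol_nonneg ξ)

/-- The function `(1 - e^{-s}) / s`, continuously extended to `s = 0`. -/
noncomputable def expQuot (s : ℝ) : ℝ := if s = 0 then 1 else (1 - Real.exp (-s)) / s

theorem expQuot_mul (s : ℝ) : expQuot s * s = 1 - Real.exp (-s) := by
  unfold expQuot
  split_ifs with h
  · simp [h]
  · field_simp

theorem abs_expQuot_le {s : ℝ} (hs : 0 ≤ s) : |expQuot s| ≤ 1 := by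
  unfold expQuot
  split_ifs with h
  · simp
  · have hs' : 0 < s := lt_of_le_of_ne hs (Ne.symm h)
    have h1 : Real.exp (-s) ≤ 1 := by simpa using hs
    have h2 := Real.add_one_le_exp (-s)
    rw [abs_of_nonneg (div_nonneg (by linarith) hs), div_le_one hs']
    linarith

/-- The function is the slope at `0` of `s ↦ -e^{-s}`, so continuity at `0` is differentiability of
the exponential there. -/
theorem continuous_expQuot : Continuous expQuot := by
  have h0 : expQuot = fun s => dslope (fun s : ℝ => -Real.exp (-s)) 0 s := by
    funext s
    unfold expQuot
    split_ifs with h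
    · subst h
      have hd : HasDerivAt (fun s : ℝ => -Real.exp (-s)) 1 0 := by
        refine ((hasDerivAt_neg (0 : ℝ)).exp.fun_neg).congr_deriv ?_
        simp
      rw [dslope_same, hd.deriv]
    · rw [dslope_of_ne _ h, slope_def_field]
      simp
      ring
  rw [h0, ← continuousOn_univ, continuousOn_dslope univ_mem]
  refine ⟨by fun_prop, ?_⟩
  exact (((hasDerivAt_neg (0 : ℝ)).exp).neg).differentiableAt

theorem expQuot_zero : expQuot 0 = 1 := by simp [expQuot]

theorem bddMeas_expQuot {t : ℝ} (ht : 0 ≤ t) : BddMeas (fun ξ => expQuot (t * absSymbol ξ)) := by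
  refine ⟨?_, 1, fun ξ => abs_expQuot_le (mul_nonneg ht (absSymbol_nonneg ξ))⟩
  exact (continuous_expQuot.comp (continuous_const.mul continuous_absSymbol)).measurable

/-- An exact form of the difference quotient: dividing by `t` leaves a multiplier bounded by `1` and
tending strongly to the identity, applied to `|D| u`. Information on the semigroup is transferred to
its generator in this way. -/
theorem sub_poissonOp_eq {t : ℝ} (ht : 0 ≤ t) (u : absD.domain) :
    (u : L2R) - poissonOp ht u = (t : ℂ) • fourierMul (bddMeas_expQuot ht) (absD u) := by
  apply fourierL2.injective
  rw [map_sub, map_smul, fourierMul_apply, poissonOp, fourierMul_apply,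
    LinearIsometryEquiv.apply_symm_apply, LinearIsometryEquiv.apply_symm_apply]
  apply Lp.ext
  filter_upwards [Lp.coeFn_sub (fourierL2 (u : L2R))
      (mulL (bddMeas_exp_absSymbol ht) (fourierL2 (u : L2R))),
    coeFn_mulL (bddMeas_exp_absSymbol ht) (fourierL2 (u : L2R)),
    Lp.coeFn_smul (t : ℂ) (mulL (bddMeas_expQuot ht) (fourierL2 (absD u))),
    coeFn_mulL (bddMeas_expQuot ht) (fourierL2 (absD u)), coeFn_fourierL2_absD u]
    with ξ h1 h2 h3 h4 h5
  rw [h1, h3, Pi.sub_apply, Pi.smul_apply, h2, h4, h5, smul_eq_mul]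
  have h6 := expQuot_mul (t * absSymbol ξ)
  have h7 : (Real.exp (-(t * absSymbol ξ)) : ℂ) =
      1 - (expQuot (t * absSymbol ξ) : ℂ) * ((t : ℂ) * (absSymbol ξ : ℂ)) := by
    rw [← Complex.ofReal_mul, ← Complex.ofReal_mul, h6]
    push_cast
    ring
  rw [h7]
  ring

theorem norm_sub_poissonOp_le {t : ℝ} (ht : 0 ≤ t) (u : absD.domain) :
    ‖(u : L2R) - poissonOp ht u‖ ≤ t * ‖absD u‖ := by
  rw [sub_poissonOp_eq, norm_smul, Complex.norm_real, Real.norm_eq_abs, abs_of_nonneg ht]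
  refine mul_le_mul_of_nonneg_left ?_ ht
  rw [← one_mul ‖absD u‖]
  exact norm_fourierMul_le _ (fun ξ => abs_expQuot_le (mul_nonneg ht (absSymbol_nonneg ξ))) _

theorem tendsto_fourierMul_expQuot (v : L2R) :
    Tendsto (fun t : {t : ℝ // 0 ≤ t} => fourierMul (bddMeas_expQuot t.2) v)
      (comap Subtype.val (𝓝 0)) (𝓝 v) := by
  have h := tendsto_mulL (l := comap (Subtype.val : {t : ℝ // 0 ≤ t} → ℝ) (𝓝 0))
    (fun t => bddMeas_expQuot t.2) (C := 1)
    (Eventually.of_forall fun t ξ => abs_expQuot_le (mul_nonneg t.2 (absSymbol_nonneg ξ)))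
    (fun ξ => by
      have h1 : Tendsto (fun t : ℝ => expQuot (t * absSymbol ξ)) (𝓝 0) (𝓝 1) := by
        have : Continuous fun t : ℝ => expQuot (t * absSymbol ξ) :=
          continuous_expQuot.comp (continuous_id.mul continuous_const)
        simpa [expQuot_zero] using this.tendsto 0
      exact h1.comp tendsto_comap) (fourierL2 v)
  have h2 := (fourierL2.symm.continuous.tendsto (fourierL2 v)).comp h
  simpa [Function.comp_def, fourierMul_apply] using h2

/-- A bound on `⟨w, (u - e^{-t|D|}u)⟩ / t`, uniform in `t > 0`, passes to `⟨w, |D|u⟩`. -/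
theorem le_re_inner_absD {w : L2R} (u : absD.domain) {c : ℝ}
    (h : ∀ t : ℝ, ∀ ht : 0 < t, t < 1 → t * c ≤ (inner ℂ w ((u : L2R) - poissonOp ht.le u)).re) :
    c ≤ (inner ℂ w (absD u)).re := by
  set l : Filter {t : ℝ // 0 ≤ t} := comap Subtype.val (𝓝[>] 0) with hl
  have hne : l.NeBot := by
    rw [hl, comap_neBot_iff]
    intro s hs
    obtain ⟨x, hx, hx'⟩ := (𝓝[>] (0 : ℝ)).nonempty_of_mem (inter_mem hs self_mem_nhdsWithin)
    exact ⟨⟨x, le_of_lt hx'⟩, hx⟩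
  have h1 : Tendsto (fun t : {t : ℝ // 0 ≤ t} =>
      (inner ℂ w (fourierMul (bddMeas_expQuot t.2) (absD u))).re) l
      (𝓝 (inner ℂ w (absD u)).re) := by
    have hc : Continuous fun v : L2R => (inner ℂ w v).re :=
      Complex.continuous_re.comp (continuous_const.inner continuous_id)
    exact (hc.tendsto _).comp ((tendsto_fourierMul_expQuot (absD u)).mono_left
      (comap_mono nhdsWithin_le_nhds))
  refine ge_of_tendsto h1 ?_
  have hmem : ∀ᶠ t : ℝ in 𝓝[>] 0, 0 < t ∧ t < 1 := Ioo_mem_nhdsGT one_pos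
  filter_upwards [hmem.comap Subtype.val] with t ht
  have h2 := h t.1 ht.1 ht.2
  rw [sub_poissonOp_eq, inner_smul_right, Complex.re_ofReal_mul] at h2
  exact le_of_mul_le_mul_left h2 ht.1

theorem bddMeas_resolvent_rpow : BddMeas (fun ξ => (Real.sqrt (1 + absSymbol ξ))⁻¹) := by
  have h := continuous_absSymbol
  refine ⟨by fun_prop, 1, fun ξ => ?_⟩
  have h1 : 1 ≤ Real.sqrt (1 + absSymbol ξ) := by
    rw [Real.one_le_sqrt]
    linarith [absSymbol_nonneg ξ]
  rw [abs_of_nonneg (by positivity)]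
  exact inv_le_one_of_one_le₀ h1

/-- The operator `(1 + |D|)^{-1/2}`. -/
noncomputable def sqrtResolvent : L2R →L[ℂ] L2R := fourierMul bddMeas_resolvent_rpow

/-- The square of `sqrtResolvent` is `(1 + |D|)⁻¹`. The square root is kept as a separate operator
so that perturbations can be symmetrised. -/
theorem exists_absD_add_self (f : L2R) :
    ∃ h : sqrtResolvent (sqrtResolvent f) ∈ absD.domain,
      absD ⟨sqrtResolvent (sqrtResolvent f), h⟩ + sqrtResolvent (sqrtResolvent f) = f := by
  have h0 : fourierL2 (sqrtResolvent (sqrtResolvent f)) =ᵐ[volume]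
      fun ξ => ((1 + absSymbol ξ)⁻¹ : ℝ) * fourierL2 f ξ := by
    rw [sqrtResolvent, fourierMul_apply, fourierMul_apply,
      LinearIsometryEquiv.apply_symm_apply, LinearIsometryEquiv.apply_symm_apply, mulL_mulL]
    filter_upwards [coeFn_mulL (bddMeas_resolvent_rpow.mul bddMeas_resolvent_rpow) (fourierL2 f)]
      with ξ h1
    rw [h1, ← mul_inv, Real.mul_self_sqrt (by linarith [absSymbol_nonneg ξ])]
  have hb : BddMeas fun ξ => absSymbol ξ * (1 + absSymbol ξ)⁻¹ := by
    have h := continuous_absSymbol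
    refine ⟨by fun_prop, 1, fun ξ => ?_⟩
    have h1 := absSymbol_nonneg ξ
    rw [abs_of_nonneg (by positivity), ← div_eq_mul_inv, div_le_one (by linarith)]
    linarith
  have hd : sqrtResolvent (sqrtResolvent f) ∈ absD.domain := by
    rw [mem_absD_domain, mem_mulOp_domain]
    refine (hb.memLp (fourierL2 f)).ae_eq ?_
    filter_upwards [h0] with ξ h1
    rw [h1]
    push_cast
    ring
  refine ⟨hd, ?_⟩
  apply fourierL2.injective
  rw [map_add]
  apply Lp.ext
  filter_upwards [Lp.coeFn_add (fourierL2 (absD ⟨sqrtResolvent (sqrtResolvent f), hd⟩))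
    (fourierL2 (sqrtResolvent (sqrtResolvent f))),
    coeFn_fourierL2_absD ⟨sqrtResolvent (sqrtResolvent f), hd⟩, h0] with ξ h1 h2 h3
  rw [h1, Pi.add_apply, h2, h3]
  have h4 : (1 + (absSymbol ξ : ℂ)) ≠ 0 := by
    have := absSymbol_nonneg ξ
    rw [← Complex.ofReal_one, ← Complex.ofReal_add, Complex.ofReal_ne_zero]
    linarith
  rw [Complex.ofReal_inv, Complex.ofReal_add, Complex.ofReal_one]
  field_simp
  ring

/-! ### The Poisson kernel as integral kernel of `e^{-t|D|}`. -/

/-- The Poisson kernel. -/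
noncomputable def cauchyKernel (t x : ℝ) : ℝ := t / (Real.pi * (t ^ 2 + x ^ 2))

theorem cauchyKernel_pos {t : ℝ} (ht : 0 < t) (x : ℝ) : 0 < cauchyKernel t x := by
  have := Real.pi_pos
  unfold cauchyKernel
  positivity

theorem cauchyKernel_neg (t x : ℝ) : cauchyKernel t (-x) = cauchyKernel t x := by
  unfold cauchyKernel
  rw [neg_sq]

theorem continuous_cauchyKernel {t : ℝ} (ht : 0 < t) : Continuous (cauchyKernel t) := by
  have := Real.pi_pos
  unfold cauchyKernel
  refine continuous_const.div (by fun_prop) fun x => ?_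
  positivity

theorem integrable_cauchyKernel {t : ℝ} (ht : 0 < t) : Integrable (cauchyKernel t) := by
  have h := (integrable_inv_one_add_sq.comp_div ht.ne').const_mul (1 / (Real.pi * t))
  refine h.congr (Eventually.of_forall fun x => ?_)
  have := Real.pi_pos
  simp only [cauchyKernel]
  field_simp

theorem cauchyKernel_le {t : ℝ} (ht : 0 < t) (x : ℝ) :
    cauchyKernel t x ≤ 1 / (Real.pi * t) := by
  have := Real.pi_pos
  unfold cauchyKernel
  rw [div_le_div_iff₀ (by positivity) (by positivity)]
  nlinarith [sq_nonneg x, mul_nonneg this.le (sq_nonneg x)]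

theorem memLp_cauchyKernel {t : ℝ} (ht : 0 < t) (x : ℝ) :
    MemLp (fun y => (cauchyKernel t (y - x) : ℂ)) 2 volume := by
  have h1 : MemLp (fun y => cauchyKernel t (y - x)) 2 volume := by
    have hc : Continuous fun y => cauchyKernel t (y - x) :=
      (continuous_cauchyKernel ht).comp (continuous_id.sub continuous_const)
    rw [memLp_two_iff_integrable_sq hc.aestronglyMeasurable]
    refine (((integrable_cauchyKernel ht).comp_sub_right x).const_mul (1 / (Real.pi * t))).mono'
      (hc.pow 2).aestronglyMeasurable ?_
    refine Eventually.of_forall fun y => ?_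
    rw [Real.norm_of_nonneg (sq_nonneg _), sq]
    exact mul_le_mul_of_nonneg_right (cauchyKernel_le ht _) (cauchyKernel_pos ht _).le
  exact h1.ofReal

/-- The Poisson kernel centered at `x`, as an element of `L²`. -/
noncomputable def poissonVec {t : ℝ} (ht : 0 < t) (x : ℝ) : L2R := (memLp_cauchyKernel ht x).toLp

theorem coeFn_poissonVec {t : ℝ} (ht : 0 < t) (x : ℝ) :
    poissonVec ht x =ᵐ[volume] fun y => (cauchyKernel t (y - x) : ℂ) :=
  (memLp_cauchyKernel ht x).coeFn_toLp

theorem inner_poissonVec {t : ℝ} (ht : 0 < t) (x : ℝ) (u : L2R) :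
    inner ℂ (poissonVec ht x) u = ∫ y, (cauchyKernel t (x - y) : ℂ) * u y := by
  rw [inner_eq_integral]
  refine integral_congr_ae ?_
  filter_upwards [coeFn_poissonVec ht x] with y hy
  rw [hy, Complex.conj_ofReal, ← neg_sub, cauchyKernel_neg]

/-- The kernels are translates of one `L²` function, and translation acts continuously on `L²`.
Compactness of the cut-off Poisson operator rests on this. -/
theorem continuous_poissonVec {t : ℝ} (ht : 0 < t) : Continuous (poissonVec ht) := by
  have h : poissonVec ht = fun x : ℝ => DomAddAct.mk (-x) +ᵥ poissonVec ht 0 := by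
    funext x
    apply Lp.ext
    have h1 := (measurePreserving_add_left volume (-x)).quasiMeasurePreserving.ae_eq_comp
      (coeFn_poissonVec ht 0)
    filter_upwards [coeFn_poissonVec ht x,
      DomAddAct.vadd_Lp_ae_eq (DomAddAct.mk (-x)) (poissonVec ht 0), h1] with y h2 h3 h4
    rw [h2, h3]
    simp only [Function.comp_apply, sub_zero] at h4
    simp only [Equiv.symm_apply_apply, vadd_eq_add]
    rw [h4, neg_add_eq_sub]
  rw [h]
  have h2 : Continuous fun x : ℝ => DomAddAct.mk (-x) :=
    DomAddAct.continuous_mk.comp continuous_neg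
  have : Fact ((2 : ℝ≥0∞) ≠ ∞) := ⟨by norm_num⟩
  exact h2.vadd continuous_const

theorem integrable_exp_absSymbol {t : ℝ} (ht : 0 < t) :
    Integrable (fun ξ => (Real.exp (-(t * absSymbol ξ)) : ℂ)) := by
  have h2 : 0 < t * (2 * Real.pi) := by positivity
  have h3 : Integrable (fun ξ => Real.exp (-(t * absSymbol ξ))) := by
    rw [← integrableOn_univ, ← Set.Iic_union_Ioi (a := (0 : ℝ)), integrableOn_union]
    constructor
    · refine (integrableOn_exp_mul_Iic h2 0).congr_fun (fun ξ hξ => ?_) measurableSet_Iic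
      simp only [absSymbol, abs_of_nonpos (Set.mem_Iic.1 hξ)]
      ring_nf
    · refine (integrableOn_exp_mul_Ioi (neg_lt_zero.2 h2) 0).congr_fun (fun ξ hξ => ?_)
        measurableSet_Ioi
      simp only [absSymbol, abs_of_pos (Set.mem_Ioi.1 hξ)]
      ring_nf
  exact h3.ofReal

/-- Splitting the integral at `0` gives two exponential integrals, whose sum is `1 / (2π(t - ix)) +
1 / (2π(t + ix))`. -/
theorem fourier_exp_absSymbol {t : ℝ} (ht : 0 < t) (x : ℝ) :
    𝓕 (fun ξ : ℝ => (Real.exp (-(t * absSymbol ξ)) : ℂ)) x = cauchyKernel t x := by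
  have hpi := Real.pi_pos
  have h2 : 0 < t * (2 * Real.pi) := by positivity
  rw [Real.fourier_real_eq_integral_exp_smul]
  set f : ℝ → ℂ := fun v => Complex.exp (((-2 * Real.pi * v * x : ℝ) : ℂ) * Complex.I) •
    (Real.exp (-(t * absSymbol v)) : ℂ) with hf
  have hint : Integrable f := by
    refine (integrable_exp_absSymbol ht).bdd_mul (c := 1) (by fun_prop) ?_
    refine Eventually.of_forall fun v => ?_
    rw [Complex.norm_exp_ofReal_mul_I]
  rw [← intervalIntegral.integral_Iic_add_Ioi (b := (0 : ℝ)) hint.integrableOn hint.integrableOn]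
  have hI : ∫ v in Set.Ioi (0 : ℝ), f v =
      - Complex.exp ((-(2 * Real.pi * t) - 2 * Real.pi * x * Complex.I : ℂ) * (0 : ℝ)) /
        (-(2 * Real.pi * t) - 2 * Real.pi * x * Complex.I : ℂ) := by
    rw [← integral_exp_mul_complex_Ioi]
    · refine setIntegral_congr_fun measurableSet_Ioi fun v hv => ?_
      simp only [hf, absSymbol, abs_of_pos (Set.mem_Ioi.1 hv), smul_eq_mul, Complex.ofReal_exp]
      rw [← Complex.exp_add]
      congr 1
      push_cast
      ring
    · simp
      positivity
  have hJ : ∫ v in Set.Iic (0 : ℝ), f v =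
      Complex.exp (((2 * Real.pi * t) - 2 * Real.pi * x * Complex.I : ℂ) * (0 : ℝ)) /
        ((2 * Real.pi * t) - 2 * Real.pi * x * Complex.I : ℂ) := by
    rw [← integral_exp_mul_complex_Iic]
    · refine setIntegral_congr_fun measurableSet_Iic fun v hv => ?_
      simp only [hf, absSymbol, abs_of_nonpos (Set.mem_Iic.1 hv), smul_eq_mul, Complex.ofReal_exp]
      rw [← Complex.exp_add]
      congr 1
      push_cast
      ring
    · simp
      positivity
  rw [hI, hJ]
  have e1 : (-(2 * Real.pi * t) - 2 * Real.pi * x * Complex.I : ℂ) ≠ 0 := by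
    intro h
    have := congrArg Complex.re h
    simp [hpi.ne', ht.ne'] at this
  have e2 : ((2 * Real.pi * t) - 2 * Real.pi * x * Complex.I : ℂ) ≠ 0 := by
    intro h
    have := congrArg Complex.re h
    simp [hpi.ne', ht.ne'] at this
  have e3 : (Real.pi * (t ^ 2 + x ^ 2) : ℂ) ≠ 0 := by
    have : (0 : ℝ) < Real.pi * (t ^ 2 + x ^ 2) := by positivity
    exact_mod_cast this.ne'
  unfold cauchyKernel
  push_cast
  simp only [mul_zero, Complex.exp_zero]
  rw [div_add_div _ _ e2 e1, div_eq_div_iff (mul_ne_zero e2 e1) e3]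
  ring_nf
  simp only [Complex.I_sq]
  ring

/-- The multiplication formula moves the Fourier transform from `φ` onto the modulated exponential,
where it produces the translated kernel. -/
theorem fourierInv_exp_absSymbol_mul {t : ℝ} (ht : 0 < t) (φ : SchwartzMap ℝ ℂ) (x : ℝ) :
    𝓕⁻ (fun ξ : ℝ => (Real.exp (-(t * absSymbol ξ)) : ℂ) * 𝓕 φ ξ) x =
      ∫ y, (cauchyKernel t (x - y) : ℂ) * φ y := by
  rw [Real.fourierInv_eq]
  set g : ℝ → ℂ := fun ξ => (Real.fourierChar (ξ * x) : ℂ) * (Real.exp (-(t * absSymbol ξ)) : ℂ)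
    with hg
  have hchar : Continuous fun ξ : ℝ => (Real.fourierChar (ξ * x) : ℂ) := by
    simp only [Real.fourierChar_apply]
    fun_prop
  have hb : ∀ ξ : ℝ, ‖(Real.fourierChar (ξ * x) : ℂ)‖ ≤ 1 := fun ξ => (Circle.norm_coe _).le
  have hgi : Integrable g :=
    (integrable_exp_absSymbol ht).bdd_mul (c := 1) hchar.aestronglyMeasurable
      (Eventually.of_forall hb)
  have h1 := VectorFourier.integral_bilin_fourierIntegral_eq_flip (ContinuousLinearMap.mul ℂ ℂ)
    (L := innerₗ ℝ) Real.continuous_fourierChar continuous_inner (φ.integrable (μ := volume)) hgi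
  have h2 : ∀ y, VectorFourier.fourierIntegral Real.fourierChar volume (innerₗ ℝ).flip g y =
      (cauchyKernel t (x - y) : ℂ) := by
    intro y
    rw [← neg_sub, cauchyKernel_neg, ← fourier_exp_absSymbol ht (y - x), Real.fourier_real_eq]
    unfold VectorFourier.fourierIntegral
    refine integral_congr_ae (Eventually.of_forall fun ξ => ?_)
    simp only [hg, LinearMap.flip_apply, innerₗ_apply_apply, Circle.smul_def, smul_eq_mul,
      RCLike.inner_apply, conj_trivial]
    rw [← mul_assoc, ← Circle.coe_mul, ← AddChar.map_add_eq_mul]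
    congr 4
    ring
  calc _ = ∫ ξ, (ContinuousLinearMap.mul ℂ ℂ)
        (VectorFourier.fourierIntegral Real.fourierChar volume (innerₗ ℝ) φ ξ) (g ξ) := by
        refine integral_congr_ae (Eventually.of_forall fun ξ => ?_)
        have : 𝓕 φ ξ = VectorFourier.fourierIntegral Real.fourierChar volume (innerₗ ℝ) φ ξ := by
          rw [SchwartzMap.fourier_coe]
          rfl
        simp only [this, hg, ContinuousLinearMap.mul_apply', Circle.smul_def, smul_eq_mul,
          RCLike.inner_apply, conj_trivial]
        rw [mul_comm x ξ]
        ring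
    _ = _ := by
        rw [h1]
        refine integral_congr_ae (Eventually.of_forall fun y => ?_)
        simp only [h2, ContinuousLinearMap.mul_apply']
        ring

theorem fourierL2_toLp (φ : SchwartzMap ℝ ℂ) : fourierL2 (φ.toLp 2) = (𝓕 φ).toLp 2 :=
  SchwartzMap.toLp_fourier_eq φ

theorem poissonOp_schwartz {t : ℝ} (ht : 0 < t) (φ : SchwartzMap ℝ ℂ) :
    poissonOp ht.le (φ.toLp 2) =ᵐ[volume]
      fun x => ∫ y, (cauchyKernel t (x - y) : ℂ) * φ y := by
  set G : ℝ → ℂ := fun ξ => (Real.exp (-(t * absSymbol ξ)) : ℂ) * 𝓕 φ ξ with hG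
  have hGi : Integrable G := by
    refine (𝓕 φ).integrable.bdd_mul (c := 1) ?_ ?_
    · exact (integrable_exp_absSymbol ht).aestronglyMeasurable
    · refine Eventually.of_forall fun ξ => ?_
      rw [Complex.norm_real, Real.norm_of_nonneg (Real.exp_pos _).le, Real.exp_le_one_iff,
        neg_nonpos]
      exact mul_nonneg ht.le (absSymbol_nonneg ξ)
  have hcont : Continuous (𝓕⁻ G) :=
    VectorFourier.fourierIntegral_continuous Real.continuous_fourierChar (L := -innerₗ ℝ)
      (by exact continuous_inner.neg) hGi
  have h1 : ∀ᵐ x, poissonOp ht.le (φ.toLp 2) x = 𝓕⁻ G x := by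
    -- The `L²` Fourier transform is not given by an integral, so the `L²` inverse is compared with
    -- the integral inverse by pairing both with smooth compactly supported functions: unitarity on
    -- one side, Fubini on the other.
    refine ae_eq_of_integral_contDiff_smul_eq ((Lp.memLp _).locallyIntegrable (by norm_num))
      hcont.locallyIntegrable fun g hg hgs => ?_
    have hg' : ContDiff ℝ ((⊤ : ℕ∞) : WithTop ℕ∞) (fun x => (g x : ℂ)) :=
      Complex.ofRealCLM.contDiff.comp hg
    have hgs' : HasCompactSupport (fun x => (g x : ℂ)) := hgs.comp_left Complex.ofReal_zero
    obtain ⟨ψ, hψx⟩ : ∃ ψ : SchwartzMap ℝ ℂ, ∀ x, ψ x = (g x : ℂ) :=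
      ⟨hgs'.toSchwartzMap hg', fun x => rfl⟩
    have e1 : ∫ x, g x • poissonOp ht.le (φ.toLp 2) x =
        inner ℂ (ψ.toLp 2) (poissonOp ht.le (φ.toLp 2)) := by
      rw [inner_eq_integral]
      refine integral_congr_ae ?_
      filter_upwards [ψ.coeFn_toLp 2] with x hx
      rw [hx, hψx, Complex.conj_ofReal, Complex.real_smul]
    have e2 : inner ℂ (ψ.toLp 2) (poissonOp ht.le (φ.toLp 2)) =
        ∫ ξ, (starRingEnd ℂ) (𝓕 ψ ξ) * G ξ := by
      rw [poissonOp, fourierMul_apply, inner_fourierL2_symm_right, inner_eq_integral]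
      rw [fourierL2_toLp, fourierL2_toLp]
      refine integral_congr_ae ?_
      filter_upwards [(𝓕 ψ).coeFn_toLp 2, (𝓕 φ).coeFn_toLp 2,
        coeFn_mulL (bddMeas_exp_absSymbol ht.le) ((𝓕 φ).toLp 2)] with ξ h1 h2 h3
      rw [h1, h3, h2]
    have e3 := VectorFourier.integral_sesq_fourierIntegral_eq_neg_flip (innerSL ℂ (E := ℂ))
      (L := innerₗ ℝ) Real.continuous_fourierChar continuous_inner (ψ.integrable (μ := volume)) hGi
    rw [e1, e2]
    calc _ = ∫ ξ, (innerSL ℂ (E := ℂ))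
          (VectorFourier.fourierIntegral Real.fourierChar volume (innerₗ ℝ) ψ ξ) (G ξ) := by
          refine integral_congr_ae (Eventually.of_forall fun ξ => ?_)
          have : 𝓕 ψ ξ = VectorFourier.fourierIntegral Real.fourierChar volume (innerₗ ℝ) ψ ξ := by
            rw [SchwartzMap.fourier_coe]
            rfl
          simp only [this, innerSL_apply_apply, RCLike.inner_apply]
          ring
      _ = _ := by
          rw [e3]
          refine integral_congr_ae (Eventually.of_forall fun x => ?_)
          have : VectorFourier.fourierIntegral Real.fourierChar volume (-(innerₗ ℝ).flip) G x =
              𝓕⁻ G x := by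
            rw [Real.fourierInv_eq]
            unfold VectorFourier.fourierIntegral
            refine integral_congr_ae (Eventually.of_forall fun ξ => ?_)
            simp
          simp only [this, innerSL_apply_apply, RCLike.inner_apply, hψx, Complex.conj_ofReal,
            Complex.real_smul]
          ring
  filter_upwards [h1] with x hx
  rw [hx]
  exact fourierInv_exp_absSymbol_mul ht φ x

/-- Density of Schwartz functions: the left side converges almost everywhere along a subsequence,
and the right side converges for every `x` because it is a continuous functional of `u`. -/
theorem coeFn_poissonOp {t : ℝ} (ht : 0 < t) (u : L2R) :
    poissonOp ht.le u =ᵐ[volume] fun x => inner ℂ (poissonVec ht x) u := by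
  obtain ⟨w, hw, hlim⟩ := mem_closure_iff_seq_limit.1
    ((SchwartzMap.denseRange_toLpCLM (E := ℝ) (F := ℂ) (μ := volume) (p := 2)
      ENNReal.ofNat_ne_top) u)
  choose φ hφ using hw
  have hφ' : ∀ n, w n = (φ n).toLp 2 := fun n => (hφ n).symm
  have h1 : Tendsto (fun n => poissonOp ht.le (w n)) atTop (𝓝 (poissonOp ht.le u)) :=
    ((poissonOp ht.le).continuous.tendsto u).comp hlim
  obtain ⟨ns, hns, hae⟩ := (tendstoInMeasure_of_tendsto_Lp h1).exists_seq_tendsto_ae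
  have h2 : ∀ᵐ x, ∀ n, poissonOp ht.le (w n) x = inner ℂ (poissonVec ht x) (w n) := by
    rw [ae_all_iff]
    intro n
    rw [hφ' n]
    filter_upwards [poissonOp_schwartz ht (φ n)] with x hx
    rw [hx, inner_poissonVec]
    refine integral_congr_ae ?_
    filter_upwards [(φ n).coeFn_toLp 2] with y hy
    rw [hy]
  filter_upwards [hae, h2] with x hx1 hx2
  simp only [hx2] at hx1
  refine tendsto_nhds_unique hx1 ?_
  have hc : Continuous fun v : L2R => inner ℂ (poissonVec ht x) v :=
    continuous_const.inner continuous_id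
  exact ((hc.tendsto u).comp hlim).comp hns.tendsto_atTop

/-! ### Quadratic forms of convolution kernels and the double commutator. -/

theorem integrable_kernel_mul_right {k f : ℝ → ℝ} (hk : Integrable k) (hf : Integrable f) :
    Integrable (fun p : ℝ × ℝ => k (p.1 - p.2) * f p.2) := by
  have := hf.convolution_integrand (ContinuousLinearMap.mul ℝ ℝ) hk
  refine this.congr (Eventually.of_forall fun p => ?_)
  simp only [ContinuousLinearMap.mul_apply']
  ring

theorem integral_kernel_mul_right {k f : ℝ → ℝ} (hk : Integrable k) (hf : Integrable f) :
    ∫ p : ℝ × ℝ, k (p.1 - p.2) * f p.2 = (∫ x, k x) * ∫ x, f x := by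
  have h := integral_convolution (ContinuousLinearMap.mul ℝ ℝ) hf hk
  rw [Measure.volume_eq_prod, integral_prod _ (integrable_kernel_mul_right hk hf)]
  simp only [convolution_def, ContinuousLinearMap.mul_apply'] at h
  rw [mul_comm, ← h]
  refine integral_congr_ae (Eventually.of_forall fun x => ?_)
  simp only [mul_comm]

theorem integrable_kernel_mul_left {k f : ℝ → ℝ} (hk : Integrable k) (hf : Integrable f) :
    Integrable (fun p : ℝ × ℝ => k (p.1 - p.2) * f p.1) := by
  have := (integrable_kernel_mul_right hk.comp_neg hf).swap
  refine this.congr (Eventually.of_forall fun p => ?_)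
  simp

theorem integral_kernel_mul_left {k f : ℝ → ℝ} (hk : Integrable k) (hf : Integrable f) :
    ∫ p : ℝ × ℝ, k (p.1 - p.2) * f p.1 = (∫ x, k x) * ∫ x, f x := by
  have h := integral_kernel_mul_right hk.comp_neg hf
  rw [integral_neg_eq_self k volume] at h
  rw [← h, Measure.volume_eq_prod, ← integral_prod_swap]
  simp

theorem integrable_kernel_form {k f g : ℝ → ℝ} (hk : Integrable k) (hk0 : ∀ x, 0 ≤ k x)
    (hf : MemLp f 2 volume) (hg : MemLp g 2 volume) :
    Integrable (fun p : ℝ × ℝ => k (p.1 - p.2) * (f p.1 * g p.2)) := by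
  refine ((integrable_kernel_mul_left hk hf.integrable_sq).add
    (integrable_kernel_mul_right hk hg.integrable_sq)).mono' ?_ ?_
  · have hkm : AEStronglyMeasurable (fun p : ℝ × ℝ => k (p.1 - p.2)) (volume.prod volume) :=
      hk.1.comp_quasiMeasurePreserving (quasiMeasurePreserving_sub volume volume)
    exact hkm.mul ((hf.1.comp_fst (ν := volume)).mul (hg.1.comp_snd (μ := volume)))
  · refine Eventually.of_forall fun p => ?_
    rw [norm_mul, Real.norm_of_nonneg (hk0 _), Pi.add_apply, ← mul_add]
    refine mul_le_mul_of_nonneg_left ?_ (hk0 _)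
    rw [Real.norm_eq_abs, abs_le]
    constructor <;> nlinarith [sq_nonneg (f p.1 + g p.2), sq_nonneg (f p.1 - g p.2)]

/-- Schur's test, from `2 f(x) f(y) ≤ f(x)² + f(y)²`. -/
theorem integral_kernel_form_le {k f : ℝ → ℝ} (hk : Integrable k) (hk0 : ∀ x, 0 ≤ k x)
    (hf : MemLp f 2 volume) :
    ∫ p : ℝ × ℝ, k (p.1 - p.2) * (f p.1 * f p.2) ≤ (∫ x, k x) * ∫ x, f x ^ 2 := by
  have h1 := integrable_kernel_mul_left hk hf.integrable_sq
  have h2 := integrable_kernel_mul_right hk hf.integrable_sq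
  have h3 : ∫ p : ℝ × ℝ, (1 / 2 : ℝ) * (k (p.1 - p.2) * f p.1 ^ 2 + k (p.1 - p.2) * f p.2 ^ 2) =
      (∫ x, k x) * ∫ x, f x ^ 2 := by
    rw [integral_const_mul, integral_add h1 h2, integral_kernel_mul_left hk hf.integrable_sq,
      integral_kernel_mul_right hk hf.integrable_sq]
    ring
  rw [← h3]
  refine integral_mono (integrable_kernel_form hk hk0 hf hf) ((h1.add h2).const_mul _) fun p => ?_
  have := mul_nonneg (hk0 (p.1 - p.2)) (sq_nonneg (f p.1 - f p.2))
  simp only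
  nlinarith

theorem memLp_norm (u : L2R) : MemLp (fun x => ‖u x‖) 2 volume := (Lp.memLp u).norm

theorem integrable_poisson_form {t : ℝ} (ht : 0 < t) (w u : L2R) :
    Integrable (fun p : ℝ × ℝ =>
      (cauchyKernel t (p.1 - p.2) : ℂ) * ((starRingEnd ℂ) (w p.1) * u p.2)) := by
  refine (integrable_kernel_form (integrable_cauchyKernel ht)
    (fun x => (cauchyKernel_pos ht x).le) (memLp_norm w) (memLp_norm u)).mono ?_ ?_
  · have hkm : AEStronglyMeasurable (fun p : ℝ × ℝ => (cauchyKernel t (p.1 - p.2) : ℂ))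
        (volume.prod volume) :=
      (Complex.continuous_ofReal.comp ((continuous_cauchyKernel ht).comp
        (continuous_fst.sub continuous_snd))).aestronglyMeasurable
    refine hkm.mul (AEStronglyMeasurable.mul ?_ ?_)
    · exact Complex.continuous_conj.comp_aestronglyMeasurable
        ((Lp.aestronglyMeasurable w).comp_fst (ν := volume))
    · exact (Lp.aestronglyMeasurable u).comp_snd (μ := volume)
  · refine Eventually.of_forall fun p => ?_
    simp only [norm_mul, Complex.norm_real, RCLike.norm_conj, norm_norm]
    exact le_rfl

theorem inner_poissonOp {t : ℝ} (ht : 0 < t) (w u : L2R) :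
    inner ℂ w (poissonOp ht.le u) = ∫ p : ℝ × ℝ,
      (cauchyKernel t (p.1 - p.2) : ℂ) * ((starRingEnd ℂ) (w p.1) * u p.2) := by
  rw [Measure.volume_eq_prod, integral_prod _ (integrable_poisson_form ht w u), inner_eq_integral]
  refine integral_congr_ae ?_
  filter_upwards [coeFn_poissonOp ht u] with x hx
  rw [hx, inner_poissonVec, ← integral_const_mul]
  refine integral_congr_ae (Eventually.of_forall fun y => ?_)
  simp only
  ring

theorem re_inner_poissonOp {t : ℝ} (ht : 0 < t) (w u : L2R) :
    (inner ℂ w (poissonOp ht.le u)).re = ∫ p : ℝ × ℝ,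
      cauchyKernel t (p.1 - p.2) * ((starRingEnd ℂ) (w p.1) * u p.2).re := by
  rw [inner_poissonOp ht]
  refine (integral_re (𝕜 := ℂ) (integrable_poisson_form ht w u)).symm.trans ?_
  refine integral_congr_ae (Eventually.of_forall fun p => ?_)
  exact Complex.re_ofReal_mul _ _

theorem integrable_re_poisson_form {t : ℝ} (ht : 0 < t) (w u : L2R) :
    Integrable (fun p : ℝ × ℝ =>
      cauchyKernel t (p.1 - p.2) * ((starRingEnd ℂ) (w p.1) * u p.2).re) := by
  refine (integrable_poisson_form ht w u).re.congr (Eventually.of_forall fun p => ?_)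
  exact Complex.re_ofReal_mul _ _

theorem ae_fst {P : ℝ → Prop} (h : ∀ᵐ x, P x) : ∀ᵐ p : ℝ × ℝ, P p.1 :=
  Measure.quasiMeasurePreserving_fst.ae h

theorem ae_snd {P : ℝ → Prop} (h : ∀ᵐ x, P x) : ∀ᵐ p : ℝ × ℝ, P p.2 :=
  Measure.quasiMeasurePreserving_snd.ae h

/-- The double commutator estimate for `e^{-t|D|}` and a multiplication operator. -/
theorem re_inner_mulL_sq_sub_poissonOp {t : ℝ} (ht : 0 < t) {h : ℝ → ℝ} (hh : BddMeas h)
    (u : L2R) {B : ℝ × ℝ → ℝ} (hB : Integrable B)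
    (hle : ∀ x y, cauchyKernel t (x - y) * (h x - h y) ^ 2 * (‖u x‖ * ‖u y‖) ≤ B (x, y)) :
    -(1 / 2) * ∫ p, B p ≤ (inner ℂ (mulL (hh.mul hh) u) (u - poissonOp ht.le u)).re := by
  set H := mulL hh u with hH
  set W := mulL (hh.mul hh) u with hW
  have e1 : (inner ℂ W u).re = ‖H‖ ^ 2 := by
    rw [hW, ← mulL_mulL, inner_mulL_left]
    exact inner_self_eq_norm_sq (𝕜 := ℂ) H
  have e2 : (inner ℂ H (poissonOp ht.le H)).re ≤ ‖H‖ ^ 2 := by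
    refine (Complex.re_le_norm _).trans ((norm_inner_le_norm _ _).trans ?_)
    rw [sq]
    exact mul_le_mul_of_nonneg_left (norm_poissonOp_le ht.le H) (norm_nonneg _)
  have hWae := coeFn_mulL (hh.mul hh) u
  have hHae := coeFn_mulL hh u
  set I : ℝ × ℝ → ℝ := fun p => cauchyKernel t (p.1 - p.2) * ((starRingEnd ℂ) (W p.1) * u p.2).re
    with hI
  have hIi : Integrable I := integrable_re_poisson_form ht W u
  have hIs : Integrable (fun p : ℝ × ℝ => I p.swap) := hIi.swap
  have e3 : ∫ p : ℝ × ℝ, I p.swap = ∫ p, I p := by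
    rw [Measure.volume_eq_prod]
    exact integral_prod_swap I
  -- Symmetrising in `(x, y)` replaces the weight `h(x)²` by `h(x)² + h(y)² = 2 h(x) h(y) + (h(x) -
  -- h(y))²`. The cross term is the form of the contraction `e^{-t|D|}` at `h u`, and the square is
  -- the error bounded by `B`.
  have e4 : 2 * (inner ℂ W (poissonOp ht.le u)).re ≤
      2 * (inner ℂ H (poissonOp ht.le H)).re + ∫ p, B p := by
    have f1 : 2 * (inner ℂ W (poissonOp ht.le u)).re = ∫ p, (I p + I p.swap) := by
      rw [integral_add hIi hIs, e3, re_inner_poissonOp ht]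
      ring
    have f2 : 2 * (inner ℂ H (poissonOp ht.le H)).re + ∫ p, B p = ∫ p : ℝ × ℝ,
        (2 * (cauchyKernel t (p.1 - p.2) * ((starRingEnd ℂ) (H p.1) * H p.2).re) + B p) := by
      rw [integral_add ((integrable_re_poisson_form ht H H).const_mul 2) hB, integral_const_mul,
        re_inner_poissonOp ht]
    rw [f1, f2]
    refine integral_mono_ae (hIi.add hIs)
      (((integrable_re_poisson_form ht H H).const_mul 2).add hB) ?_
    filter_upwards [ae_fst hWae, ae_snd hWae, ae_fst hHae, ae_snd hHae] with p g1 g2 g3 g4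
    simp only [hI, Prod.swap]
    have g5 : cauchyKernel t (p.2 - p.1) = cauchyKernel t (p.1 - p.2) := by
      rw [← neg_sub, cauchyKernel_neg]
    rw [g1, g2, g3, g4, g5]
    have g6 := hle p.1 p.2
    have g7 : ((starRingEnd ℂ) (u p.1) * u p.2).re ≤ ‖u p.1‖ * ‖u p.2‖ := by
      refine (Complex.re_le_norm _).trans ?_
      rw [norm_mul, RCLike.norm_conj]
    set a := h p.1
    set b := h p.2
    set z := u p.1
    set w := u p.2
    set k := cauchyKernel t (p.1 - p.2)
    have hk : 0 ≤ k := (cauchyKernel_pos ht _).le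
    have i1 : ((starRingEnd ℂ) (((a * a : ℝ) : ℂ) * z) * w).re =
        a * a * ((starRingEnd ℂ) z * w).re := by
      rw [map_mul, Complex.conj_ofReal, mul_assoc, Complex.re_ofReal_mul]
    have i2 : ((starRingEnd ℂ) (((b * b : ℝ) : ℂ) * w) * z).re =
        b * b * ((starRingEnd ℂ) z * w).re := by
      rw [map_mul, Complex.conj_ofReal, mul_assoc, Complex.re_ofReal_mul]
      congr 1
      simp only [Complex.mul_re, Complex.conj_re, Complex.conj_im]
      ring
    have i3 : ((starRingEnd ℂ) ((a : ℂ) * z) * ((b : ℂ) * w)).re =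
        a * b * ((starRingEnd ℂ) z * w).re := by
      rw [map_mul, Complex.conj_ofReal, show (a : ℂ) * (starRingEnd ℂ) z * ((b : ℂ) * w) =
        ((a * b : ℝ) : ℂ) * ((starRingEnd ℂ) z * w) by push_cast; ring, Complex.re_ofReal_mul]
    rw [i1, i2, i3]
    have i4 : k * (a - b) ^ 2 * ((starRingEnd ℂ) z * w).re ≤ k * (a - b) ^ 2 * (‖z‖ * ‖w‖) :=
      mul_le_mul_of_nonneg_left g7 (mul_nonneg hk (sq_nonneg _))
    have i5 := i4.trans g6
    have i6 : k * (a * a * ((starRingEnd ℂ) z * w).re) + k * (b * b * ((starRingEnd ℂ) z * w).re) =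
        2 * (k * (a * b * ((starRingEnd ℂ) z * w).re)) +
          k * (a - b) ^ 2 * ((starRingEnd ℂ) z * w).re := by ring
    rw [i6]
    linarith
  rw [inner_sub_right, Complex.sub_re, e1]
  linarith

/-! ### Slowly varying weights and the weighted lower bound for `|D|`. -/

theorem one_add_pow_le {z : ℝ} (h0 : 0 ≤ z) (h1 : z ≤ 1) (N : ℕ) :
    (1 + z) ^ N ≤ 1 + (2 ^ N - 1) * z := by
  induction N with
  | zero => simp
  | succ n ih =>
    have h2 : (1 : ℝ) ≤ 2 ^ n := one_le_pow₀ (by norm_num)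
    have h3 : (1 + z) * (1 + z) ^ n ≤ (1 + z) * (1 + (2 ^ n - 1) * z) :=
      mul_le_mul_of_nonneg_left ih (by linarith)
    have h4 : 0 ≤ (2 ^ n - 1) * (z * (1 - z)) :=
      mul_nonneg (by linarith) (mul_nonneg h0 (by linarith))
    rw [pow_succ', pow_succ']
    nlinarith

/-- Slowly varying weights `h ≥ 1`. -/
structure SlowWeight (N : ℕ) (h : ℝ → ℝ) : Prop where
  one_le : ∀ x, 1 ≤ h x
  le_mul : ∀ x y, h y ≤ h x * (1 + |x - y|) ^ N

/-- The form is dictated by the commutator: the factor `(x - y)²` cancels the singularity of the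
Poisson kernel, `(1 + |x - y|) ^ (-3/2)` is an integrable convolution kernel, and the exponent `2 -
1/(2N)`, being less than `2`, makes the remainder subordinate to `‖h² u‖²`. Nearby points use the
Lipschitz-type bound on `h`. For distant points a power `1/(2N)` of the larger value is traded for
`(1 + |x - y|) ^ (1/2)`. -/
theorem SlowWeight.sq_sub_le {N : ℕ} (hN : 1 ≤ N) {h : ℝ → ℝ} (hh : SlowWeight N h) (x y : ℝ) :
    (h x - h y) ^ 2 ≤ 4 ^ (N + 1) * (x - y) ^ 2 * (1 + |x - y|) ^ (-(3 / 2) : ℝ) *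
      (h x ^ (2 - 1 / (2 * N) : ℝ) * h y ^ (2 - 1 / (2 * N) : ℝ)) := by
  wlog hxy : h x ≤ h y generalizing x y
  · have := this y x (le_of_not_ge hxy)
    rw [abs_sub_comm y x, sub_sq_comm y x, sub_sq_comm (h y), mul_comm (h y ^ _)] at this
    exact this
  have hx := hh.one_le x
  have hy := hh.one_le y
  have hN' : (1 : ℝ) ≤ N := by exact_mod_cast hN
  have hd0 : 0 < 1 / (2 * (N : ℝ)) := by positivity
  have hd1 : 1 / (2 * (N : ℝ)) ≤ 1 / 2 := by
    rw [div_le_div_iff₀ (by positivity) (by positivity)]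
    linarith
  set d : ℝ := 1 / (2 * (N : ℝ)) with hd
  set z := |x - y| with hz
  have hz0 : 0 ≤ z := abs_nonneg _
  have hz2 : (x - y) ^ 2 = z ^ 2 := (sq_abs _).symm
  rw [hz2]
  have hxp : h x ≤ h x ^ (2 - d) := by
    conv_lhs => rw [← Real.rpow_one (h x)]
    exact Real.rpow_le_rpow_of_exponent_le hx (by linarith)
  have hyp : h y ≤ h y ^ (2 - d) := by
    conv_lhs => rw [← Real.rpow_one (h y)]
    exact Real.rpow_le_rpow_of_exponent_le hy (by linarith)
  rcases le_total z 1 with h1 | h1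
  · have e1 : h y - h x ≤ 2 ^ N * z * h x := by
      have := hh.le_mul x y
      have h3 := mul_le_mul_of_nonneg_left (one_add_pow_le hz0 h1 N) (by linarith : 0 ≤ h x)
      have h4 : 0 ≤ h x * z := mul_nonneg (by linarith) hz0
      linarith
    have e2 : (h x - h y) ^ 2 ≤ (2 ^ N * z * h x) ^ 2 := by
      rw [sub_sq_comm]
      exact pow_le_pow_left₀ (by linarith) e1 2
    have e3 : (1 / 4 : ℝ) ≤ (1 + z) ^ (-(3 / 2) : ℝ) := by
      have h4 : (1 + z) ^ (3 / 2 : ℝ) ≤ 4 := by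
        calc (1 + z) ^ (3 / 2 : ℝ) ≤ (2 : ℝ) ^ (3 / 2 : ℝ) :=
              Real.rpow_le_rpow (by linarith) (by linarith) (by norm_num)
          _ ≤ (2 : ℝ) ^ (2 : ℝ) := Real.rpow_le_rpow_of_exponent_le (by norm_num) (by norm_num)
          _ = 4 := by norm_num
      rw [Real.rpow_neg (by linarith), one_div]
      exact inv_anti₀ (Real.rpow_pos_of_pos (by linarith) _) h4
    calc (h x - h y) ^ 2 ≤ (2 ^ N * z * h x) ^ 2 := e2
      _ = 4 ^ (N + 1) * z ^ 2 * (1 / 4) * (h x * h x) := by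
          rw [mul_pow, mul_pow, ← pow_mul, mul_comm N 2, pow_mul, pow_succ]
          norm_num
          ring
      _ ≤ 4 ^ (N + 1) * z ^ 2 * (1 + z) ^ (-(3 / 2) : ℝ) * (h x ^ (2 - d) * h y ^ (2 - d)) := by
          gcongr
          exact hxy.trans hyp
  · have e1 : (h x - h y) ^ 2 ≤ h y ^ 2 := by
      rw [sub_sq_comm]
      exact pow_le_pow_left₀ (by linarith) (by linarith) 2
    have e2 : h y ^ 2 = h y ^ (2 - d) * h y ^ d := by
      rw [← Real.rpow_add (by linarith), ← Real.rpow_natCast]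
      congr 1
      push_cast
      ring
    have e3 : h y ^ d ≤ h x ^ d * (1 + z) ^ (1 / 2 : ℝ) := by
      calc h y ^ d ≤ (h x * (1 + z) ^ N) ^ d :=
            Real.rpow_le_rpow (by linarith) (hh.le_mul x y) hd0.le
        _ = h x ^ d * (1 + z) ^ (1 / 2 : ℝ) := by
            rw [Real.mul_rpow (by linarith) (by positivity), ← Real.rpow_natCast,
              ← Real.rpow_mul (by linarith)]
            congr 2
            rw [hd]
            field_simp
    have e4 : h x ^ d ≤ h x ^ (2 - d) := Real.rpow_le_rpow_of_exponent_le hx (by linarith)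
    have e5 : (1 + z) ^ (1 / 2 : ℝ) ≤ 4 ^ (N + 1) * z ^ 2 * (1 + z) ^ (-(3 / 2) : ℝ) := by
      have h5 : (1 + z) ^ (1 / 2 : ℝ) = (1 + z) ^ 2 * (1 + z) ^ (-(3 / 2) : ℝ) := by
        rw [← Real.rpow_natCast (1 + z) 2, ← Real.rpow_add (by linarith)]
        norm_num
      rw [h5]
      refine mul_le_mul_of_nonneg_right ?_ (Real.rpow_nonneg (by linarith) _)
      have h6 : (1 : ℝ) ≤ 4 ^ N := one_le_pow₀ (by norm_num)
      rw [pow_succ 4]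
      nlinarith [mul_nonneg (sub_nonneg.2 h6) (sq_nonneg z)]
    have p1 : 0 ≤ h y ^ (2 - d) := Real.rpow_nonneg (by linarith) _
    have p2 : 0 ≤ (1 + z) ^ (1 / 2 : ℝ) := Real.rpow_nonneg (by linarith) _
    have p3 : 0 ≤ h x ^ (2 - d) := Real.rpow_nonneg (by linarith) _
    calc (h x - h y) ^ 2 ≤ h y ^ (2 - d) * h y ^ d := e2 ▸ e1
      _ ≤ h y ^ (2 - d) * (h x ^ (2 - d) * (1 + z) ^ (1 / 2 : ℝ)) :=
          mul_le_mul_of_nonneg_left (e3.trans (mul_le_mul_of_nonneg_right e4 p2)) p1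
      _ = (1 + z) ^ (1 / 2 : ℝ) * (h x ^ (2 - d) * h y ^ (2 - d)) := by ring
      _ ≤ _ := mul_le_mul_of_nonneg_right e5 (mul_nonneg p3 p1)

/-- The left side is `s ^ (4 - 1/N)`. Beyond the threshold `s = ε⁻¹ ^ N` the missing factor `s ^
(1/N)` is at least `ε⁻¹`; below it the fourth power of the threshold suffices. -/
theorem rpow_le_eps_add {N : ℕ} (hN : 1 ≤ N) {ε s : ℝ} (hε : 0 < ε) (hs : 1 ≤ s) :
    (s ^ (2 - 1 / (2 * N) : ℝ)) ^ 2 ≤ ε * s ^ 4 + (ε⁻¹ ^ N) ^ 4 := by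
  have hN' : (1 : ℝ) ≤ N := by exact_mod_cast hN
  have hs0 : 0 < s := by linarith
  have e1 : (s ^ (2 - 1 / (2 * N) : ℝ)) ^ 2 * s ^ (1 / N : ℝ) = s ^ 4 := by
    rw [← Real.rpow_natCast, ← Real.rpow_mul hs0.le, ← Real.rpow_add hs0, ← Real.rpow_natCast]
    congr 1
    push_cast
    field_simp
    ring
  have p1 : 0 ≤ (s ^ (2 - 1 / (2 * N) : ℝ)) ^ 2 := sq_nonneg _
  have p2 : 0 < s ^ (1 / N : ℝ) := Real.rpow_pos_of_pos hs0 _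
  rcases le_total (ε⁻¹ ^ N) s with h | h
  · have e2 : ε⁻¹ ≤ s ^ (1 / N : ℝ) := by
      have := Real.rpow_le_rpow (by positivity) h (by positivity : (0 : ℝ) ≤ 1 / N)
      rw [one_div] at this ⊢
      rwa [Real.pow_rpow_inv_natCast (by positivity) (by omega)] at this
    have e3 : 1 ≤ ε * s ^ (1 / N : ℝ) := by
      calc (1 : ℝ) = ε * ε⁻¹ := (mul_inv_cancel₀ hε.ne').symm
        _ ≤ _ := mul_le_mul_of_nonneg_left e2 hε.le
    have : (s ^ (2 - 1 / (2 * N) : ℝ)) ^ 2 ≤ ε * s ^ 4 := by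
      rw [← e1]
      nlinarith [mul_le_mul_of_nonneg_left e3 p1]
    have : 0 ≤ (ε⁻¹ ^ N) ^ 4 := by positivity
    linarith
  · have e2 : (1 : ℝ) ≤ s ^ (1 / N : ℝ) := Real.one_le_rpow hs (by positivity)
    have e3 : (s ^ (2 - 1 / (2 * N) : ℝ)) ^ 2 ≤ s ^ 4 := by
      rw [← e1]
      exact le_mul_of_one_le_right p1 e2
    have e4 : s ^ 4 ≤ (ε⁻¹ ^ N) ^ 4 := pow_le_pow_left₀ hs0.le h 4
    have : 0 ≤ ε * s ^ 4 := by positivity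
    linarith

theorem integrable_japanese : Integrable (fun x : ℝ => (1 + |x|) ^ (-(3 / 2) : ℝ)) := by
  have := integrable_one_add_norm (E := ℝ) (μ := volume) (r := 3 / 2) (by norm_num)
  simpa using this

theorem cauchyKernel_mul_sq_le {t : ℝ} (ht : 0 < t) (z : ℝ) : cauchyKernel t z * z ^ 2 ≤ t := by
  have h1 : 1 ≤ Real.pi := by linarith [Real.pi_gt_three]
  have h0 : 0 < t ^ 2 + z ^ 2 := by positivity
  unfold cauchyKernel
  rw [div_mul_eq_mul_div, div_le_iff₀ (by positivity)]
  refine mul_le_mul_of_nonneg_left ?_ ht.le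
  nlinarith [mul_le_mul_of_nonneg_right h1 h0.le, sq_nonneg t]

/-- The constant depends only on `N` and `ε`, not on the bound of `h`. This uniformity is what lets
truncated weights approximate an unbounded one. -/
theorem exists_re_inner_weight_absD {N : ℕ} (hN : 1 ≤ N) {ε : ℝ} (hε : 0 < ε) :
    ∃ C : ℝ, 0 ≤ C ∧ ∀ (h : ℝ → ℝ) (hb : BddMeas h), SlowWeight N h → ∀ u : absD.domain,
      -(ε * ‖mulL (hb.mul hb) (u : L2R)‖ ^ 2 + C * ‖(u : L2R)‖ ^ 2) ≤
        (inner ℂ (mulL (hb.mul hb) (u : L2R)) (absD u)).re := by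
  set k : ℝ → ℝ := fun x => (1 + |x|) ^ (-(3 / 2) : ℝ) with hk
  have hki : Integrable k := integrable_japanese
  have hk0 : ∀ x, 0 ≤ k x := fun x => Real.rpow_nonneg (by positivity) _
  set M : ℝ := 4 ^ (N + 1) * ∫ x, k x with hM
  have hM0 : 0 ≤ M := mul_nonneg (by positivity) (integral_nonneg hk0)
  -- Chosen so that `M * η ≤ ε`, where `M` collects the constant of the commutator bound and the
  -- mass of `k`.
  set η : ℝ := ε / (M + 1) with hη
  have hη0 : 0 < η := by positivity
  refine ⟨M * (η⁻¹ ^ N) ^ 4, by positivity, fun h hb hs u => ?_⟩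
  set v : L2R := (u : L2R) with hv
  set d : ℝ := 2 - 1 / (2 * N) with hd
  have hN' : (1 : ℝ) ≤ N := by exact_mod_cast hN
  have hd0 : 0 ≤ d := by
    have : 1 / (2 * (N : ℝ)) ≤ 1 / 2 := by
      rw [div_le_div_iff₀ (by positivity) (by positivity)]
      linarith
    rw [hd]
    linarith
  have hbd : BddMeas (fun x => h x ^ d) := by
    obtain ⟨K, hK⟩ := hb.bdd
    refine ⟨hb.meas.pow_const d, K ^ d, fun x => ?_⟩
    have h1 := hs.one_le x
    rw [abs_of_nonneg (Real.rpow_nonneg (by linarith) _)]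
    exact Real.rpow_le_rpow (by linarith) ((le_abs_self _).trans (hK x)) hd0
  set F : ℝ → ℝ := fun x => h x ^ d * ‖v x‖ with hF
  have hF2 : MemLp F 2 volume := by
    refine (hbd.memLp v).norm.ae_eq (Eventually.of_forall fun x => ?_)
    have h1 := hs.one_le x
    simp only [hF, norm_mul, Complex.norm_real,
      Real.norm_of_nonneg (Real.rpow_nonneg (by linarith : 0 ≤ h x) d)]
  have hFint : ∫ x, F x ^ 2 ≤ η * ‖mulL (hb.mul hb) v‖ ^ 2 + (η⁻¹ ^ N) ^ 4 * ‖v‖ ^ 2 := by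
    rw [norm_sq_eq_integral, norm_sq_eq_integral v, ← integral_const_mul, ← integral_const_mul,
      ← integral_add ((integrable_norm_sq _).const_mul _) ((integrable_norm_sq _).const_mul _)]
    refine integral_mono_ae hF2.integrable_sq
      (((integrable_norm_sq _).const_mul _).add ((integrable_norm_sq _).const_mul _)) ?_
    filter_upwards [coeFn_mulL (hb.mul hb) v] with x hx
    have e : ‖mulL (hb.mul hb) v x‖ ^ 2 = (h x * h x) ^ 2 * ‖v x‖ ^ 2 := by
      rw [hx, norm_mul, mul_pow, Complex.norm_real, Real.norm_eq_abs, sq_abs]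
    rw [e]
    have := mul_le_mul_of_nonneg_right (rpow_le_eps_add hN hη0 (hs.one_le x)) (sq_nonneg ‖v x‖)
    simp only [hF]
    rw [mul_pow]
    refine this.trans (le_of_eq ?_)
    ring
  -- The commutator bound is linear in `t`, because `cauchyKernel t z * z ^ 2 ≤ t`, so it survives
  -- division by `t` and the limit `t → 0`.
  refine le_re_inner_absD u fun t ht _ => ?_
  have hBi : Integrable (fun p : ℝ × ℝ =>
      t * 4 ^ (N + 1) * (k (p.1 - p.2) * (F p.1 * F p.2))) :=
    (integrable_kernel_form hki hk0 hF2 hF2).const_mul _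
  have key := re_inner_mulL_sq_sub_poissonOp ht hb v hBi (fun x y => by
    have h1 := hs.sq_sub_le hN x y
    have h2 := cauchyKernel_mul_sq_le ht (x - y)
    have h0 := (cauchyKernel_pos ht (x - y)).le
    have p1 : 0 ≤ h x ^ d := Real.rpow_nonneg (by linarith [hs.one_le x]) _
    have p2 : 0 ≤ h y ^ d := Real.rpow_nonneg (by linarith [hs.one_le y]) _
    calc cauchyKernel t (x - y) * (h x - h y) ^ 2 * (‖v x‖ * ‖v y‖)
        ≤ cauchyKernel t (x - y) * (4 ^ (N + 1) * (x - y) ^ 2 * k (x - y) *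
          (h x ^ d * h y ^ d)) * (‖v x‖ * ‖v y‖) := by gcongr
      _ = (cauchyKernel t (x - y) * (x - y) ^ 2) * (4 ^ (N + 1) * (k (x - y) *
          (F x * F y))) := by
          simp only [hF]
          ring
      _ ≤ t * (4 ^ (N + 1) * (k (x - y) * (F x * F y))) := by
          refine mul_le_mul_of_nonneg_right h2 ?_
          have := hk0 (x - y)
          simp only [hF]
          positivity
      _ = t * 4 ^ (N + 1) * (k (x - y) * (F x * F y)) := by ring)
  refine le_trans ?_ key
  rw [integral_const_mul]
  have i1 := integral_kernel_form_le hki hk0 hF2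
  have hF0 : 0 ≤ ∫ x, F x ^ 2 := integral_nonneg fun x => sq_nonneg _
  have i2 : 4 ^ (N + 1) * ∫ p : ℝ × ℝ, k (p.1 - p.2) * (F p.1 * F p.2) ≤
      ε * ‖mulL (hb.mul hb) v‖ ^ 2 + M * (η⁻¹ ^ N) ^ 4 * ‖v‖ ^ 2 := by
    calc _ ≤ 4 ^ (N + 1) * ((∫ x, k x) * ∫ x, F x ^ 2) :=
          mul_le_mul_of_nonneg_left i1 (by positivity)
      _ = M * ∫ x, F x ^ 2 := by rw [hM]; ring
      _ ≤ M * (η * ‖mulL (hb.mul hb) v‖ ^ 2 + (η⁻¹ ^ N) ^ 4 * ‖v‖ ^ 2) :=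
          mul_le_mul_of_nonneg_left hFint hM0
      _ = (M * η) * ‖mulL (hb.mul hb) v‖ ^ 2 + M * (η⁻¹ ^ N) ^ 4 * ‖v‖ ^ 2 := by ring
      _ ≤ _ := by
          have : M * η ≤ ε := by
            rw [hη, mul_div_assoc', div_le_iff₀ (by positivity)]
            nlinarith
          gcongr
  have i3 : 0 ≤ ∫ p : ℝ × ℝ, k (p.1 - p.2) * (F p.1 * F p.2) := by
    refine integral_nonneg fun p => ?_
    have q1 := hk0 (p.1 - p.2)
    have p1 : 0 ≤ h p.1 ^ d := Real.rpow_nonneg (by linarith [hs.one_le p.1]) _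
    have p2 : 0 ≤ h p.2 ^ d := Real.rpow_nonneg (by linarith [hs.one_le p.2]) _
    simp only [hF]
    positivity
  have i4 : 0 ≤ 4 ^ (N + 1) * ∫ p : ℝ × ℝ, k (p.1 - p.2) * (F p.1 * F p.2) := by positivity
  have i5 := mul_le_mul_of_nonneg_left i2 ht.le
  have i6 := mul_nonneg ht.le i4
  linarith

/-! ### Bounded potentials: solvability and a uniform a priori bound. -/

theorem integrable_re_conj_mul (u v : L2R) :
    Integrable (fun x => ((starRingEnd ℂ) (u x) * v x).re) volume :=
  (integrable_conj_mul u v).re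

/-- The equation is `(|D| + 1 + v) u = f` in integrated form. With `S = sqrtResolvent` and `u = S w`
it becomes `(1 + S v S) w = S f`, whose operator is bounded and coercive because `v ≥ 0`. -/
theorem exists_bounded_perturbation {v : ℝ → ℝ} (hv : BddMeas v) (h0 : ∀ x, 0 ≤ v x) (f : L2R) :
    ∃ u : L2R, u = sqrtResolvent (sqrtResolvent (f - mulL hv u)) := by
  set T : L2R →L[ℂ] L2R :=
    ContinuousLinearMap.id ℂ L2R + sqrtResolvent ∘L mulL hv ∘L sqrtResolvent with hT
  have hu : IsUnit T := by
    refine ContinuousLinearMap.isUnit_of_forall_le_norm_inner_map T (c := 1) one_pos fun x => ?_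
    have h1 : (inner ℂ (T x) x).re = ‖x‖ ^ 2 +
        (inner ℂ (mulL hv (sqrtResolvent x)) (sqrtResolvent x)).re := by
      rw [hT]
      simp only [add_apply, ContinuousLinearMap.id_apply,
        ContinuousLinearMap.comp_apply, inner_add_left, Complex.add_re]
      rw [sqrtResolvent, inner_fourierMul_left]
      congr 1
      exact inner_self_eq_norm_sq (𝕜 := ℂ) x
    have h2 := re_inner_mulL_nonneg hv h0 (sqrtResolvent x)
    rw [← inner_mulL_left] at h2
    have h3 := Complex.re_le_norm (inner ℂ (T x) x)
    simp only [NNReal.coe_one, mul_one]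
    linarith
  obtain ⟨w, hw⟩ : ∃ w, T w = sqrtResolvent f := by
    obtain ⟨U, hU⟩ := hu
    refine ⟨(↑U⁻¹ : L2R →L[ℂ] L2R) (sqrtResolvent f), ?_⟩
    rw [← hU, ← mul_apply_eq_comp, Units.mul_inv, one_apply_eq_self]
  refine ⟨sqrtResolvent w, ?_⟩
  congr 1
  rw [map_sub, ← hw, hT]
  simp

/-- The equation is paired with `h² u`. The potential term is at least `c ‖h² u‖²`, and the possibly
negative `|D|` term absorbs only half of it. The constant depends on `N` and `c` alone. -/
theorem apriori_bounded {N : ℕ} (hN : 1 ≤ N) {c : ℝ} (hc : 0 < c) :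
    ∃ C : ℝ, 0 ≤ C ∧ ∀ (h v : ℝ → ℝ) (hb : BddMeas h) (hv : BddMeas v), SlowWeight N h →
      (∀ x, 0 ≤ v x) → (∀ x, c * (h x * h x) ≤ v x + 1) → ∀ f u : L2R,
      u = sqrtResolvent (sqrtResolvent (f - mulL hv u)) → ‖mulL (hb.mul hb) u‖ ≤ C * ‖f‖ := by
  obtain ⟨C₁, hC₁, key⟩ := exists_re_inner_weight_absD hN (half_pos hc)
  refine ⟨Real.sqrt (4 / c * (1 / c + C₁)), Real.sqrt_nonneg _, ?_⟩
  intro h v hb hv hs h0 hcv f u hu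
  obtain ⟨hd, he⟩ := exists_absD_add_self (f - mulL hv u)
  set u' : absD.domain := ⟨_, hd⟩ with hu'
  have hu'u : (u' : L2R) = u := hu.symm
  have he' : f = absD u' + u + mulL hv u := by
    rw [← hu] at he
    rw [he, sub_add_cancel]
  set W := mulL (hb.mul hb) u with hW
  have h1 := key h hb hs u'
  rw [hu'u] at h1
  have hself : ∀ x : L2R, (inner ℂ x x).re = ‖x‖ ^ 2 := fun x =>
    inner_self_eq_norm_sq (𝕜 := ℂ) x
  -- Pairing with `u` itself, where both `|D|` and `v` contribute nonnegatively.
  have h2 : ‖u‖ ≤ ‖f‖ := by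
    have e1 : (inner ℂ u f).re = (inner ℂ u (absD u')).re + ‖u‖ ^ 2 +
        (inner ℂ u (mulL hv u)).re := by
      conv_lhs => rw [he']
      rw [inner_add_right, inner_add_right, Complex.add_re, Complex.add_re, hself]
    have e2 := re_inner_absD_nonneg u'
    rw [hu'u] at e2
    have e3 := re_inner_mulL_nonneg hv h0 u
    have e4 := (Complex.re_le_norm _).trans (norm_inner_le_norm (𝕜 := ℂ) u f)
    by_contra hlt
    push Not at hlt
    nlinarith [norm_nonneg u, norm_nonneg f]
  have h3 : c * ‖W‖ ^ 2 ≤ (inner ℂ W u).re + (inner ℂ W (mulL hv u)).re := by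
    rw [re_inner_eq_integral, re_inner_eq_integral, norm_sq_eq_integral, ← integral_const_mul,
      ← integral_add (integrable_re_conj_mul _ _) (integrable_re_conj_mul _ _)]
    refine integral_mono_ae ((integrable_norm_sq _).const_mul _)
      ((integrable_re_conj_mul _ _).add (integrable_re_conj_mul _ _)) ?_
    filter_upwards [coeFn_mulL (hb.mul hb) u, coeFn_mulL hv u] with x e1 e2
    rw [hW, e1, e2]
    set z := u x
    have e3 : ((starRingEnd ℂ) (((h x * h x : ℝ) : ℂ) * z) * z).re = (h x * h x) * ‖z‖ ^ 2 := by
      rw [map_mul, Complex.conj_ofReal, mul_assoc, mul_left_comm, re_conj_mul_ofReal_mul_self]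
    have e4 : ((starRingEnd ℂ) (((h x * h x : ℝ) : ℂ) * z) * ((v x : ℂ) * z)).re =
        (h x * h x) * (v x) * ‖z‖ ^ 2 := by
      rw [map_mul, Complex.conj_ofReal, ← re_conj_mul_ofReal_mul_self]
      congr 1
      push_cast
      ring
    have e5 : ‖((h x * h x : ℝ) : ℂ) * z‖ ^ 2 = (h x * h x) ^ 2 * ‖z‖ ^ 2 := by
      rw [norm_mul, mul_pow, Complex.norm_real, Real.norm_eq_abs, sq_abs]
    rw [e5]
    refine le_trans ?_ (le_of_eq (congrArg₂ (· + ·) e3.symm e4.symm))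
    have := mul_le_mul_of_nonneg_right (hcv x)
      (mul_nonneg (mul_self_nonneg (h x)) (sq_nonneg ‖z‖))
    nlinarith
  have h4 : (inner ℂ W f).re = (inner ℂ W (absD u')).re + (inner ℂ W u).re +
      (inner ℂ W (mulL hv u)).re := by
    conv_lhs => rw [he']
    rw [inner_add_right, inner_add_right, Complex.add_re, Complex.add_re]
  have h5 := (Complex.re_le_norm _).trans (norm_inner_le_norm (𝕜 := ℂ) W f)
  have h6 : ‖u‖ ^ 2 ≤ ‖f‖ ^ 2 := pow_le_pow_left₀ (norm_nonneg _) h2 2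
  have h7 : C₁ * ‖u‖ ^ 2 ≤ C₁ * ‖f‖ ^ 2 := mul_le_mul_of_nonneg_left h6 hC₁
  have h8 : c / 2 * ‖W‖ ^ 2 ≤ ‖W‖ * ‖f‖ + C₁ * ‖f‖ ^ 2 := by linarith
  -- Young's inequality, leaving `c / 4` of the remaining `c / 2` on the left; this gives the
  -- constant chosen at the start.
  have h9 : ‖W‖ * ‖f‖ ≤ c / 4 * ‖W‖ ^ 2 + 1 / c * ‖f‖ ^ 2 := by
    have := sq_nonneg (c / 2 * ‖W‖ - ‖f‖)
    have h10 : ‖W‖ * ‖f‖ = 1 / c * (c * (‖W‖ * ‖f‖)) := by field_simp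
    have h11 : c / 4 * ‖W‖ ^ 2 = 1 / c * (c ^ 2 / 4 * ‖W‖ ^ 2) := by field_simp
    rw [h10, h11, ← mul_add]
    refine mul_le_mul_of_nonneg_left ?_ (by positivity)
    nlinarith
  have h12 : ‖W‖ ^ 2 ≤ 4 / c * (1 / c + C₁) * ‖f‖ ^ 2 := by
    have : c / 4 * ‖W‖ ^ 2 ≤ (1 / c + C₁) * ‖f‖ ^ 2 := by linarith
    calc ‖W‖ ^ 2 = 4 / c * (c / 4 * ‖W‖ ^ 2) := by field_simp
      _ ≤ 4 / c * ((1 / c + C₁) * ‖f‖ ^ 2) := mul_le_mul_of_nonneg_left this (by positivity)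
      _ = _ := by ring
  have h13 := Real.sqrt_le_sqrt h12
  rwa [Real.sqrt_sq (norm_nonneg _), Real.sqrt_mul (by positivity),
    Real.sqrt_sq (norm_nonneg _)] at h13

/-- Weak convergence of a bounded sequence may be tested on a dense set. -/
theorem tendsto_inner_of_dense {E : Type*} [NormedAddCommGroup E] [InnerProductSpace ℂ E]
    {x : ℕ → E} {y : E} {C : ℝ} (hC : ∀ n, ‖x n‖ ≤ C) {s : Set E} (hs : Dense s)
    (h : ∀ w ∈ s, Tendsto (fun n => inner ℂ w (x n)) atTop (𝓝 (inner ℂ w y))) (w : E) :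
    Tendsto (fun n => inner ℂ w (x n)) atTop (𝓝 (inner ℂ w y)) := by
  have hC0 : 0 ≤ C := (norm_nonneg _).trans (hC 0)
  rw [Metric.tendsto_atTop]
  intro ε hε
  set K := C + ‖y‖ + 1 with hK
  have hK0 : 0 < K := by positivity
  obtain ⟨w', hw's, hw'⟩ := Metric.dense_iff.1 hs w (ε / (2 * K)) (by positivity)
  have hw'd : ‖w - w'‖ < ε / (2 * K) := by
    rw [← dist_eq_norm, dist_comm]
    exact hw's
  obtain ⟨N, hN⟩ := (Metric.tendsto_atTop.1 (h w' hw')) (ε / 2) (half_pos hε)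
  refine ⟨N, fun n hn => ?_⟩
  have h1 := hN n hn
  rw [dist_eq_norm] at h1 ⊢
  have h2 : inner ℂ w (x n) - inner ℂ w y = inner ℂ (w - w') (x n - y) +
      (inner ℂ w' (x n) - inner ℂ w' y) := by
    simp only [inner_sub_left, inner_sub_right]
    ring
  have h3 : ‖(inner ℂ (w - w') (x n - y) : ℂ)‖ ≤ ε / 2 := by
    refine (norm_inner_le_norm _ _).trans ?_
    have h4 : ‖x n - y‖ ≤ K := by
      refine (norm_sub_le _ _).trans ?_
      have := hC n
      linarith
    calc ‖w - w'‖ * ‖x n - y‖ ≤ ε / (2 * K) * K :=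
          mul_le_mul hw'd.le h4 (norm_nonneg _) (by positivity)
      _ = ε / 2 := by field_simp
  rw [h2]
  exact (norm_add_le _ _).trans_lt (by linarith)

/-! ### Unbounded potentials: solving `(|D| + V + 1) u = f`. -/

/-- The weight `(1 + |x|)^α`. -/
noncomputable def japaneseWeight (α x : ℝ) : ℝ := (1 + |x|) ^ α

theorem one_le_japaneseWeight {α : ℝ} (hα : 0 < α) (x : ℝ) : 1 ≤ japaneseWeight α x :=
  Real.one_le_rpow (by linarith [abs_nonneg x]) hα.le

theorem continuous_japaneseWeight {α : ℝ} (hα : 0 < α) : Continuous (japaneseWeight α) := by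
  unfold japaneseWeight
  refine Continuous.rpow_const (by fun_prop) fun x => Or.inr hα.le

theorem japaneseWeight_le_mul {α : ℝ} (hα : 0 < α) {N : ℕ} (hN : α ≤ N) (x y : ℝ) :
    japaneseWeight α y ≤ japaneseWeight α x * (1 + |x - y|) ^ N := by
  have h1 : 1 + |y| ≤ (1 + |x|) * (1 + |x - y|) := by
    have h2 : |y| ≤ |x| + |x - y| := by
      have := abs_sub_abs_le_abs_sub y x
      rw [abs_sub_comm y x] at this
      linarith
    nlinarith [mul_nonneg (abs_nonneg x) (abs_nonneg (x - y))]
  unfold japaneseWeight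
  calc (1 + |y|) ^ α ≤ ((1 + |x|) * (1 + |x - y|)) ^ α :=
        Real.rpow_le_rpow (by positivity) h1 hα.le
    _ = (1 + |x|) ^ α * (1 + |x - y|) ^ α := Real.mul_rpow (by positivity) (by positivity)
    _ ≤ (1 + |x|) ^ α * (1 + |x - y|) ^ (N : ℝ) := by
        refine mul_le_mul_of_nonneg_left ?_ (by positivity)
        exact Real.rpow_le_rpow_of_exponent_le (by linarith [abs_nonneg (x - y)]) hN
    _ = _ := by rw [Real.rpow_natCast]

/-- The weight truncated at height `m`. -/
noncomputable def truncWeight (α m x : ℝ) : ℝ := min (japaneseWeight α x) m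

theorem bddMeas_truncWeight {α : ℝ} (hα : 0 < α) {m : ℝ} (hm : 1 ≤ m) :
    BddMeas (truncWeight α m) := by
  refine ⟨((continuous_japaneseWeight hα).min continuous_const).measurable, m, fun x => ?_⟩
  have h1 := one_le_japaneseWeight hα x
  rw [truncWeight, abs_of_nonneg (le_min (by linarith) (by linarith))]
  exact min_le_right _ _

theorem slowWeight_truncWeight {α : ℝ} (hα : 0 < α) {N : ℕ} (hN : α ≤ N) {m : ℝ} (hm : 1 ≤ m) :
    SlowWeight N (truncWeight α m) := by
  refine ⟨fun x => le_min (one_le_japaneseWeight hα x) hm, fun x y => ?_⟩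
  have h1 : (1 : ℝ) ≤ (1 + |x - y|) ^ N := one_le_pow₀ (by linarith [abs_nonneg (x - y)])
  unfold truncWeight
  rw [min_mul_of_nonneg _ _ (by linarith)]
  exact min_le_min (japaneseWeight_le_mul hα hN x y) (le_mul_of_one_le_right (by linarith) h1)

/-- Potentials comparable to `(1 + |x|)^(2α)`. -/
structure ComparablePotential (α c C : ℝ) (V : ℝ → ℝ) : Prop where
  exponent_pos : 0 < α
  c_pos : 0 < c
  meas : Measurable V
  nonneg : ∀ x, 0 ≤ V x
  lower : ∀ x, c * (japaneseWeight α x * japaneseWeight α x) ≤ V x + 1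
  upper : ∀ x, V x ≤ C * (japaneseWeight α x * japaneseWeight α x)

namespace ComparablePotential

variable {α c C : ℝ} {V : ℝ → ℝ}

theorem C_nonneg (hV : ComparablePotential α c C V) : 0 ≤ C := by
  have h1 := one_le_japaneseWeight hV.exponent_pos 0
  have h2 := (hV.nonneg 0).trans (hV.upper 0)
  exact nonneg_of_mul_nonneg_left h2 (by nlinarith)

/-- The ratio of the potential and the weight. -/
noncomputable def ratio (_ : ComparablePotential α c C V) (x : ℝ) : ℝ :=
  V x / (japaneseWeight α x * japaneseWeight α x)

theorem ratio_nonneg (hV : ComparablePotential α c C V) (x : ℝ) : 0 ≤ hV.ratio x :=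
  div_nonneg (hV.nonneg x) (mul_self_nonneg _)

theorem ratio_le (hV : ComparablePotential α c C V) (x : ℝ) : hV.ratio x ≤ C := by
  have h1 := one_le_japaneseWeight hV.exponent_pos x
  exact (div_le_iff₀ (by nlinarith)).2 (hV.upper x)

theorem ratio_mul (hV : ComparablePotential α c C V) (x : ℝ) :
    hV.ratio x * (japaneseWeight α x * japaneseWeight α x) = V x := by
  have h1 := one_le_japaneseWeight hV.exponent_pos x
  exact div_mul_cancel₀ _ (by nlinarith)

theorem bddMeas_ratio (hV : ComparablePotential α c C V) : BddMeas hV.ratio := by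
  have h := continuous_japaneseWeight hV.exponent_pos
  refine ⟨hV.meas.div (h.mul h).measurable, C, fun x => ?_⟩
  rw [abs_of_nonneg (hV.ratio_nonneg x)]
  exact hV.ratio_le x

/-- The bounded approximations of the potential. -/
noncomputable def trunc (hV : ComparablePotential α c C V) (m x : ℝ) : ℝ :=
  hV.ratio x * (truncWeight α m x * truncWeight α m x)

theorem bddMeas_trunc (hV : ComparablePotential α c C V) {m : ℝ} (hm : 1 ≤ m) :
    BddMeas (hV.trunc m) :=
  hV.bddMeas_ratio.mul ((bddMeas_truncWeight hV.exponent_pos hm).mul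
    (bddMeas_truncWeight hV.exponent_pos hm))

theorem trunc_nonneg (hV : ComparablePotential α c C V) (m x : ℝ) : 0 ≤ hV.trunc m x :=
  mul_nonneg (hV.ratio_nonneg x) (mul_self_nonneg _)

/-- Truncating only the weight and keeping the ratio preserves the lower bound with the same `c`: it
reads `(c - ratio) s² ≤ 1`, which passes from the full weight to any smaller one. -/
theorem le_trunc (hV : ComparablePotential α c C V) {m : ℝ} (hm : 1 ≤ m) (x : ℝ) :
    c * (truncWeight α m x * truncWeight α m x) ≤ hV.trunc m x + 1 := by
  have h1 := one_le_japaneseWeight hV.exponent_pos x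
  have h2 := hV.lower x
  rw [← hV.ratio_mul x] at h2
  unfold trunc
  set w := japaneseWeight α x with hw
  set s := truncWeight α m x with hs
  have h3 : s ≤ w := min_le_left _ _
  have h4 : 1 ≤ s := le_min h1 hm
  have h5 : s * s ≤ w * w := mul_self_le_mul_self (by linarith) h3
  have hww : 0 < w * w := by nlinarith
  have h6 : (c - hV.ratio x) * (w * w) ≤ 1 := by linarith
  rcases le_total (c - hV.ratio x) 0 with h | h
  · nlinarith [mul_self_nonneg s]
  · nlinarith [mul_le_mul_of_nonneg_left h5 h]

theorem trunc_le (hV : ComparablePotential α c C V) {m : ℝ} (x : ℝ) :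
    hV.trunc m x ≤ C * (truncWeight α m x * truncWeight α m x) :=
  mul_le_mul_of_nonneg_right (hV.ratio_le x) (mul_self_nonneg _)

/-- The difference lives where the weight is at least `n`; there the factor `truncWeight α n x ^ 2 =
n²` is free to insert. Each of the two weights will be absorbed by one a priori bound, and the gain
is `n⁻²`. -/
theorem trunc_sub_trunc (hV : ComparablePotential α c C V) {m n : ℝ} (hn : 1 ≤ n) (hnm : n ≤ m)
    (x : ℝ) : |hV.trunc m x - hV.trunc n x| ≤ C / n ^ 2 *
      ((truncWeight α n x * truncWeight α n x) * (truncWeight α m x * truncWeight α m x)) := by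
  have h1 := one_le_japaneseWeight hV.exponent_pos x
  have h0 := hV.ratio_nonneg x
  have hC := hV.C_nonneg
  have h2 := hV.ratio_le x
  unfold trunc truncWeight
  set w := japaneseWeight α x with hw
  have hn2 : 0 < n ^ 2 := by positivity
  rcases le_total w n with h | h
  · rw [min_eq_left h, min_eq_left (h.trans hnm), sub_self, abs_zero]
    positivity
  · rw [min_eq_right h]
    set s := min w m with hs
    have h3 : n ≤ s := le_min h hnm
    have h4 : n * n ≤ s * s := mul_self_le_mul_self (by linarith) h3
    rw [← mul_sub, abs_of_nonneg (mul_nonneg h0 (by linarith))]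
    have h5 : C / n ^ 2 * (n * n * (s * s)) = C * (s * s) := by
      field_simp
    rw [h5]
    exact mul_le_mul h2 (by nlinarith) (by linarith) hC

end ComparablePotential

/-- Fatou's lemma. -/
theorem memLp_of_forall_norm_mulL_le {g : ℕ → ℝ → ℝ} (hg : ∀ n, BddMeas (g n)) {f : ℝ → ℝ}
    (hlim : ∀ x, Tendsto (fun n => g n x) atTop (𝓝 (f x))) {u : L2R} {K : ℝ}
    (hK : ∀ n, ‖mulL (hg n) u‖ ≤ K) : MemLp (fun x => (f x : ℂ) * u x) 2 volume := by
  have hlim' : ∀ x, Tendsto (fun n => (g n x : ℂ) * u x) atTop (𝓝 ((f x : ℂ) * u x)) := fun x =>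
    ((Complex.continuous_ofReal.tendsto _).comp (hlim x)).mul_const _
  have hm : ∀ n, AEStronglyMeasurable (fun x => (g n x : ℂ) * u x) volume := fun n =>
    ((hg n).memLp u).1
  refine ⟨aestronglyMeasurable_of_tendsto_ae atTop hm (Eventually.of_forall hlim'), ?_⟩
  refine (Lp.eLpNorm_lim_le_liminf_eLpNorm hm _ (Eventually.of_forall hlim')).trans_lt ?_
  refine lt_of_le_of_lt ?_ (ENNReal.ofReal_lt_top (r := K))
  refine liminf_le_of_le (by isBoundedDefault) fun b hb => ?_
  obtain ⟨n, hn⟩ := hb.exists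
  refine hn.trans ?_
  rw [← eLpNorm_congr_ae (coeFn_mulL (hg n) u), ← Lp.enorm_def, ← ofReal_norm]
  exact ENNReal.ofReal_le_ofReal (hK n)

theorem mulL_eq_mulL {g h : ℝ → ℝ} (hg : BddMeas g) (hh : BddMeas h) (hgh : ∀ x, g x = h x)
    (u : L2R) : mulL hg u = mulL hh u := by
  apply Lp.ext
  filter_upwards [coeFn_mulL hg u, coeFn_mulL hh u] with x h1 h2
  rw [h1, h2, hgh]

theorem absD_eq_sub_of_eq {u g : L2R} (h : u = sqrtResolvent (sqrtResolvent g)) :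
    ∃ hd : u ∈ absD.domain, absD ⟨u, hd⟩ = g - u := by
  subst h
  obtain ⟨hd, he⟩ := exists_absD_add_self g
  exact ⟨hd, eq_sub_of_add_eq he⟩

namespace ComparablePotential

variable {α c C : ℝ} {V : ℝ → ℝ}

theorem norm_inner_trunc_sub_le (hV : ComparablePotential α c C V) {m n : ℝ} (hm : 1 ≤ m)
    (hn : 1 ≤ n) (hnm : n ≤ m) (d u : L2R) :
    ‖inner ℂ d (mulL (hV.bddMeas_trunc hm) u - mulL (hV.bddMeas_trunc hn) u)‖ ≤ C / n ^ 2 *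
      (‖mulL ((bddMeas_truncWeight hV.exponent_pos hn).mul
          (bddMeas_truncWeight hV.exponent_pos hn)) d‖ *
        ‖mulL ((bddMeas_truncWeight hV.exponent_pos hm).mul
          (bddMeas_truncWeight hV.exponent_pos hm)) u‖) := by
  set An := (bddMeas_truncWeight hV.exponent_pos hn).mul (bddMeas_truncWeight hV.exponent_pos hn)
  set Am := (bddMeas_truncWeight hV.exponent_pos hm).mul (bddMeas_truncWeight hV.exponent_pos hm)
  set s : ℝ → ℝ := fun x => (hV.trunc m x - hV.trunc n x) /
    ((truncWeight α n x * truncWeight α n x) * (truncWeight α m x * truncWeight α m x)) with hs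
  have hpos : ∀ x, 0 < (truncWeight α n x * truncWeight α n x) *
      (truncWeight α m x * truncWeight α m x) := by
    intro x
    have h1 : 1 ≤ truncWeight α n x := le_min (one_le_japaneseWeight hV.exponent_pos x) hn
    have h2 : 1 ≤ truncWeight α m x := le_min (one_le_japaneseWeight hV.exponent_pos x) hm
    positivity
  have hsb : ∀ x, |s x| ≤ C / n ^ 2 := by
    intro x
    rw [hs, abs_div, abs_of_pos (hpos x), div_le_iff₀ (hpos x)]
    exact hV.trunc_sub_trunc hn hnm x
  have hsm : BddMeas s :=
    ⟨((hV.bddMeas_trunc hm).meas.sub (hV.bddMeas_trunc hn).meas).div (An.meas.mul Am.meas),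
      C / n ^ 2, hsb⟩
  have e1 : mulL (hV.bddMeas_trunc hm) u - mulL (hV.bddMeas_trunc hn) u =
      mulL An (mulL hsm (mulL Am u)) := by
    apply Lp.ext
    filter_upwards [Lp.coeFn_sub (mulL (hV.bddMeas_trunc hm) u) (mulL (hV.bddMeas_trunc hn) u),
      coeFn_mulL (hV.bddMeas_trunc hm) u, coeFn_mulL (hV.bddMeas_trunc hn) u,
      coeFn_mulL An (mulL hsm (mulL Am u)), coeFn_mulL hsm (mulL Am u), coeFn_mulL Am u]
      with x h1 h2 h3 h4 h5 h6
    rw [h1, Pi.sub_apply, h2, h3, h4, h5, h6, ← sub_mul, ← Complex.ofReal_sub, ← mul_assoc,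
      ← mul_assoc, ← Complex.ofReal_mul, ← Complex.ofReal_mul]
    congr 2
    rw [mul_right_comm, hs]
    exact (mul_div_cancel₀ _ (hpos x).ne').symm
  rw [e1, ← inner_mulL_left]
  refine (norm_inner_le_norm _ _).trans ?_
  have h2 := norm_mulL_le hsm hsb (mulL Am u)
  calc _ ≤ ‖mulL An d‖ * (C / n ^ 2 * ‖mulL Am u‖) :=
        mul_le_mul_of_nonneg_left h2 (norm_nonneg _)
    _ = _ := by ring

/-- The limit of the solutions for truncated potentials. The weighted bound is kept in the
conclusion because it also gives the decay needed for compactness. -/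
theorem exists_solution (hV : ComparablePotential α c C V) :
    ∃ K : ℝ, 0 ≤ K ∧ ∀ f : L2R, ∃ (u : L2R) (hd : u ∈ absD.domain) (hv : u ∈ (mulOp V).domain),
      absD ⟨u, hd⟩ + mulOp V ⟨u, hv⟩ + u = f ∧ ∀ (m : ℝ) (hm : 1 ≤ m),
        ‖mulL ((bddMeas_truncWeight hV.exponent_pos hm).mul
          (bddMeas_truncWeight hV.exponent_pos hm)) u‖ ≤ K * ‖f‖ := by
  have hα := hV.exponent_pos
  obtain ⟨N, hN1, hN⟩ : ∃ N : ℕ, 1 ≤ N ∧ α ≤ N := by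
    obtain ⟨N, hN⟩ := exists_nat_ge α
    exact ⟨N + 1, by omega, hN.trans (by push_cast; linarith)⟩
  obtain ⟨K, hK0, hK⟩ := apriori_bounded hN1 hV.c_pos
  refine ⟨K, hK0, fun f => ?_⟩
  have hm : ∀ n : ℕ, (1 : ℝ) ≤ (n : ℝ) + 1 := fun n => by
    have : (0 : ℝ) ≤ n := Nat.cast_nonneg n
    linarith
  choose u hu using fun n : ℕ => exists_bounded_perturbation (hV.bddMeas_trunc (hm n))
    (hV.trunc_nonneg _) f
  set Wop : ∀ m : ℝ, 1 ≤ m → L2R →L[ℂ] L2R := fun m hm =>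
    mulL ((bddMeas_truncWeight hα hm).mul (bddMeas_truncWeight hα hm)) with hWop
  have hWmono : ∀ {m n : ℝ} (hm : 1 ≤ m) (hn : 1 ≤ n), n ≤ m → ∀ v : L2R,
      ‖Wop _ hn v‖ ≤ ‖Wop _ hm v‖ := by
    intro m n hm hn hnm v
    refine norm_mulL_le_norm_mulL _ _ (fun x => ?_) v
    rw [abs_of_nonneg (mul_self_nonneg _), abs_of_nonneg (mul_self_nonneg _)]
    refine mul_self_le_mul_self (zero_le_one.trans
      ((slowWeight_truncWeight hα hN hn).one_le x)) ?_
    exact min_le_min_left _ hnm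
  have hWb : ∀ n : ℕ, ‖Wop _ (hm n) (u n)‖ ≤ K * ‖f‖ := fun n =>
    hK _ _ (bddMeas_truncWeight hα (hm n)) (hV.bddMeas_trunc (hm n))
      (slowWeight_truncWeight hα hN (hm n)) (hV.trunc_nonneg _) (hV.le_trunc (hm n)) f (u n) (hu n)
  set x : ℕ → L2R := fun n => mulL (hV.bddMeas_trunc (hm n)) (u n) with hx
  have hxb : ∀ n, ‖x n‖ ≤ C * (K * ‖f‖) := by
    intro n
    refine le_trans ?_ (mul_le_mul_of_nonneg_left (hWb n) hV.C_nonneg)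
    refine Lp.norm_le_mul_norm_of_ae_le_mul ?_
    filter_upwards [coeFn_mulL (hV.bddMeas_trunc (hm n)) (u n),
      coeFn_mulL ((bddMeas_truncWeight hα (hm n)).mul (bddMeas_truncWeight hα (hm n))) (u n)]
      with y h1 h2
    rw [hx, hWop, h1, h2, norm_mul, norm_mul, ← mul_assoc, Complex.norm_real, Complex.norm_real,
      Real.norm_of_nonneg (hV.trunc_nonneg _ _), Real.norm_of_nonneg (mul_self_nonneg _)]
    exact mul_le_mul_of_nonneg_right (hV.trunc_le y) (norm_nonneg _)
  have hself : ∀ x : L2R, (inner ℂ x x).re = ‖x‖ ^ 2 := fun x =>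
    inner_self_eq_norm_sq (𝕜 := ℂ) x
  set B : ℝ := Real.sqrt (2 * C) * (K * ‖f‖) with hB
  have hC := hV.C_nonneg
  -- Subtract the two equations and pair with the difference `d`: `|D|` and the smaller potential
  -- contribute nonnegatively, so `‖d‖²` is at most the pairing of `d` with `(V_m - V_n) u_m`, where
  -- `V_m`, `V_n` are the truncations in play. That pairing is `O(n⁻²)` by `trunc_sub_trunc`.
  have hdist : ∀ n m : ℕ, n ≤ m → ‖u n - u m‖ ≤ B / ((n : ℝ) + 1) := by
    intro n m hnm
    have hnm' : (n : ℝ) + 1 ≤ (m : ℝ) + 1 := by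
      have : (n : ℝ) ≤ m := by exact_mod_cast hnm
      linarith
    obtain ⟨hdn, hen⟩ := absD_eq_sub_of_eq (hu n)
    obtain ⟨hdm, hem⟩ := absD_eq_sub_of_eq (hu m)
    have hn1 := re_inner_absD_nonneg (⟨u n, hdn⟩ - ⟨u m, hdm⟩ : absD.domain)
    rw [LinearPMap.map_sub] at hn1
    change 0 ≤ (inner ℂ (u n - u m) (absD ⟨u n, hdn⟩ - absD ⟨u m, hdm⟩)).re at hn1
    set d := u n - u m with hd
    have e1 : absD ⟨u n, hdn⟩ - absD ⟨u m, hdm⟩ + d + mulL (hV.bddMeas_trunc (hm n)) d =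
        mulL (hV.bddMeas_trunc (hm m)) (u m) - mulL (hV.bddMeas_trunc (hm n)) (u m) := by
      rw [hen, hem, hd, map_sub]
      abel
    have e4 := hV.norm_inner_trunc_sub_le (hm m) (hm n) hnm' d (u m)
    rw [← e1, inner_add_right, inner_add_right] at e4
    have e5 := (Complex.re_le_norm _).trans e4
    rw [Complex.add_re, Complex.add_re, hself] at e5
    have e6 := re_inner_mulL_nonneg (hV.bddMeas_trunc (hm n)) (hV.trunc_nonneg _) d
    have e7 : ‖Wop _ (hm n) d‖ ≤ 2 * (K * ‖f‖) := by
      rw [hd, map_sub]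
      refine (norm_sub_le _ _).trans ?_
      have := (hWmono (hm m) (hm n) hnm' (u m)).trans (hWb m)
      have := hWb n
      linarith
    have e8 : ‖Wop _ (hm n) d‖ * ‖Wop _ (hm m) (u m)‖ ≤ 2 * (K * ‖f‖) * (K * ‖f‖) :=
      mul_le_mul e7 (hWb m) (norm_nonneg _) (by positivity)
    have e9 : ‖d‖ ^ 2 ≤ C / ((n : ℝ) + 1) ^ 2 * (2 * (K * ‖f‖) * (K * ‖f‖)) := by
      have := mul_le_mul_of_nonneg_left e8 (by positivity : 0 ≤ C / ((n : ℝ) + 1) ^ 2)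
      linarith
    refine le_of_sq_le_sq ?_ (by positivity)
    rw [hB, div_pow, mul_pow, Real.sq_sqrt (by positivity)]
    refine e9.trans (le_of_eq ?_)
    ring
  have hcau : CauchySeq u := by
    refine cauchySeq_of_le_tendsto_0 (fun n : ℕ => 2 * (B / ((n : ℝ) + 1))) ?_ ?_
    · intro n m k hkn hkm
      rw [dist_eq_norm]
      have h1 := hdist k n hkn
      have h2 := hdist k m hkm
      have h3 : u n - u m = (u k - u m) - (u k - u n) := by abel
      rw [h3]
      exact (norm_sub_le _ _).trans (by linarith)
    · have := (tendsto_const_div_atTop_nhds_zero_nat B).comp (tendsto_add_atTop_nat 1)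
      have := this.const_mul 2
      simpa [Function.comp_def] using this
  obtain ⟨v, hv⟩ := cauchySeq_tendsto_of_complete hcau
  have hWv : ∀ (m : ℝ) (hm1 : 1 ≤ m), ‖Wop _ hm1 v‖ ≤ K * ‖f‖ := by
    intro m hm1
    have h1 : Tendsto (fun n => ‖Wop _ hm1 (u n)‖) atTop (𝓝 ‖Wop _ hm1 v‖) :=
      ((Wop _ hm1).continuous.norm.tendsto v).comp hv
    refine le_of_tendsto h1 ?_
    obtain ⟨k, hk⟩ := exists_nat_ge m
    filter_upwards [eventually_ge_atTop k] with n hn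
    refine (hWmono (hm n) hm1 ?_ (u n)).trans (hWb n)
    have : (k : ℝ) ≤ n := by exact_mod_cast hn
    linarith
  have htr : ∀ y : ℝ, ∀ n : ℕ, japaneseWeight α y ≤ n → hV.trunc ((n : ℝ) + 1) y = V y := by
    intro y n hn
    rw [trunc, truncWeight, min_eq_left (by linarith), hV.ratio_mul]
  have hvV : v ∈ (mulOp V).domain := by
    refine memLp_of_forall_norm_mulL_le (fun n => hV.bddMeas_trunc (hm n)) (f := V)
      (K := C * (K * ‖f‖)) (fun y => ?_) (fun n => ?_)
    · refine tendsto_const_nhds.congr' ?_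
      obtain ⟨k, hk⟩ := exists_nat_ge (japaneseWeight α y)
      filter_upwards [eventually_ge_atTop k] with n hn
      refine (htr y n (hk.trans ?_)).symm
      exact_mod_cast hn
    · refine le_trans ?_ (mul_le_mul_of_nonneg_left (hWv _ (hm n)) hV.C_nonneg)
      refine Lp.norm_le_mul_norm_of_ae_le_mul ?_
      filter_upwards [coeFn_mulL (hV.bddMeas_trunc (hm n)) v,
        coeFn_mulL ((bddMeas_truncWeight hα (hm n)).mul (bddMeas_truncWeight hα (hm n))) v]
        with y h1 h2
      rw [hWop, h1, h2, norm_mul, norm_mul, ← mul_assoc, Complex.norm_real, Complex.norm_real,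
        Real.norm_of_nonneg (hV.trunc_nonneg _ _), Real.norm_of_nonneg (mul_self_nonneg _)]
      exact mul_le_mul_of_nonneg_right (hV.trunc_le y) (norm_nonneg _)
  set g : L2R := mulOp V ⟨v, hvV⟩ with hg
  set χ : ℕ → ℝ → ℝ := fun k => {y | japaneseWeight α y ≤ k}.indicator 1 with hχ
  have hχb : ∀ k y, |χ k y| ≤ 1 := by
    intro k y
    simp only [hχ, Set.indicator_apply, Pi.one_apply]
    split_ifs <;> simp
  have hχm : ∀ k, BddMeas (χ k) := fun k =>
    ⟨measurable_one.indicator (measurableSet_le (continuous_japaneseWeight hα).measurable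
      measurable_const), 1, hχb k⟩
  -- The products of truncated potential and solution are bounded in `L²`, so weak convergence may
  -- be tested on functions cut off to a sublevel set of the weight, where the truncation is
  -- eventually inactive.
  have hweak : ∀ w : L2R, Tendsto (fun n => inner ℂ w (x n)) atTop (𝓝 (inner ℂ w g)) := by
    refine tendsto_inner_of_dense hxb
      (s := {w | ∃ (k : ℕ) (w' : L2R), w = mulL (hχm k) w'}) ?_ ?_
    · intro w
      refine mem_closure_of_tendsto (tendsto_mulL (l := atTop) hχm (C := 1)
        (Eventually.of_forall hχb) (fun y => ?_) w) (Eventually.of_forall fun k => ⟨k, w, rfl⟩)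
      refine tendsto_const_nhds.congr' ?_
      obtain ⟨k, hk⟩ := exists_nat_ge (japaneseWeight α y)
      filter_upwards [eventually_ge_atTop k] with n hn
      have : japaneseWeight α y ≤ n := hk.trans (by exact_mod_cast hn)
      simp [hχ, this]
    · rintro w ⟨k, w', rfl⟩
      have hb := (hχm k).mul (hV.bddMeas_trunc (hm k))
      have e1 : inner ℂ (mulL (hχm k) w') g = inner ℂ w' (mulL hb v) := by
        rw [inner_mulL_left]
        congr 1
        apply Lp.ext
        filter_upwards [coeFn_mulL (hχm k) g, coeFn_mulOp (f := V) ⟨v, hvV⟩, coeFn_mulL hb v]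
          with y h1 h2 h3
        rw [h1, hg, h2, h3, ← mul_assoc, ← Complex.ofReal_mul]
        congr 2
        by_cases hy : japaneseWeight α y ≤ k
        · rw [htr y k hy]
        · simp [hχ, hy]
      have e2 : ∀ᶠ n in atTop, inner ℂ w' (mulL hb (u n)) = inner ℂ (mulL (hχm k) w') (x n) := by
        filter_upwards [eventually_ge_atTop k] with n hn
        rw [inner_mulL_left]
        congr 1
        simp only [hx]
        rw [mulL_mulL]
        refine mulL_eq_mulL _ _ (fun y => ?_) _
        by_cases hy : japaneseWeight α y ≤ k
        · rw [htr y k hy, htr y n (hy.trans (by exact_mod_cast hn))]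
        · simp [hχ, hy]
      rw [e1]
      refine Tendsto.congr' e2 ?_
      have hc : Continuous fun z : L2R => inner ℂ w' (mulL hb z) :=
        continuous_const.inner (mulL hb).continuous
      exact (hc.tendsto v).comp hv
  -- The integrated equation involves only bounded operators, so weak convergence is enough to pass
  -- to the limit.
  have hvS : v = sqrtResolvent (sqrtResolvent (f - g)) := by
    refine ext_inner_left ℂ fun w => ?_
    have hcw : Continuous fun z : L2R => inner ℂ w z := continuous_const.inner continuous_id
    refine tendsto_nhds_unique ((hcw.tendsto v).comp hv) ?_
    have e1 : ∀ z : L2R, inner ℂ w (sqrtResolvent (sqrtResolvent z)) =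
        inner ℂ (sqrtResolvent (sqrtResolvent w)) z := by
      intro z
      simp only [sqrtResolvent, inner_fourierMul_left]
    rw [e1, inner_sub_right]
    refine ((hweak (sqrtResolvent (sqrtResolvent w))).const_sub
      (inner ℂ (sqrtResolvent (sqrtResolvent w)) f)).congr fun n => ?_
    simp only [Function.comp_apply]
    conv_rhs => rw [hu n]
    rw [e1, inner_sub_right]
  obtain ⟨hd, he⟩ := absD_eq_sub_of_eq hvS
  refine ⟨v, hd, hvV, ?_, hWv⟩
  rw [he, ← hg]
  abel

end ComparablePotential

/-! ### Scalar estimates for the functional calculus of the resolvent. -/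

/-- The function `r ↦ e^{-t(1/r - 1)}`, which maps the resolvent `(A + 1)⁻¹` to `e^{-tA}`. -/
noncomputable def heatFun (t r : ℝ) : ℝ := if r ≤ 0 then 0 else Real.exp (-(t * (r⁻¹ - 1)))

theorem heatFun_nonneg (t r : ℝ) : 0 ≤ heatFun t r := by
  unfold heatFun
  split_ifs
  · exact le_rfl
  · exact (Real.exp_pos _).le

theorem heatFun_of_pos (t : ℝ) {r : ℝ} (hr : 0 < r) :
    heatFun t r = Real.exp (-(t * (r⁻¹ - 1))) := if_neg (not_le.2 hr)

theorem heatFun_le_one {t r : ℝ} (ht : 0 ≤ t) (hr : r ≤ 1) : heatFun t r ≤ 1 := by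
  rcases le_or_gt r 0 with h | h
  · unfold heatFun
    rw [if_pos h]
    exact zero_le_one
  · rw [heatFun_of_pos t h, Real.exp_le_one_iff, neg_nonpos]
    exact mul_nonneg ht (sub_nonneg.2 ((one_le_inv₀ h).2 hr))

theorem heatFun_add (s t r : ℝ) : heatFun (s + t) r = heatFun s r * heatFun t r := by
  unfold heatFun
  split_ifs
  · simp
  · rw [← Real.exp_add]
    ring_nf

theorem heatFun_eq {t : ℝ} (ht : 0 < t) (r : ℝ) :
    heatFun t r = Real.exp t * expNegInvGlue (r / t) := by
  rcases le_or_gt r 0 with h | h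
  · rw [expNegInvGlue.zero_of_nonpos (div_nonpos_of_nonpos_of_nonneg h ht.le), mul_zero]
    exact if_pos h
  · rw [heatFun_of_pos t h, expNegInvGlue, if_neg (not_le.2 (div_pos h ht)), ← Real.exp_add,
      inv_div]
    ring_nf

theorem continuous_heatFun {t : ℝ} (ht : 0 < t) : Continuous (heatFun t) := by
  have : heatFun t = fun r => Real.exp t * expNegInvGlue (r / t) := funext (heatFun_eq ht)
  rw [this]
  exact continuous_const.mul
    ((expNegInvGlue.contDiff (n := 0)).continuous.comp (continuous_id.div_const t))

/-- The function `r ↦ e^{-t(1/r - 1)} / r`. -/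
noncomputable def heatFunDiv (t r : ℝ) : ℝ :=
  Real.exp t * t⁻¹ * ((r / t)⁻¹ * expNegInvGlue (r / t))

theorem continuous_heatFunDiv (t : ℝ) : Continuous (heatFunDiv t) := by
  have h := expNegInvGlue.continuous_polynomial_eval_inv_mul Polynomial.X
  simp only [Polynomial.eval_X] at h
  exact continuous_const.mul (h.comp (continuous_id.div_const t))

theorem mul_heatFunDiv {t : ℝ} (ht : 0 < t) (r : ℝ) : r * heatFunDiv t r = heatFun t r := by
  rw [heatFun_eq ht, heatFunDiv]
  rcases eq_or_ne r 0 with h | h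
  · rw [h, zero_div, expNegInvGlue.zero, mul_zero, zero_mul, mul_zero]
  · field_simp

theorem abs_exp_neg_sub_exp_neg_le {a b : ℝ} (ha : 0 ≤ a) (hb : 0 ≤ b) :
    |Real.exp (-a) - Real.exp (-b)| ≤ |a - b| := by
  wlog hab : a ≤ b generalizing a b
  · rw [abs_sub_comm, abs_sub_comm a b]
    exact this hb ha (le_of_not_ge hab)
  have h1 : Real.exp (-b) ≤ Real.exp (-a) := Real.exp_le_exp.2 (by linarith)
  rw [abs_of_nonneg (by linarith), abs_of_nonpos (by linarith)]
  have h2 : Real.exp (-b) = Real.exp (-a) * Real.exp (-(b - a)) := by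
    rw [← Real.exp_add]
    ring_nf
  have h3 := Real.add_one_le_exp (-(b - a))
  have h4 : Real.exp (-a) ≤ 1 := by simpa using ha
  rw [h2]
  nlinarith [Real.exp_pos (-a), mul_le_mul_of_nonneg_left h3 (Real.exp_pos (-a)).le]

/-- With `σ = 1/r - 1` the spectral value of `A`, the extra factor `r` tames the Lipschitz constant
`σ`, since `σ r = 1 - r ≤ 1`. It gives continuity of the semigroup on the range of the resolvent. -/
theorem abs_heatFun_mul_sub_le {s t r : ℝ} (hs : 0 ≤ s) (ht : 0 ≤ t) (h0 : 0 ≤ r) (h1 : r ≤ 1) :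
    |heatFun t r * r - heatFun s r * r| ≤ |t - s| := by
  rcases h0.eq_or_lt with h | h
  · rw [← h]
    simp
  · have hσ : 0 ≤ r⁻¹ - 1 := sub_nonneg.2 ((one_le_inv₀ h).2 h1)
    rw [heatFun_of_pos t h, heatFun_of_pos s h, ← sub_mul, abs_mul, abs_of_pos h]
    have h2 := abs_exp_neg_sub_exp_neg_le (mul_nonneg ht hσ) (mul_nonneg hs hσ)
    rw [← sub_mul, abs_mul, abs_of_nonneg hσ] at h2
    calc _ ≤ |t - s| * (r⁻¹ - 1) * r := mul_le_mul_of_nonneg_right h2 h.le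
      _ = |t - s| * (1 - r) := by field_simp
      _ ≤ |t - s| * 1 := mul_le_mul_of_nonneg_left (by linarith) (abs_nonneg _)
      _ = _ := mul_one _

theorem abs_heatFun_quot_le {t r : ℝ} (ht : 0 < t) (h0 : 0 ≤ r) (h1 : r ≤ 1) :
    |t⁻¹ * (r - heatFun t r * r)| ≤ 1 := by
  rcases h0.eq_or_lt with h | h
  · rw [← h]
    simp
  · have h2 := abs_heatFun_mul_sub_le le_rfl ht.le h0 h1
    have h3 : heatFun 0 r = 1 := by
      rw [heatFun_of_pos 0 h]
      simp
    rw [h3, one_mul, sub_zero, abs_of_pos ht, abs_sub_comm] at h2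
    rw [abs_mul, abs_of_pos (inv_pos.2 ht), ← div_eq_inv_mul, div_le_one ht]
    exact h2

theorem abs_one_sub_exp_neg_sub_le {a : ℝ} (ha : 0 ≤ a) : |1 - Real.exp (-a) - a| ≤ a ^ 2 := by
  have h1 := Real.add_one_le_exp (-a)
  rw [abs_of_nonpos (by linarith)]
  have h2 := Real.add_one_le_exp a
  have h3 : Real.exp (-a) ≤ (1 + a)⁻¹ := by
    rw [Real.exp_neg]
    exact inv_anti₀ (by linarith) (by linarith)
  have h4 : (1 + a)⁻¹ ≤ 1 - a + a ^ 2 := by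
    rw [inv_le_iff_one_le_mul₀ (by linarith)]
    nlinarith [pow_nonneg ha 3]
  linarith

/-- The second-order Taylor error is of size `t σ²`, and two factors `r` compensate `σ²`.
Accordingly the generator is first computed on the range of the squared resolvent. -/
theorem abs_heatFun_quot_sub_le {t r : ℝ} (ht : 0 < t) (h0 : 0 ≤ r) (h1 : r ≤ 1) :
    |(t⁻¹ * (r - heatFun t r * r) - (1 - r)) * r| ≤ t := by
  rcases h0.eq_or_lt with h | h
  · rw [← h]
    simpa using ht.le
  · have hσ : 0 ≤ r⁻¹ - 1 := sub_nonneg.2 ((one_le_inv₀ h).2 h1)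
    have h2 := abs_one_sub_exp_neg_sub_le (mul_nonneg ht.le hσ)
    have h3 : (t⁻¹ * (r - heatFun t r * r) - (1 - r)) * r =
        t⁻¹ * r ^ 2 * (1 - Real.exp (-(t * (r⁻¹ - 1))) - t * (r⁻¹ - 1)) := by
      rw [heatFun_of_pos t h]
      field_simp
    rw [h3, abs_mul, abs_of_nonneg (by positivity)]
    calc _ ≤ t⁻¹ * r ^ 2 * (t * (r⁻¹ - 1)) ^ 2 :=
          mul_le_mul_of_nonneg_left h2 (by positivity)
      _ = t * (1 - r) ^ 2 := by field_simp
      _ ≤ t * 1 := by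
          refine mul_le_mul_of_nonneg_left ?_ ht.le
          nlinarith
      _ = t := mul_one t

/-! ### The semigroup of a nonnegative self-adjoint operator. -/

section AbstractSemigroup

variable {E : Type*} [NormedAddCommGroup E] [InnerProductSpace ℂ E]

theorem tendsto_zero_of_dense {ι : Type*} {l : Filter ι} {F : ι → E →L[ℂ] E} {C : ℝ} {s : Set E}
    (hs : Dense s) (hF : ∀ᶠ i in l, ‖F i‖ ≤ C)
    (h : ∀ u ∈ s, Tendsto (fun i => F i u) l (𝓝 0)) (u : E) :
    Tendsto (fun i => F i u) l (𝓝 0) := by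
  rw [Metric.tendsto_nhds]
  intro ε hε
  have hδ : 0 < ε / (2 * (|C| + 1)) := by positivity
  obtain ⟨d, hd, hud⟩ := Metric.mem_closure_iff.1 (hs u) _ hδ
  filter_upwards [hF, Metric.tendsto_nhds.1 (h d hd) (ε / 2) (by positivity)] with i hi hi'
  rw [dist_zero_right] at hi' ⊢
  rw [dist_eq_norm] at hud
  have h1 : ‖F i (u - d)‖ ≤ (|C| + 1) * (ε / (2 * (|C| + 1))) :=
    ((F i).le_opNorm _).trans (mul_le_mul (hi.trans (by linarith [le_abs_self C])) hud.le
      (norm_nonneg _) (by positivity))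
  have h2 : (|C| + 1) * (ε / (2 * (|C| + 1))) = ε / 2 := by
    field_simp
  have h3 : F i u = F i (u - d) + F i d := by rw [map_sub, sub_add_cancel]
  rw [h3]
  exact (norm_add_le _ _).trans_lt (by linarith)

theorem re_inner_self (u : E) : (inner ℂ u u).re = ‖u‖ ^ 2 :=
  inner_self_eq_norm_sq (𝕜 := ℂ) u

/-- A symmetric nonnegative operator `A` such that `A + 1` is onto. -/
structure IsNonnegSelfAdjoint (A : E →ₗ.[ℂ] E) : Prop where
  symm : ∀ u v : A.domain, inner ℂ (A u) (v : E) = inner ℂ (u : E) (A v)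
  nonneg : ∀ u : A.domain, 0 ≤ (inner ℂ (u : E) (A u)).re
  surj : ∀ f : E, ∃ u : A.domain, A u + u = f

namespace IsNonnegSelfAdjoint

variable {A : E →ₗ.[ℂ] E}

theorem norm_sq_le (hA : IsNonnegSelfAdjoint A) (u : A.domain) :
    ‖(u : E)‖ ^ 2 ≤ (inner ℂ (u : E) (A u + u)).re := by
  have h := hA.nonneg u
  rw [inner_add_right, Complex.add_re, re_inner_self]
  linarith

theorem norm_le (hA : IsNonnegSelfAdjoint A) (u : A.domain) : ‖(u : E)‖ ≤ ‖A u + u‖ := by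
  have h := (hA.norm_sq_le u).trans (re_inner_le_norm (𝕜 := ℂ) (u : E) (A u + u))
  by_contra! h1
  nlinarith [norm_nonneg (A u + u)]

theorem exists_resolvent (hA : IsNonnegSelfAdjoint A) : ∃ R : E →L[ℂ] E,
    (∀ f, ∃ h : R f ∈ A.domain, A ⟨R f, h⟩ = f - R f) ∧
    (∀ u : A.domain, R (A u + u) = u) ∧ ∀ f, ‖R f‖ ≤ ‖f‖ := by
  choose S hS using hA.surj
  have inj : ∀ u v : A.domain, A u + u = A v + v → u = v := by
    intro u v h
    have h1 := hA.norm_le (u - v)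
    have h2 : A (u - v) + ((u - v : A.domain) : E) = 0 := by
      rw [A.map_sub, Submodule.coe_sub, sub_add_sub_comm, h, sub_self]
    rw [h2, norm_zero] at h1
    exact sub_eq_zero.1 (Subtype.ext (norm_le_zero_iff.1 h1))
  let R₀ : E →ₗ[ℂ] E :=
    { toFun := fun f => S f
      map_add' := by
        intro f g
        rw [← Submodule.coe_add]
        congr 1
        apply inj
        rw [hS, A.map_add, Submodule.coe_add, add_add_add_comm, hS, hS]
      map_smul' := by
        intro c f
        rw [RingHom.id_apply, ← Submodule.coe_smul]
        congr 1
        apply inj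
        rw [hS, A.map_smul, Submodule.coe_smul, ← smul_add, hS] }
  have hR : ∀ f, ‖R₀ f‖ ≤ 1 * ‖f‖ := by
    intro f
    have := hA.norm_le (S f)
    rwa [hS, ← one_mul ‖f‖] at this
  refine ⟨R₀.mkContinuous 1 hR, fun f => ⟨(S f).2, ?_⟩, fun u => ?_, fun f => ?_⟩
  · exact eq_sub_of_add_eq (hS f)
  · exact congrArg Subtype.val (inj _ _ (hS _))
  · simpa using hR f

/-- The resolvent `(A + 1)⁻¹`. -/
noncomputable def resolvent (hA : IsNonnegSelfAdjoint A) : E →L[ℂ] E := hA.exists_resolvent.choose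

theorem resolvent_mem (hA : IsNonnegSelfAdjoint A) (f : E) : hA.resolvent f ∈ A.domain :=
  (hA.exists_resolvent.choose_spec.1 f).1

theorem apply_resolvent (hA : IsNonnegSelfAdjoint A) (f : E) :
    A ⟨hA.resolvent f, hA.resolvent_mem f⟩ = f - hA.resolvent f :=
  (hA.exists_resolvent.choose_spec.1 f).2

theorem resolvent_apply_add (hA : IsNonnegSelfAdjoint A) (u : A.domain) :
    hA.resolvent (A u + u) = u :=
  hA.exists_resolvent.choose_spec.2.1 u

theorem norm_resolvent_apply_le (hA : IsNonnegSelfAdjoint A) (f : E) : ‖hA.resolvent f‖ ≤ ‖f‖ :=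
  hA.exists_resolvent.choose_spec.2.2 f

theorem norm_resolvent_le (hA : IsNonnegSelfAdjoint A) : ‖hA.resolvent‖ ≤ 1 :=
  ContinuousLinearMap.opNorm_le_bound _ zero_le_one fun f => by
    simpa using hA.norm_resolvent_apply_le f

theorem inner_resolvent_left (hA : IsNonnegSelfAdjoint A) (f g : E) :
    inner ℂ (hA.resolvent f) g = inner ℂ f (hA.resolvent g) := by
  have h := hA.symm ⟨_, hA.resolvent_mem f⟩ ⟨_, hA.resolvent_mem g⟩
  rw [hA.apply_resolvent, hA.apply_resolvent, inner_sub_left, inner_sub_right] at h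
  exact (sub_left_inj.1 h).symm

theorem re_inner_resolvent_nonneg (hA : IsNonnegSelfAdjoint A) (f : E) :
    0 ≤ (inner ℂ f (hA.resolvent f)).re := by
  have h := hA.norm_sq_le ⟨_, hA.resolvent_mem f⟩
  rw [hA.apply_resolvent, sub_add_cancel, hA.inner_resolvent_left] at h
  exact (sq_nonneg _).trans h

theorem resolvent_injective (hA : IsNonnegSelfAdjoint A) : Function.Injective hA.resolvent := by
  rw [injective_iff_map_eq_zero]
  intro f hf
  have h := hA.apply_resolvent f
  have h0 : (⟨hA.resolvent f, hA.resolvent_mem f⟩ : A.domain) = 0 := Subtype.ext hf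
  rw [h0, A.map_zero, hf, sub_zero] at h
  exact h.symm

theorem isPositive_resolvent (hA : IsNonnegSelfAdjoint A) : hA.resolvent.IsPositive := by
  rw [ContinuousLinearMap.isPositive_def]
  refine ⟨fun f g => hA.inner_resolvent_left f g, fun f => ?_⟩
  rw [ContinuousLinearMap.reApplyInnerSelf_apply, hA.inner_resolvent_left]
  exact hA.re_inner_resolvent_nonneg f

variable [CompleteSpace E]

/-- The orthogonal complement of the range of a symmetric operator is its kernel, here trivial by
injectivity. -/
theorem denseRange_resolvent (hA : IsNonnegSelfAdjoint A) : DenseRange hA.resolvent := by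
  have h : (LinearMap.range hA.resolvent.toLinearMap).topologicalClosure = ⊤ := by
    rw [Submodule.topologicalClosure_eq_top_iff, Submodule.eq_bot_iff]
    intro v hv
    apply hA.resolvent_injective
    rw [map_zero]
    refine ext_inner_right ℂ fun f => ?_
    rw [hA.inner_resolvent_left, inner_zero_left]
    exact Submodule.mem_orthogonal' _ _ |>.1 hv _ (LinearMap.mem_range_self _ f)
  exact Submodule.dense_iff_topologicalClosure_eq_top.2 h

theorem isSelfAdjoint_resolvent (hA : IsNonnegSelfAdjoint A) : IsSelfAdjoint hA.resolvent :=
  hA.isPositive_resolvent.isSelfAdjoint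

theorem spectrum_resolvent_subset (hA : IsNonnegSelfAdjoint A) :
    spectrum ℝ hA.resolvent ⊆ Set.Icc 0 1 := by
  intro r hr
  refine ⟨spectrum_nonneg_of_nonneg
    ((ContinuousLinearMap.nonneg_iff_isPositive _).2 hA.isPositive_resolvent) hr, ?_⟩
  have h := spectrum.norm_le_norm_mul_of_mem hr
  have h1 : ‖(1 : E →L[ℂ] E)‖ ≤ 1 := ContinuousLinearMap.norm_id_le
  exact (le_abs_self r).trans (h.trans (mul_le_one₀ hA.norm_resolvent_le (norm_nonneg _) h1))

open Classical in
/-- The operator `e^{-tA}`, defined by the functional calculus of the resolvent. -/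
noncomputable def heat (hA : IsNonnegSelfAdjoint A) (t : ℝ≥0) : E →L[ℂ] E :=
  if t = 0 then 1 else cfc (heatFun t) hA.resolvent

theorem heat_zero (hA : IsNonnegSelfAdjoint A) : hA.heat 0 = 1 := if_pos rfl

theorem heat_of_pos (hA : IsNonnegSelfAdjoint A) {t : ℝ≥0} (ht : 0 < t) :
    hA.heat t = cfc (heatFun t) hA.resolvent := if_neg ht.ne'

theorem heat_add (hA : IsNonnegSelfAdjoint A) (s t : ℝ≥0) :
    hA.heat (s + t) = hA.heat s * hA.heat t := by
  rcases eq_or_ne s 0 with rfl | hs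
  · rw [hA.heat_zero, zero_add, one_mul]
  rcases eq_or_ne t 0 with rfl | ht
  · rw [hA.heat_zero, add_zero, mul_one]
  have hs' := pos_iff_ne_zero.2 hs
  have ht' := pos_iff_ne_zero.2 ht
  rw [hA.heat_of_pos hs', hA.heat_of_pos ht', hA.heat_of_pos (add_pos hs' ht'),
    ← cfc_mul _ _ _ (continuous_heatFun (NNReal.coe_pos.2 hs')).continuousOn
      (continuous_heatFun (NNReal.coe_pos.2 ht')).continuousOn]
  congr 1
  ext r
  exact heatFun_add _ _ _

theorem norm_heat_le (hA : IsNonnegSelfAdjoint A) (t : ℝ≥0) : ‖hA.heat t‖ ≤ 1 := by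
  rcases eq_or_ne t 0 with rfl | ht
  · rw [hA.heat_zero]
    exact ContinuousLinearMap.norm_id_le
  · rw [hA.heat_of_pos (pos_iff_ne_zero.2 ht)]
    refine norm_cfc_le zero_le_one fun r hr => ?_
    rw [Real.norm_of_nonneg (heatFun_nonneg _ _)]
    exact heatFun_le_one t.2 (hA.spectrum_resolvent_subset hr).2

theorem norm_heat_apply_le (hA : IsNonnegSelfAdjoint A) (t : ℝ≥0) (u : E) :
    ‖hA.heat t u‖ ≤ ‖u‖ :=
  ((hA.heat t).le_of_opNorm_le (hA.norm_heat_le t) u).trans_eq (one_mul _)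

theorem isSelfAdjoint_heat (hA : IsNonnegSelfAdjoint A) (t : ℝ≥0) : IsSelfAdjoint (hA.heat t) := by
  rcases eq_or_ne t 0 with rfl | ht
  · rw [hA.heat_zero]
    exact IsSelfAdjoint.one _
  · rw [hA.heat_of_pos (pos_iff_ne_zero.2 ht)]
    exact cfc_predicate _ _

theorem inner_heat_left (hA : IsNonnegSelfAdjoint A) (t : ℝ≥0) (u v : E) :
    inner ℂ (hA.heat t u) v = inner ℂ u (hA.heat t v) :=
  (hA.isSelfAdjoint_heat t).isSymmetric u v

theorem continuousOn_heatFun_mul (t : ℝ≥0) :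
    ContinuousOn (fun r => heatFun t r * r) (Set.Icc 0 1) := by
  rcases eq_or_ne t 0 with rfl | ht
  · refine continuousOn_id.congr fun r hr => ?_
    rcases hr.1.eq_or_lt with h | h
    · simp [← h]
    · simp [heatFun_of_pos _ h]
  · exact ((continuous_heatFun (NNReal.coe_pos.2 (pos_iff_ne_zero.2 ht))).mul
      continuous_id).continuousOn

theorem heat_mul_resolvent (hA : IsNonnegSelfAdjoint A) (t : ℝ≥0) :
    hA.heat t * hA.resolvent = cfc (fun r => heatFun t r * r) hA.resolvent := by
  have hR := hA.isSelfAdjoint_resolvent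
  rcases eq_or_ne t 0 with rfl | ht
  · rw [hA.heat_zero, one_mul]
    conv_lhs => rw [← cfc_id ℝ hA.resolvent]
    refine cfc_congr fun r hr => ?_
    rcases (hA.spectrum_resolvent_subset hr).1.eq_or_lt with h | h
    · simp [← h]
    · simp [heatFun_of_pos _ h]
  · have ht' := pos_iff_ne_zero.2 ht
    rw [hA.heat_of_pos ht', cfc_mul _ _ _ (continuous_heatFun (NNReal.coe_pos.2 ht')).continuousOn
      (continuousOn_id' _)]
    congr 1
    exact (cfc_id' ℝ hA.resolvent).symm

/-- Smoothing: `heatFun t r / r` is still continuous, so the semigroup factors through the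
resolvent. -/
theorem heat_apply_mem (hA : IsNonnegSelfAdjoint A) {t : ℝ≥0} (ht : 0 < t) (u : E) :
    hA.heat t u ∈ A.domain := by
  have h : hA.heat t = hA.resolvent * cfc (heatFunDiv t) hA.resolvent := by
    have hR := hA.isSelfAdjoint_resolvent
    conv_rhs => enter [1]; rw [← cfc_id' ℝ hA.resolvent]
    rw [hA.heat_of_pos ht, ← cfc_mul _ _ _ (continuousOn_id' _) (continuous_heatFunDiv _).continuousOn]
    congr 1
    ext r
    exact (mul_heatFunDiv (NNReal.coe_pos.2 ht) r).symm
  rw [h]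
  exact hA.resolvent_mem _

theorem norm_heat_mul_resolvent_sub_le (hA : IsNonnegSelfAdjoint A) (s t : ℝ≥0) :
    ‖hA.heat t * hA.resolvent - hA.heat s * hA.resolvent‖ ≤ |(t : ℝ) - s| := by
  rw [hA.heat_mul_resolvent, hA.heat_mul_resolvent,
    ← cfc_sub _ _ _ ((continuousOn_heatFun_mul t).mono hA.spectrum_resolvent_subset)
      ((continuousOn_heatFun_mul s).mono hA.spectrum_resolvent_subset)]
  refine norm_cfc_le (abs_nonneg _) fun r hr => ?_
  exact abs_heatFun_mul_sub_le s.2 t.2 (hA.spectrum_resolvent_subset hr).1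
    (hA.spectrum_resolvent_subset hr).2

theorem continuous_heat_apply (hA : IsNonnegSelfAdjoint A) (u : E) :
    Continuous fun t => hA.heat t u := by
  rw [continuous_iff_continuousAt]
  intro t
  have h : Tendsto (fun s => (hA.heat s - hA.heat t) u) (𝓝 t) (𝓝 0) := by
    refine tendsto_zero_of_dense (C := 2) hA.denseRange_resolvent
      (Eventually.of_forall fun s => ?_) ?_ u
    · exact (norm_sub_le _ _).trans (by linarith [hA.norm_heat_le s, hA.norm_heat_le t])
    · rintro _ ⟨f, rfl⟩
      have h1 : Tendsto (fun s : ℝ≥0 => |(s : ℝ) - t| * ‖f‖) (𝓝 t) (𝓝 0) := by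
        have : Continuous fun s : ℝ≥0 => |(s : ℝ) - t| * ‖f‖ := by fun_prop
        simpa using this.tendsto t
      refine squeeze_zero_norm (fun s => ?_) h1
      exact ContinuousLinearMap.le_of_opNorm_le _ (hA.norm_heat_mul_resolvent_sub_le t s) f
  have h2 := h.add_const (hA.heat t u)
  simpa [ContinuousAt] using h2

/-- The difference quotient of the semigroup on the range of the resolvent. -/
noncomputable def heatQuot (hA : IsNonnegSelfAdjoint A) (t : ℝ≥0) : E →L[ℂ] E :=
  (t⁻¹ : ℝ) • (hA.resolvent - hA.heat t * hA.resolvent)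

theorem heatQuot_eq (hA : IsNonnegSelfAdjoint A) (t : ℝ≥0) :
    hA.heatQuot t = cfc (fun r => (t⁻¹ : ℝ) * (r - heatFun t r * r)) hA.resolvent ∧
    (hA.heatQuot t - (1 - hA.resolvent)) * hA.resolvent =
      cfc (fun r => ((t⁻¹ : ℝ) * (r - heatFun t r * r) - (1 - r)) * r) hA.resolvent := by
  have hR := hA.isSelfAdjoint_resolvent
  have hc := (continuousOn_heatFun_mul t).mono hA.spectrum_resolvent_subset
  have hc1 : ContinuousOn (fun r : ℝ => r - heatFun t r * r) (spectrum ℝ hA.resolvent) :=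
    continuousOn_id.sub hc
  have hc2 : ContinuousOn (fun r : ℝ => (t⁻¹ : ℝ) * (r - heatFun t r * r))
      (spectrum ℝ hA.resolvent) := continuousOn_const.mul hc1
  have h1 : hA.heatQuot t = cfc (fun r => (t⁻¹ : ℝ) * (r - heatFun t r * r)) hA.resolvent := by
    rw [cfc_const_mul _ _ _ hc1, cfc_sub _ _ _ (continuousOn_id' _) hc, cfc_id' ℝ hA.resolvent,
      ← hA.heat_mul_resolvent]
    rfl
  refine ⟨h1, ?_⟩
  have hc3 : ContinuousOn (fun r : ℝ => 1 - r) (spectrum ℝ hA.resolvent) :=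
    continuousOn_const.sub continuousOn_id
  have hc4 : ContinuousOn (fun r : ℝ => (t⁻¹ : ℝ) * (r - heatFun t r * r) - (1 - r))
      (spectrum ℝ hA.resolvent) := hc2.sub hc3
  rw [cfc_mul _ _ _ hc4 (continuousOn_id' _), cfc_sub _ _ _ hc2 hc3,
    cfc_sub _ _ _ continuousOn_const (continuousOn_id' _), cfc_id' ℝ hA.resolvent,
    cfc_const_one ℝ hA.resolvent, ← h1]

/-- The quotients are bounded by `1` uniformly in `t` and converge on the dense range of the
resolvent. The limit `f - R f` is `A (R f)`. -/
theorem tendsto_heatQuot (hA : IsNonnegSelfAdjoint A) (f : E) :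
    Tendsto (fun t => hA.heatQuot t f) (𝓝[>] 0) (𝓝 (f - hA.resolvent f)) := by
  have h : Tendsto (fun t => (hA.heatQuot t - (1 - hA.resolvent)) f) (𝓝[>] 0) (𝓝 0) := by
    refine tendsto_zero_of_dense (C := 3) hA.denseRange_resolvent ?_ ?_ f
    · filter_upwards [self_mem_nhdsWithin] with t ht
      have h1 : ‖hA.heatQuot t‖ ≤ 1 := by
        rw [(hA.heatQuot_eq t).1]
        exact norm_cfc_le zero_le_one fun r hr => abs_heatFun_quot_le (NNReal.coe_pos.2 ht)
          (hA.spectrum_resolvent_subset hr).1 (hA.spectrum_resolvent_subset hr).2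
      have h2 : ‖(1 : E →L[ℂ] E)‖ ≤ 1 := ContinuousLinearMap.norm_id_le
      have h3 := hA.norm_resolvent_le
      have h4 := norm_sub_le (1 : E →L[ℂ] E) hA.resolvent
      exact (norm_sub_le _ _).trans (by linarith)
    · rintro _ ⟨g, rfl⟩
      have h1 : Tendsto (fun s : ℝ≥0 => (s : ℝ) * ‖g‖) (𝓝[>] 0) (𝓝 0) := by
        have : Continuous fun s : ℝ≥0 => (s : ℝ) * ‖g‖ := by fun_prop
        simpa using (this.tendsto 0).mono_left nhdsWithin_le_nhds
      refine squeeze_zero_norm' ?_ h1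
      filter_upwards [self_mem_nhdsWithin] with t ht
      have h2 : ‖(hA.heatQuot t - (1 - hA.resolvent)) * hA.resolvent‖ ≤ t := by
        rw [(hA.heatQuot_eq t).2]
        exact norm_cfc_le t.2 fun r hr => abs_heatFun_quot_sub_le (NNReal.coe_pos.2 ht)
          (hA.spectrum_resolvent_subset hr).1 (hA.spectrum_resolvent_subset hr).2
      exact ContinuousLinearMap.le_of_opNorm_le _ h2 g
  have h2 := h.add_const (f - hA.resolvent f)
  simpa using h2

theorem tendsto_quot_heat (hA : IsNonnegSelfAdjoint A) (u : A.domain) :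
    Tendsto (fun t : ℝ≥0 => ((t⁻¹ : ℝ≥0) : ℂ) • ((u : E) - hA.heat t u)) (𝓝[>] 0) (𝓝 (A u)) := by
  have h := hA.tendsto_heatQuot (A u + u)
  rw [hA.resolvent_apply_add, add_sub_cancel_right] at h
  refine h.congr fun t => ?_
  have h1 : hA.heatQuot t (A u + u) = (t⁻¹ : ℝ) • (hA.resolvent (A u + u) -
    hA.heat t (hA.resolvent (A u + u))) := rfl
  rw [h1, hA.resolvent_apply_add, ← Complex.coe_smul]
  norm_cast

theorem isExpSemigroup_heat (hA : IsNonnegSelfAdjoint A) : IsExpSemigroup A hA.heat where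
  zero := hA.heat_zero
  add := hA.heat_add
  continuous := hA.continuous_heat_apply
  generator := by
    intro u v
    refine ⟨fun h => ?_, ?_⟩
    · have h1 := h.sub (hA.tendsto_quot_heat ⟨_, hA.resolvent_mem (v + u)⟩)
      rw [hA.apply_resolvent] at h1
      set u' := hA.resolvent (v + u) with hu'
      have h2 : v - (v + u - u') = -(u - u') := by abel
      rw [h2] at h1
      have h3 : Tendsto (fun t : ℝ≥0 => (inner ℂ (u - u')
          (((t⁻¹ : ℝ≥0) : ℂ) • (u - hA.heat t u) - ((t⁻¹ : ℝ≥0) : ℂ) • (u' - hA.heat t u'))).re)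
          (𝓝[>] 0) (𝓝 (inner ℂ (u - u') (-(u - u'))).re) :=
        (Complex.continuous_re.tendsto _).comp (tendsto_const_nhds.inner h1)
      have h4 : 0 ≤ (inner ℂ (u - u') (-(u - u'))).re := by
        refine ge_of_tendsto' h3 fun t => ?_
        rw [← smul_sub, sub_sub_sub_comm, ← map_sub, inner_smul_right]
        have h5 : (((t⁻¹ : ℝ≥0) : ℂ)) = (((t⁻¹ : ℝ≥0) : ℝ) : ℂ) := rfl
        rw [h5, Complex.re_ofReal_mul]
        refine mul_nonneg (NNReal.coe_nonneg _) ?_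
        rw [inner_sub_right, Complex.sub_re, re_inner_self]
        have h6 := re_inner_le_norm (𝕜 := ℂ) (u - u') (hA.heat t (u - u'))
        have h7 := mul_le_mul_of_nonneg_left (hA.norm_heat_apply_le t (u - u'))
          (norm_nonneg (u - u'))
        simp only [RCLike.re_to_complex] at h6
        linarith [sq ‖u - u'‖]
      rw [inner_neg_right, Complex.neg_re, re_inner_self] at h4
      have h5 : u - u' = 0 := norm_eq_zero.1 (by nlinarith [norm_nonneg (u - u')])
      have h6 : u = u' := sub_eq_zero.1 h5
      have h7 : u ∈ A.domain := h6 ▸ hA.resolvent_mem _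
      refine ⟨h7, ?_⟩
      have h8 := hA.apply_resolvent (v + u)
      have h9 : (⟨hA.resolvent (v + u), hA.resolvent_mem _⟩ : A.domain) = ⟨u, h7⟩ :=
        Subtype.ext h6.symm
      rw [h9, ← hu', ← h6, add_sub_cancel_right] at h8
      exact h8
    · rintro ⟨h, rfl⟩
      exact hA.tendsto_quot_heat ⟨u, h⟩

end IsNonnegSelfAdjoint

end AbstractSemigroup

/-! ### Uniqueness of the semigroup and its injectivity. -/

section SemigroupUniqueness

variable {E : Type*} [NormedAddCommGroup E] [InnerProductSpace ℂ E]

theorem tendsto_toNNReal_sub_nhdsGT (x : ℝ) :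
    Tendsto (fun y : ℝ => (y - x).toNNReal) (𝓝[>] x) (𝓝[>] 0) := by
  refine tendsto_nhdsWithin_iff.2 ⟨?_, ?_⟩
  · have h : Continuous fun y : ℝ => (y - x).toNNReal := by fun_prop
    simpa using (h.tendsto x).mono_left nhdsWithin_le_nhds
  · filter_upwards [self_mem_nhdsWithin] with y hy
    exact Real.toNNReal_pos.2 (sub_pos.2 hy)

/-- The derivative of `‖z‖²` is `2 Re ⟨z, z'⟩`. One-sided derivatives suffice, and the definition of
the generator provides only those. -/
theorem norm_le_of_dissipative {z z' : ℝ → E} {b : ℝ} (hb : 0 ≤ b)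
    (hz : ContinuousOn z (Set.Icc 0 b))
    (hz' : ∀ x ∈ Set.Ico 0 b, HasDerivWithinAt z (z' x) (Set.Ici x) x)
    (hle : ∀ x ∈ Set.Ico 0 b, (inner ℂ (z x) (z' x)).re ≤ 0) : ‖z b‖ ≤ ‖z 0‖ := by
  have h : ‖z b‖ ^ 2 ≤ ‖z 0‖ ^ 2 := by
    refine image_le_of_liminf_slope_right_le_deriv_boundary (f := fun x => ‖z x‖ ^ 2)
      (B := fun _ => ‖z 0‖ ^ 2) (B' := fun _ => 0) (hz.norm.pow 2) le_rfl continuousOn_const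
      (fun x _ => hasDerivWithinAt_const _ _ _) (fun x hx r hr => ?_) (Set.right_mem_Icc.2 hb)
    have h1 := Complex.reCLM.hasFDerivAt.comp_hasDerivWithinAt x
      ((hz' x hx).inner ℂ (hz' x hx))
    have h3 : (Complex.reCLM ∘ fun y => inner ℂ (z y) (z y)) = fun y => ‖z y‖ ^ 2 := by
      ext y
      exact re_inner_self _
    have h4 : Complex.reCLM (inner ℂ (z x) (z' x) + inner ℂ (z' x) (z x)) =
        2 * (inner ℂ (z x) (z' x)).re := by
      have := inner_re_symm (𝕜 := ℂ) (z' x) (z x)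
      simp only [RCLike.re_to_complex] at this
      rw [Complex.reCLM_apply, Complex.add_re, this, two_mul]
    rw [h3, h4] at h1
    have h2 := h1.Ioi_of_Ici
    exact (hasDerivWithinAt_iff_tendsto_slope' (Set.self_notMem_Ioi)).1 h2
      |>.eventually_lt_const (lt_of_le_of_lt (by linarith [hle x hx]) hr) |>.frequently
  exact (pow_le_pow_iff_left₀ (norm_nonneg _) (norm_nonneg _) two_ne_zero).1 h

namespace IsExpSemigroup

variable {A : E →ₗ.[ℂ] E} {T S : ℝ≥0 → E →L[ℂ] E}

theorem apply_mem (hT : IsExpSemigroup A T) (s : ℝ≥0) (u : A.domain) :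
    ∃ h : T s u ∈ A.domain, A ⟨T s u, h⟩ = T s (A u) := by
  rw [← hT.generator]
  have h := ((T s).continuous.tendsto _).comp ((hT.generator u (A u)).2 ⟨u.2, rfl⟩)
  refine h.congr fun t => ?_
  have h1 : T t (T s u) = T s (T t u) := by
    rw [← ContinuousLinearMap.comp_apply, ← hT.add, add_comm, hT.add]
    rfl
  rw [Function.comp_apply, map_smul, map_sub, h1]

theorem hasDerivWithinAt (hT : IsExpSemigroup A T) {x : ℝ} (hx : 0 ≤ x) (u : E)
    (h : T x.toNNReal u ∈ A.domain) :
    HasDerivWithinAt (fun y : ℝ => T y.toNNReal u) (-A ⟨_, h⟩) (Set.Ici x) x := by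
  rw [← hasDerivWithinAt_Ioi_iff_Ici, hasDerivWithinAt_iff_tendsto_slope' Set.self_notMem_Ioi]
  have h1 := (((hT.generator _ _).2 ⟨h, rfl⟩).comp (tendsto_toNNReal_sub_nhdsGT x)).neg
  refine h1.congr' ?_
  filter_upwards [self_mem_nhdsWithin] with y hy
  have hy' : x < y := hy
  have h2 : T y.toNNReal u = T (y - x).toNNReal (T x.toNNReal u) := by
    rw [← ContinuousLinearMap.comp_apply, ← hT.add, ← Real.toNNReal_add (sub_pos.2 hy').le hx,
      sub_add_cancel]
  have h3 : (((y - x).toNNReal⁻¹ : ℝ≥0) : ℂ) = (((y - x)⁻¹ : ℝ) : ℂ) := by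
    rw [← Real.toNNReal_inv]
    exact congrArg _ (Real.coe_toNNReal _ (inv_pos.2 (sub_pos.2 hy')).le)
  rw [Function.comp_apply, slope_def_module, h2, h3, Complex.coe_smul, ← smul_neg, neg_sub]

theorem continuous_real (hT : IsExpSemigroup A T) (u : E) :
    Continuous fun y : ℝ => T y.toNNReal u :=
  (hT.continuous u).comp continuous_real_toNNReal

theorem eq_of_dense (hT : IsExpSemigroup A T) (hS : IsExpSemigroup A S)
    (hpos : ∀ u : A.domain, 0 ≤ (inner ℂ (u : E) (A u)).re) (hd : Dense (A.domain : Set E)) :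
    T = S := by
  funext t
  refine ContinuousLinearMap.coeFn_injective
    ((T t).continuous.ext_on hd (S t).continuous fun u hu => ?_)
  have hmT := fun x : ℝ => hT.apply_mem x.toNNReal ⟨u, hu⟩
  have hmS := fun x : ℝ => hS.apply_mem x.toNNReal ⟨u, hu⟩
  have hm : ∀ x : ℝ, T x.toNNReal u - S x.toNNReal u ∈ A.domain := fun x =>
    A.domain.sub_mem (hmT x).1 (hmS x).1
  have h := norm_le_of_dissipative (z := fun y => T y.toNNReal u - S y.toNNReal u)
    (z' := fun x => -A ⟨_, hm x⟩) t.2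
    ((hT.continuous_real u).sub (hS.continuous_real u)).continuousOn
    (fun x hx => ?_) (fun x _ => ?_)
  · simpa [hT.zero, hS.zero, sub_eq_zero] using h
  · have h1 := (hT.hasDerivWithinAt hx.1 u (hmT x).1).sub (hS.hasDerivWithinAt hx.1 u (hmS x).1)
    refine HasDerivWithinAt.congr_deriv h1 ?_
    rw [neg_sub_neg, ← neg_sub, ← A.map_sub]
    rfl
  · rw [inner_neg_right, Complex.neg_re]
    exact neg_nonpos.2 (hpos ⟨_, hm x⟩)

end IsExpSemigroup

namespace IsNonnegSelfAdjoint

variable [CompleteSpace E] {A : E →ₗ.[ℂ] E} {T : ℝ≥0 → E →L[ℂ] E}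

theorem dense_domain (hA : IsNonnegSelfAdjoint A) : Dense (A.domain : Set E) :=
  hA.denseRange_resolvent.mono (by
    rintro _ ⟨f, rfl⟩
    exact hA.resolvent_mem f)

theorem eq_heat (hA : IsNonnegSelfAdjoint A) (hT : IsExpSemigroup A T) : T = hA.heat :=
  hT.eq_of_dense hA.isExpSemigroup_heat hA.nonneg hA.dense_domain

theorem existsUnique_isExpSemigroup (hA : IsNonnegSelfAdjoint A) :
    ∃! T : ℝ≥0 → E →L[ℂ] E, IsExpSemigroup A T :=
  ⟨hA.heat, hA.isExpSemigroup_heat, fun _ hT => hA.eq_heat hT⟩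

theorem norm_heat_half_sq (hA : IsNonnegSelfAdjoint A) (t : ℝ≥0) (u : E) :
    ‖hA.heat (t / 2) u‖ ^ 2 = (inner ℂ u (hA.heat t u)).re := by
  conv_rhs => rw [← add_halves t, hA.heat_add]
  rw [mul_apply_eq_comp, ← hA.inner_heat_left, re_inner_self]

/-- If the orbit vanishes at `t`, then `‖T(t/2) u‖² = ⟨u, T(t) u⟩` makes it vanish at `t/2`, hence
at all `t/2ⁿ`, and strong continuity at `0` gives `u = 0`. -/
theorem heat_apply_ne_zero (hA : IsNonnegSelfAdjoint A) (t : ℝ≥0) {u : E} (hu : u ≠ 0) :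
    hA.heat t u ≠ 0 := by
  intro h
  have h1 : ∀ n : ℕ, hA.heat (t / 2 ^ n) u = 0 := by
    intro n
    induction n with
    | zero => simpa using h
    | succ n ih =>
      have h2 := hA.norm_heat_half_sq (t / 2 ^ n) u
      rw [ih, inner_zero_right, Complex.zero_re, div_div, ← pow_succ] at h2
      exact norm_eq_zero.1 (pow_eq_zero_iff two_ne_zero |>.1 h2)
  have h2 : Tendsto (fun n : ℕ => t / 2 ^ n) atTop (𝓝 0) := by
    have h3 : Tendsto (fun n : ℕ => t * ((2 : ℝ≥0)⁻¹) ^ n) atTop (𝓝 (t * 0)) :=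
      (NNReal.tendsto_pow_atTop_nhds_zero_of_lt_one (by
        rw [← NNReal.coe_lt_coe]; norm_num)).const_mul t
    simpa [div_eq_mul_inv] using h3
  have h3 := ((hA.continuous_heat_apply u).tendsto 0).comp h2
  have h4 : Tendsto (fun _ : ℕ => (0 : E)) atTop (𝓝 (hA.heat 0 u)) := h3.congr fun n => h1 n
  rw [hA.heat_zero] at h4
  exact hu (tendsto_nhds_unique h4 tendsto_const_nhds)

end IsNonnegSelfAdjoint

end SemigroupUniqueness

/-! ### The cone of nonnegative functions -/

theorem lipschitzWith_ofReal_max_re : LipschitzWith 1 fun z : ℂ => ((max z.re 0 : ℝ) : ℂ) := by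
  refine LipschitzWith.of_dist_le_mul fun z w => ?_
  rw [NNReal.coe_one, one_mul, Complex.dist_eq, Complex.dist_eq, ← Complex.ofReal_sub,
    Complex.norm_real, Real.norm_eq_abs]
  refine (abs_max_sub_max_le_abs _ _ _).trans ?_
  rw [← Complex.sub_re]
  exact Complex.abs_re_le_norm _

theorem ofReal_max_re_zero : ((max (0 : ℂ).re 0 : ℝ) : ℂ) = 0 := by simp

/-- The positive part of the real part of `u`. -/
noncomputable def rePosPart (u : L2R) : L2R :=
  lipschitzWith_ofReal_max_re.compLp ofReal_max_re_zero u

theorem coeFn_rePosPart (u : L2R) :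
    rePosPart u =ᵐ[volume] fun x => ((max (u x).re 0 : ℝ) : ℂ) :=
  lipschitzWith_ofReal_max_re.coeFn_compLp ofReal_max_re_zero u

theorem continuous_rePosPart : Continuous rePosPart :=
  lipschitzWith_ofReal_max_re.continuous_compLp ofReal_max_re_zero

theorem aeNonneg_rePosPart (u : L2R) : AENonneg (rePosPart u) := by
  filter_upwards [coeFn_rePosPart u] with x hx
  rw [hx]
  exact ⟨le_max_right _ _, Complex.ofReal_im _⟩

theorem AENonneg.rePosPart_eq {u : L2R} (hu : AENonneg u) : rePosPart u = u := by
  refine Lp.ext ?_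
  filter_upwards [coeFn_rePosPart u, hu] with x hx hx'
  rw [hx, max_eq_left hx'.1]
  exact Complex.ext rfl (by rw [hx'.2, Complex.ofReal_im])

theorem AENonneg.re_conj_mul {u v : L2R} (hu : AENonneg u) (hv : AENonneg v) :
    ∀ᵐ x, (starRingEnd ℂ (u x) * v x).re = (u x).re * (v x).re := by
  filter_upwards [hu, hv] with x h1 h2
  simp [Complex.mul_re, h2.2]

theorem AENonneg.re_inner_nonneg {u v : L2R} (hu : AENonneg u) (hv : AENonneg v) :
    0 ≤ (inner ℂ u v).re := by
  rw [re_inner_eq_integral]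
  refine integral_nonneg_of_ae ?_
  filter_upwards [hu.re_conj_mul hv, hu, hv] with x h1 h2 h3
  rw [h1]
  exact mul_nonneg h2.1 h3.1

theorem AENonneg.mul_eq_zero_of_inner {u v : L2R} (hu : AENonneg u) (hv : AENonneg v)
    (h : (inner ℂ u v).re = 0) : ∀ᵐ x, u x = 0 ∨ v x = 0 := by
  rw [re_inner_eq_integral, integral_eq_zero_iff_of_nonneg_ae _ (integrable_re_conj_mul u v)] at h
  · filter_upwards [h, hu.re_conj_mul hv, hu, hv] with x h0 h1 h2 h3
    rw [h1] at h0
    rcases mul_eq_zero.1 h0 with h4 | h4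
    · exact Or.inl (Complex.ext h4 h2.2)
    · exact Or.inr (Complex.ext h4 h3.2)
  · filter_upwards [hu.re_conj_mul hv, hu, hv] with x h1 h2 h3
    rw [h1]
    exact mul_nonneg h2.1 h3.1

theorem AEPos.aeNonneg {u : L2R} (hu : AEPos u) : AENonneg u := by
  filter_upwards [hu] with x hx using ⟨hx.1.le, hx.2⟩

theorem AENonneg.eq_zero_of_inner_aePos {u v : L2R} (hu : AENonneg u) (hv : AEPos v)
    (h : (inner ℂ u v).re = 0) : u = 0 := by
  refine Lp.ext ?_
  filter_upwards [hu.mul_eq_zero_of_inner hv.aeNonneg h, hv, Lp.coeFn_zero ℂ 2 volume]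
    with x h1 h2 h3
  rw [h3]
  refine h1.resolve_right fun h4 => ?_
  rw [h4] at h2
  exact lt_irrefl _ h2.1

theorem re_conj_sub_max_mul_le (z : ℂ) {p : ℝ} (hp : 0 ≤ p) :
    (starRingEnd ℂ (z - ((max z.re 0 : ℝ) : ℂ)) * p).re ≤ 0 := by
  have h : (starRingEnd ℂ (z - ((max z.re 0 : ℝ) : ℂ)) * p).re = (z.re - max z.re 0) * p := by
    simp [Complex.mul_re]
  rw [h]
  exact mul_nonpos_of_nonpos_of_nonneg (sub_nonpos.2 (le_max_left _ _)) hp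

theorem re_conj_sub_max_mul_self (z : ℂ) :
    (starRingEnd ℂ (z - ((max z.re 0 : ℝ) : ℂ)) * z).re = ‖z - ((max z.re 0 : ℝ) : ℂ)‖ ^ 2 := by
  rw [← Complex.normSq_eq_norm_sq, Complex.normSq_apply]
  simp only [map_sub, Complex.conj_ofReal, Complex.mul_re, Complex.sub_re, Complex.conj_re,
    Complex.ofReal_re, Complex.sub_im, Complex.conj_im, Complex.ofReal_im]
  rcases le_total z.re 0 with h | h
  · rw [max_eq_right h]; ring
  · rw [max_eq_left h]; ring

theorem coeFn_sub_rePosPart (u : L2R) :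
    (u - rePosPart u : L2R) =ᵐ[volume] fun x => u x - ((max (u x).re 0 : ℝ) : ℂ) := by
  filter_upwards [Lp.coeFn_sub u (rePosPart u), coeFn_rePosPart u] with x h1 h2
  rw [h1, Pi.sub_apply, h2]

/-- With `re_inner_sub_rePosPart_rePosPart`, this says that `rePosPart` is the metric projection
onto the cone for the real inner product: the residual lies in the polar cone and is orthogonal to
the projection. -/
theorem re_inner_sub_rePosPart_le (u : L2R) {p : L2R} (hp : AENonneg p) :
    (inner ℂ (u - rePosPart u) p).re ≤ 0 := by
  rw [re_inner_eq_integral]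
  refine integral_nonpos_of_ae ?_
  filter_upwards [coeFn_sub_rePosPart u, hp] with x h1 h2
  have h3 : p x = ((p x).re : ℂ) := Complex.ext rfl (by rw [h2.2, Complex.ofReal_im])
  rw [h1, h3]
  exact re_conj_sub_max_mul_le _ h2.1

theorem re_inner_sub_rePosPart_self (u : L2R) :
    (inner ℂ (u - rePosPart u) u).re = ‖u - rePosPart u‖ ^ 2 := by
  rw [re_inner_eq_integral, norm_sq_eq_integral]
  refine integral_congr_ae ?_
  filter_upwards [coeFn_sub_rePosPart u] with x h1
  rw [h1, re_conj_sub_max_mul_self]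

theorem re_inner_sub_rePosPart_rePosPart (u : L2R) :
    (inner ℂ (u - rePosPart u) (rePosPart u)).re = 0 := by
  have h := re_inner_sub_rePosPart_self u
  have h1 : (inner ℂ (u - rePosPart u) u).re =
      (inner ℂ (u - rePosPart u) (u - rePosPart u)).re +
        (inner ℂ (u - rePosPart u) (rePosPart u)).re := by
    rw [← Complex.add_re, ← inner_add_right, sub_add_cancel]
  rw [re_inner_self] at h1
  linarith

theorem norm_sub_rePosPart_le (u : L2R) {p : L2R} (hp : AENonneg p) :
    ‖u - rePosPart u‖ ≤ ‖u - p‖ := by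
  have h1 := re_inner_le_norm (𝕜 := ℂ) (u - rePosPart u) (u - p)
  simp only [RCLike.re_to_complex] at h1
  rw [inner_sub_right, Complex.sub_re, re_inner_sub_rePosPart_self] at h1
  have h2 := re_inner_sub_rePosPart_le u hp
  by_contra! h
  nlinarith [norm_nonneg (u - rePosPart u), norm_nonneg (u - p)]

theorem aeNonneg_of_norm_sub_rePosPart {u : L2R} (h : ‖u - rePosPart u‖ = 0) : AENonneg u := by
  rw [sub_eq_zero.1 (norm_eq_zero.1 h)]
  exact aeNonneg_rePosPart u

/-! ### Positivity of the Poisson semigroup -/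

theorem AENonneg.ae_poissonOp {t : ℝ} (ht : 0 < t) {u : L2R} (hu : AENonneg u) :
    ∀ᵐ x, poissonOp ht.le u x = ((∫ y, cauchyKernel t (x - y) * (u y).re : ℝ) : ℂ) := by
  filter_upwards [coeFn_poissonOp ht u] with x hx
  rw [hx, inner_poissonVec]
  refine Eq.trans (integral_congr_ae ?_) (integral_ofReal (𝕜 := ℂ))
  filter_upwards [hu] with y hy
  have h : u y = ((u y).re : ℂ) := Complex.ext rfl (by rw [hy.2, Complex.ofReal_im])
  conv_lhs => rw [h]
  exact (Complex.ofReal_mul _ _).symm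

theorem AENonneg.aeNonneg_poissonOp {t : ℝ} (ht : 0 < t) {u : L2R} (hu : AENonneg u) :
    AENonneg (poissonOp ht.le u) := by
  filter_upwards [hu.ae_poissonOp ht] with x hx
  rw [hx]
  refine ⟨?_, Complex.ofReal_im _⟩
  rw [Complex.ofReal_re]
  refine integral_nonneg_of_ae ?_
  filter_upwards [hu] with y hy
  exact mul_nonneg (cauchyKernel_pos ht _).le hy.1

theorem integrable_cauchyKernel_mul_re {t : ℝ} (ht : 0 < t) (x : ℝ) (u : L2R) :
    Integrable fun y => cauchyKernel t (x - y) * (u y).re := by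
  refine (integrable_re_conj_mul (poissonVec ht x) u).congr ?_
  filter_upwards [coeFn_poissonVec ht x] with y hy
  rw [hy, Complex.conj_ofReal, Complex.re_ofReal_mul, ← neg_sub, cauchyKernel_neg]

theorem AENonneg.aePos_poissonOp {t : ℝ} (ht : 0 < t) {u : L2R} (hu : AENonneg u) (h0 : u ≠ 0) :
    AEPos (poissonOp ht.le u) := by
  filter_upwards [hu.ae_poissonOp ht] with x hx
  rw [hx]
  refine ⟨?_, Complex.ofReal_im _⟩
  rw [Complex.ofReal_re]
  have h1 : 0 ≤ᵐ[volume] fun y => cauchyKernel t (x - y) * (u y).re := by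
    filter_upwards [hu] with y hy
    exact mul_nonneg (cauchyKernel_pos ht _).le hy.1
  refine lt_of_le_of_ne (integral_nonneg_of_ae h1) fun h => h0 ?_
  have h2 := (integral_eq_zero_iff_of_nonneg_ae h1 (integrable_cauchyKernel_mul_re ht x u)).1 h.symm
  refine Lp.ext ?_
  filter_upwards [h2, hu, Lp.coeFn_zero ℂ 2 volume] with y h3 h4 h5
  rw [h5]
  exact Complex.ext ((mul_eq_zero.1 h3).resolve_left (cauchyKernel_pos ht _).ne') h4.2

theorem mul_cauchyKernel_one_le {t : ℝ} (ht : 0 < t) (h1 : t < 1) (x : ℝ) :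
    t * cauchyKernel 1 x ≤ cauchyKernel t x := by
  rw [cauchyKernel, cauchyKernel, mul_one_div]
  refine div_le_div_of_nonneg_left ht.le (by positivity) ?_
  refine mul_le_mul_of_nonneg_left ?_ Real.pi_pos.le
  nlinarith

/-- A lower bound linear in `t` for the off-diagonal kernel, which therefore survives in the
generator. -/
theorem AENonneg.poissonOp_sub_smul {t : ℝ} (ht : 0 < t) (h1 : t < 1) {u : L2R} (hu : AENonneg u) :
    AENonneg (poissonOp ht.le u - (t : ℂ) • poissonOp zero_le_one u) := by
  filter_upwards [hu.ae_poissonOp ht, hu.ae_poissonOp one_pos, Lp.coeFn_sub (poissonOp ht.le u)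
    ((t : ℂ) • poissonOp zero_le_one u), Lp.coeFn_smul (t : ℂ) (poissonOp zero_le_one u)]
    with x h2 h3 h4 h5
  rw [h4, Pi.sub_apply, h5, Pi.smul_apply, h2, h3, smul_eq_mul, ← Complex.ofReal_mul,
    ← Complex.ofReal_sub]
  refine ⟨?_, Complex.ofReal_im _⟩
  rw [Complex.ofReal_re, sub_nonneg, ← integral_const_mul]
  refine integral_mono_ae ((integrable_cauchyKernel_mul_re one_pos x u).const_mul t)
    (integrable_cauchyKernel_mul_re ht x u) ?_
  filter_upwards [hu] with y hy
  rw [← mul_assoc]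
  exact mul_le_mul_of_nonneg_right (mul_cauchyKernel_one_le ht h1 _) hy.1

/-- The form version of positivity preservation: `e^{-t|D|}` is a contraction mapping the cone to
itself, so the residual `n` satisfies `Re ⟨n, e^{-t|D|} u⟩ ≤ ‖n‖² = Re ⟨n, u⟩`. -/
theorem re_inner_sub_rePosPart_absD_nonneg (u : absD.domain) :
    0 ≤ (inner ℂ ((u : L2R) - rePosPart u) (absD u)).re := by
  refine le_re_inner_absD u fun t ht _ => ?_
  rw [mul_zero]
  set n : L2R := (u : L2R) - rePosPart u with hn
  have h1 : (inner ℂ n (poissonOp ht.le (u : L2R))).re ≤ ‖n‖ ^ 2 := by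
    have h2 : (u : L2R) = n + rePosPart u := by rw [hn, sub_add_cancel]
    conv_lhs => rw [h2]
    rw [map_add, inner_add_right, Complex.add_re]
    have h3 := re_inner_sub_rePosPart_le (u : L2R) ((aeNonneg_rePosPart (u : L2R)).aeNonneg_poissonOp ht)
    have h4 := re_inner_le_norm (𝕜 := ℂ) n (poissonOp ht.le n)
    have h5 := mul_le_mul_of_nonneg_left (norm_poissonOp_le ht.le n) (norm_nonneg n)
    simp only [RCLike.re_to_complex] at h4
    linarith [sq ‖n‖]
  rw [inner_sub_right, Complex.sub_re, hn, re_inner_sub_rePosPart_self, ← hn]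
  linarith

theorem re_inner_sub_rePosPart_mulOp_nonneg {V : ℝ → ℝ} (hV : ∀ x, 0 ≤ V x)
    (u : (mulOp V).domain) : 0 ≤ (inner ℂ ((u : L2R) - rePosPart u) (mulOp V u)).re := by
  rw [re_inner_eq_integral]
  refine integral_nonneg_of_ae ?_
  filter_upwards [coeFn_sub_rePosPart (u : L2R), coeFn_mulOp u] with x h1 h2
  rw [h1, h2, mul_left_comm, Complex.re_ofReal_mul, re_conj_sub_max_mul_self]
  exact mul_nonneg (hV x) (sq_nonneg _)

/-- Nonlocality of `|D|`. By orthogonality `-⟨p, q - e^{-t|D|} q⟩ = ⟨p, e^{-t|D|} q⟩ ≥ t ⟨p,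
e^{-|D|} q⟩`, and the last pairing is strictly positive. -/
theorem re_inner_absD_neg {p : L2R} (q : absD.domain) (hp : AENonneg p) (hq : AENonneg (q : L2R))
    (hp0 : p ≠ 0) (hq0 : (q : L2R) ≠ 0) (hpq : (inner ℂ p (q : L2R)).re = 0) :
    (inner ℂ p (absD q)).re < 0 := by
  have h1 : 0 < (inner ℂ p (poissonOp zero_le_one (q : L2R))).re := by
    have h2 := hq.aePos_poissonOp one_pos hq0
    exact lt_of_le_of_ne (hp.re_inner_nonneg h2.aeNonneg)
      fun h => hp0 (hp.eq_zero_of_inner_aePos h2 h.symm)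
  have h3 := le_re_inner_absD (w := -p) q
    (c := (inner ℂ p (poissonOp zero_le_one (q : L2R))).re) fun t ht ht1 => by
      have h4 := hp.re_inner_nonneg (hq.poissonOp_sub_smul ht ht1)
      rw [inner_sub_right, Complex.sub_re, inner_smul_right, Complex.re_ofReal_mul] at h4
      rw [inner_neg_left, Complex.neg_re, inner_sub_right, Complex.sub_re, hpq]
      linarith
  rw [inner_neg_left, Complex.neg_re] at h3
  linarith

/-! ### The operator `|D| + V` -/

/-- The operator `|D| + V`. -/
noncomputable def absDAdd (V : ℝ → ℝ) : L2R →ₗ.[ℂ] L2R := absD + mulOp V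

theorem absDAdd_apply {V : ℝ → ℝ} (u : (absDAdd V).domain) :
    absDAdd V u = absD ⟨u, u.2.1⟩ + mulOp V ⟨u, u.2.2⟩ :=
  LinearPMap.add_apply _ _ u

theorem re_inner_sub_rePosPart_absDAdd_nonneg {V : ℝ → ℝ} (hV : ∀ x, 0 ≤ V x)
    (u : (absDAdd V).domain) :
    0 ≤ (inner ℂ ((u : L2R) - rePosPart u) (absDAdd V u)).re := by
  rw [absDAdd_apply, inner_add_right, Complex.add_re]
  exact add_nonneg (re_inner_sub_rePosPart_absD_nonneg ⟨u, u.2.1⟩)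
    (re_inner_sub_rePosPart_mulOp_nonneg hV ⟨u, u.2.2⟩)

theorem re_inner_absDAdd_neg {V : ℝ → ℝ} {p : L2R} (q : (absDAdd V).domain) (hp : AENonneg p)
    (hq : AENonneg (q : L2R)) (hp0 : p ≠ 0) (hq0 : (q : L2R) ≠ 0)
    (hpq : (inner ℂ p (q : L2R)).re = 0) : (inner ℂ p (absDAdd V q)).re < 0 := by
  have h1 := re_inner_absD_neg ⟨q, q.2.1⟩ hp hq hp0 hq0 hpq
  have h2 : (inner ℂ p (mulOp V ⟨q, q.2.2⟩)).re = 0 := by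
    rw [re_inner_eq_integral]
    refine integral_eq_zero_of_ae ?_
    filter_upwards [hp.mul_eq_zero_of_inner hq hpq, coeFn_mulOp (⟨q, q.2.2⟩ : (mulOp V).domain)]
      with x h3 h4
    rw [h4]
    rcases h3 with h3 | h3 <;> simp [h3]
  rw [absDAdd_apply, inner_add_right, Complex.add_re, h2, add_zero]
  exact h1

theorem ComparablePotential.isNonnegSelfAdjoint {α c C : ℝ} {V : ℝ → ℝ}
    (hV : ComparablePotential α c C V) : IsNonnegSelfAdjoint (absDAdd V) where
  symm u v := by
    rw [absDAdd_apply, absDAdd_apply, inner_add_left, inner_add_right]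
    exact congrArg₂ _ (inner_absD_left ⟨u, u.2.1⟩ ⟨v, v.2.1⟩)
      (inner_mulOp_left ⟨u, u.2.2⟩ ⟨v, v.2.2⟩)
  nonneg u := by
    rw [absDAdd_apply, inner_add_right, Complex.add_re]
    exact add_nonneg (re_inner_absD_nonneg ⟨u, u.2.1⟩) (re_inner_mulOp_nonneg hV.nonneg ⟨u, u.2.2⟩)
  surj f := by
    obtain ⟨K, -, hK⟩ := hV.exists_solution
    obtain ⟨u, hd, hv, h, -⟩ := hK f
    refine ⟨⟨u, hd, hv⟩, ?_⟩
    rw [absDAdd_apply]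
    exact h

/-! ### Positivity preservation and improvement. -/

section Positivity

variable {A : L2R →ₗ.[ℂ] L2R}

theorem IsNonnegSelfAdjoint.aeNonneg_heat (hA : IsNonnegSelfAdjoint A)
    (hN : ∀ u : A.domain, 0 ≤ (inner ℂ ((u : L2R) - rePosPart u) (A u)).re) (t : ℝ≥0) {u : L2R}
    (hu : AENonneg u) : AENonneg (hA.heat t u) := by
  have hT := hA.isExpSemigroup_heat
  have hc : Continuous fun y : ℝ => hA.heat y.toNNReal u - rePosPart (hA.heat y.toNNReal u) :=
    (hT.continuous_real u).sub (continuous_rePosPart.comp (hT.continuous_real u))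
  -- The squared distance to the cone does not increase. It is followed from a positive time because
  -- the orbit of a general `u` enters the domain only for `t > 0`.
  have key : ∀ ε : ℝ, 0 < ε → ε ≤ t →
      ‖hA.heat t u - rePosPart (hA.heat t u)‖ ^ 2 ≤
        ‖hA.heat ε.toNNReal u - rePosPart (hA.heat ε.toNNReal u)‖ ^ 2 := by
    intro ε hε hεt
    have h := image_le_of_liminf_slope_right_le_deriv_boundary
      (f := fun y : ℝ => ‖hA.heat y.toNNReal u - rePosPart (hA.heat y.toNNReal u)‖ ^ 2)
      (a := ε) (b := t)
      (B := fun _ => ‖hA.heat ε.toNNReal u - rePosPart (hA.heat ε.toNNReal u)‖ ^ 2)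
      (B' := fun _ => 0) (hc.norm.pow 2).continuousOn le_rfl continuousOn_const
      (fun x _ => hasDerivWithinAt_const _ _ _) (fun x hx r hr => ?_) (Set.right_mem_Icc.2 hεt)
    · simpa using h
    · have hx0 : 0 < x := hε.trans_le hx.1
      have hm := hA.heat_apply_mem (Real.toNNReal_pos.2 hx0) u
      -- The projection is frozen at time `x`: the distance to this fixed point of the cone
      -- dominates the distance to the cone, with equality at `x`, and is differentiable from the
      -- right.
      have h1 := (hT.hasDerivWithinAt hx0.le u hm).sub_const (rePosPart (hA.heat x.toNNReal u))
      have h2 := Complex.reCLM.hasFDerivAt.comp_hasDerivWithinAt x (h1.inner ℂ h1)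
      have h3 : (Complex.reCLM ∘ fun y : ℝ => inner ℂ
          (hA.heat y.toNNReal u - rePosPart (hA.heat x.toNNReal u))
          (hA.heat y.toNNReal u - rePosPart (hA.heat x.toNNReal u))) =
          fun y => ‖hA.heat y.toNNReal u - rePosPart (hA.heat x.toNNReal u)‖ ^ 2 := by
        ext y
        exact re_inner_self _
      rw [h3, ← hasDerivWithinAt_Ioi_iff_Ici,
        hasDerivWithinAt_iff_tendsto_slope' Set.self_notMem_Ioi] at h2
      have h4 := hN ⟨_, hm⟩
      have h5 := inner_re_symm (𝕜 := ℂ) (-A ⟨_, hm⟩)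
        (hA.heat x.toNNReal u - rePosPart (hA.heat x.toNNReal u))
      simp only [RCLike.re_to_complex] at h5
      rw [Complex.reCLM_apply, Complex.add_re, h5, inner_neg_right, Complex.neg_re] at h2
      refine Eventually.frequently ?_
      filter_upwards [h2.eventually_lt_const (u := r) (by linarith), self_mem_nhdsWithin]
        with y hy hxy
      refine lt_of_le_of_lt ?_ hy
      rw [slope_def_field, slope_def_field]
      refine div_le_div_of_nonneg_right ?_ (sub_pos.2 hxy).le
      refine sub_le_sub_right ?_ _
      exact pow_le_pow_left₀ (norm_nonneg _) (norm_sub_rePosPart_le _ (aeNonneg_rePosPart _)) 2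
  rcases eq_or_ne t 0 with rfl | ht
  · rw [hA.heat_zero]
    exact hu
  refine aeNonneg_of_norm_sub_rePosPart ?_
  have h1 : Tendsto (fun y : ℝ => ‖hA.heat y.toNNReal u - rePosPart (hA.heat y.toNNReal u)‖ ^ 2)
      (𝓝[>] 0) (𝓝 0) := by
    have h2 := ((hc.norm.pow 2).tendsto 0).mono_left (nhdsWithin_le_nhds (s := Set.Ioi 0))
    simpa [hA.heat_zero, hu.rePosPart_eq, Pi.pow_def] using h2
  have h2 : ‖hA.heat t u - rePosPart (hA.heat t u)‖ ^ 2 ≤ 0 := by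
    refine ge_of_tendsto h1 ?_
    filter_upwards [Ioc_mem_nhdsGT (NNReal.coe_pos.2 (pos_iff_ne_zero.2 ht))] with ε hε
    exact key ε hε.1 hε.2
  exact pow_eq_zero_iff two_ne_zero |>.1 (le_antisymm h2 (sq_nonneg _))

/-- The function `s ↦ ⟨T_s v, q⟩` is nonnegative and vanishes at `s = 2r`, so its left derivative
there, `-⟨T_{2r} v, A q⟩`, is at most zero. The time is written `r + r` so that the step backwards
acts on `T_r v`, which is in the domain. -/
theorem IsNonnegSelfAdjoint.re_inner_apply_heat_nonneg (hA : IsNonnegSelfAdjoint A)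
    (hP : ∀ (t : ℝ≥0) {u : L2R}, AENonneg u → AENonneg (hA.heat t u)) {r : ℝ≥0} (hr : 0 < r)
    {v : L2R} (hv : AENonneg v) {q : A.domain} (hq : AENonneg (q : L2R))
    (h0 : (inner ℂ (hA.heat (r + r) v) (q : L2R)).re = 0) :
    0 ≤ (inner ℂ (hA.heat (r + r) v) (A q)).re := by
  have hT := hA.isExpSemigroup_heat
  have hm := hA.heat_apply_mem hr v
  have h1 := (hT.generator _ _).2 ⟨hm, rfl⟩
  have h2 : Tendsto (fun h : ℝ≥0 => hA.heat (r - h) (q : L2R)) (𝓝[>] 0) (𝓝 (hA.heat r q)) := by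
    have : Continuous fun h : ℝ≥0 => hA.heat (r - h) (q : L2R) :=
      (hA.continuous_heat_apply _).comp (continuous_const.sub continuous_id)
    simpa using (this.tendsto 0).mono_left nhdsWithin_le_nhds
  have h3 := (Complex.continuous_re.tendsto _).comp (h1.inner h2 (𝕜 := ℂ))
  have h4 : (inner ℂ (A ⟨_, hm⟩) (hA.heat r (q : L2R))) = inner ℂ (hA.heat (r + r) v) (A q) := by
    obtain ⟨h5, h6⟩ := hT.apply_mem r ⟨_, hm⟩
    rw [← hA.inner_heat_left, ← h6, hA.symm, hA.heat_add]
    rfl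
  rw [h4] at h3
  refine ge_of_tendsto h3 ?_
  filter_upwards [Ioc_mem_nhdsGT hr] with h hh
  have h5 : (((h⁻¹ : ℝ≥0) : ℂ)) = (((h⁻¹ : ℝ≥0) : ℝ) : ℂ) := rfl
  rw [Function.comp_apply, inner_smul_left, h5, Complex.conj_ofReal, Complex.re_ofReal_mul]
  refine mul_nonneg (NNReal.coe_nonneg _) ?_
  rw [← hA.inner_heat_left, map_sub, inner_sub_left, Complex.sub_re]
  have h6 : hA.heat (r - h) (hA.heat h (hA.heat r v)) = hA.heat (r + r) v := by
    rw [← mul_apply_eq_comp, ← hA.heat_add, tsub_add_cancel_of_le hh.2, hA.heat_add]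
    rfl
  rw [h6, h0, sub_zero]
  exact (hP _ (hP _ hv)).re_inner_nonneg hq

theorem exists_aePos : ∃ g : L2R, AEPos g := by
  refine ⟨poissonVec one_pos 0, ?_⟩
  filter_upwards [coeFn_poissonVec one_pos 0] with x hx
  rw [hx]
  exact ⟨cauchyKernel_pos one_pos _, Complex.ofReal_im _⟩

theorem AENonneg.exists_orthogonal {q : L2R} (hq : AENonneg q) (h : ¬ AEPos q) :
    ∃ v : L2R, AENonneg v ∧ v ≠ 0 ∧ (inner ℂ v q).re = 0 := by
  obtain ⟨g, hg⟩ := exists_aePos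
  have hZ : MeasurableSet {x | (q x).re ≤ 0} :=
    measurableSet_le (Complex.measurable_re.comp (Lp.stronglyMeasurable q).measurable)
      measurable_const
  set Z := {x | (q x).re ≤ 0} with hZdef
  have hb : BddMeas (Z.indicator fun _ => (1 : ℝ)) :=
    ⟨measurable_const.indicator hZ, 1, fun x => by
      by_cases hx : x ∈ Z <;> simp [hx]⟩
  have hv := coeFn_mulL hb g
  refine ⟨mulL hb g, ?_, fun h0 => h ?_, ?_⟩
  · filter_upwards [hv, hg] with x h1 h2
    rw [h1]
    by_cases hx : x ∈ Z
    · simp [hx, h2.1.le, h2.2]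
    · simp [hx]
  · rw [h0] at hv
    filter_upwards [hv, hg, hq, Lp.coeFn_zero ℂ 2 volume] with x h1 h2 h3 h4
    refine ⟨?_, h3.2⟩
    by_contra hx
    have hx' : x ∈ Z := not_lt.1 hx
    rw [h4, Set.indicator_of_mem hx', Complex.ofReal_one, one_mul] at h1
    rw [← h1] at h2
    exact lt_irrefl _ h2.1
  · rw [re_inner_eq_integral]
    refine integral_eq_zero_of_ae ?_
    filter_upwards [hv, hq] with x h1 h2
    rw [h1]
    by_cases hx : x ∈ Z
    · have h3 : q x = 0 := Complex.ext (le_antisymm hx h2.1) h2.2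
      simp [h3]
    · simp [hx]

theorem positivityImproving_heat {V : ℝ → ℝ} (hV : ∀ x, 0 ≤ V x)
    (hA : IsNonnegSelfAdjoint (absDAdd V)) {t : ℝ≥0} (ht : 0 < t) :
    PositivityImproving (hA.heat t) := by
  intro u hu hu0
  have hP : ∀ (t : ℝ≥0) {u : L2R}, AENonneg u → AENonneg (hA.heat t u) := fun t u hu =>
    hA.aeNonneg_heat (re_inner_sub_rePosPart_absDAdd_nonneg hV) t hu
  by_contra hpos
  obtain ⟨v, hv, hv0, hvq⟩ := (hP t hu).exists_orthogonal hpos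
  -- With `t = 2r + 2r`, symmetry puts half of the time on each of `u` and `v`. Both evolved
  -- functions are nonnegative, nonzero and orthogonal, and the two sign statements for their
  -- pairing through the operator contradict each other.
  set r := t / 2 / 2 with hr
  have hr0 : 0 < r := by positivity
  have hrt : t = (r + r) + (r + r) := by rw [hr, add_halves, add_halves]
  rw [hrt, hA.heat_add, mul_apply_eq_comp, ← hA.inner_heat_left] at hvq
  have hm := hA.heat_apply_mem (add_pos hr0 hr0) u
  have h1 := hA.re_inner_apply_heat_nonneg hP hr0 hv (q := ⟨_, hm⟩) (hP _ hu) hvq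
  have h2 := re_inner_absDAdd_neg ⟨_, hm⟩ (hP (r + r) hv) (hP _ hu) (hA.heat_apply_ne_zero _ hv0)
    (hA.heat_apply_ne_zero _ hu0) hvq
  linarith

end Positivity

/-! ### Compactness of the resolvent. -/

theorem isCompactOperator_of_forall_norm_sub_le {E F : Type*} [NormedAddCommGroup E]
    [NormedSpace ℂ E] [NormedAddCommGroup F] [NormedSpace ℂ F] [CompleteSpace F] {T : E →L[ℂ] F}
    (h : ∀ ε : ℝ, 0 < ε → ∃ S : E →L[ℂ] F, IsCompactOperator S ∧ ‖T - S‖ ≤ ε) :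
    IsCompactOperator T := by
  have hc : T ∈ closure {f : E →L[ℂ] F | IsCompactOperator f} := by
    rw [Metric.mem_closure_iff]
    intro ε hε
    obtain ⟨S, hS, hS'⟩ := h (ε / 2) (half_pos hε)
    refine ⟨S, hS, ?_⟩
    rw [dist_eq_norm]
    linarith
  rwa [isClosed_setOfPred_isCompactOperator.closure_eq] at hc

theorem norm_sub_starProjection_le {E : Type*} [NormedAddCommGroup E] [InnerProductSpace ℂ E]
    (W : Submodule ℂ E) [W.HasOrthogonalProjection] (x : E) {p : E} (hp : p ∈ W) :
    ‖x - W.starProjection x‖ ≤ ‖x - p‖ := by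
  rw [W.starProjection_minimal]
  exact ciInf_le ⟨0, by
    rintro _ ⟨y, rfl⟩
    exact norm_nonneg _⟩ (⟨p, hp⟩ : W)

theorem isCompactOperator_comp_starProjection {E F : Type*} [NormedAddCommGroup E]
    [InnerProductSpace ℂ E] [NormedAddCommGroup F] [NormedSpace ℂ F] (B : E →L[ℂ] F)
    (W : Submodule ℂ E) [FiniteDimensional ℂ W] : IsCompactOperator (B ∘L W.starProjection) := by
  have : ProperSpace W := FiniteDimensional.proper ℂ W
  exact (isCompactOperator_of_locallyCompactSpace_rng (B ∘L W.subtypeL)).comp_clm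
    W.orthogonalProjectionOnto

theorem bddMeas_indicator {Z : Set ℝ} (hZ : MeasurableSet Z) :
    BddMeas (Z.indicator fun _ => (1 : ℝ)) :=
  ⟨measurable_const.indicator hZ, 1, fun x => by by_cases hx : x ∈ Z <;> simp [hx]⟩

/-- The value at `x` is the pairing with the kernel vector at `x`, and these vectors form a compact
set for `x` in `[-M, M]`. A finite net of them spans a space `W`; replacing `f` by its projection to
`W` changes all values uniformly little and gives a finite-rank operator. -/
theorem isCompactOperator_indicator_poissonOp {t : ℝ} (ht : 0 < t) (M : ℝ) :
    IsCompactOperator (mulL (bddMeas_indicator (measurableSet_Icc (a := -M) (b := M))) ∘L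
      poissonOp ht.le) := by
  set Z := Set.Icc (-M) M with hZ
  set B := mulL (bddMeas_indicator (measurableSet_Icc (a := -M) (b := M))) ∘L poissonOp ht.le
    with hB
  set χ : L2R := indicatorConstLp 2 (measurableSet_Icc (a := -M) (b := M))
    (isCompact_Icc.measure_lt_top (μ := volume)).ne 1 with hχ
  have hBx : ∀ f : L2R, ∀ᵐ x, B f x = Z.indicator (fun x => inner ℂ (poissonVec ht x) f) x := by
    intro f
    filter_upwards [coeFn_mulL (bddMeas_indicator (measurableSet_Icc (a := -M) (b := M)))
      (poissonOp ht.le f), coeFn_poissonOp ht f] with x h1 h2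
    rw [hB, ContinuousLinearMap.comp_apply, h1, h2]
    by_cases hx : x ∈ Z
    · simp [hZ ▸ hx, hx]
    · simp [hZ ▸ hx, hx]
  refine isCompactOperator_of_forall_norm_sub_le fun ε hε => ?_
  set δ := ε / (‖χ‖ + 1) with hδ
  have hδ0 : 0 < δ := by positivity
  obtain ⟨s, hsZ, hs, hcov⟩ := (isCompact_Icc.image (continuous_poissonVec ht) :
    IsCompact (poissonVec ht '' Z)).finite_cover_balls hδ0
  set W := Submodule.span ℂ s with hW
  have : FiniteDimensional ℂ W := FiniteDimensional.span_of_finite ℂ hs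
  refine ⟨B ∘L W.starProjection, isCompactOperator_comp_starProjection B W, ?_⟩
  refine ContinuousLinearMap.opNorm_le_bound _ hε.le fun f => ?_
  have h1 : ‖B (f - W.starProjection f)‖ ≤ δ * ‖f‖ * ‖χ‖ := by
    refine Lp.norm_le_mul_norm_of_ae_le_mul ?_
    filter_upwards [hBx (f - W.starProjection f), indicatorConstLp_coeFn (p := 2)
      (hs := measurableSet_Icc (a := -M) (b := M))
      (hμs := (isCompact_Icc.measure_lt_top (μ := volume)).ne) (c := (1 : ℂ))] with x h2 h3
    rw [h2, h3]
    by_cases hx : x ∈ Z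
    · rw [Set.indicator_of_mem hx, Set.indicator_of_mem hx, norm_one, mul_one]
      obtain ⟨p, hp, hxp⟩ := Set.mem_iUnion₂.1 (hcov (Set.mem_image_of_mem _ hx))
      rw [inner_sub_right, ← W.inner_starProjection_left_eq_right, ← inner_sub_left]
      refine (norm_inner_le_norm _ _).trans (mul_le_mul_of_nonneg_right ?_ (norm_nonneg _))
      refine (norm_sub_starProjection_le W _ (Submodule.subset_span hp)).trans ?_
      rw [← dist_eq_norm]
      exact (Metric.mem_ball.1 hxp).le
    · rw [Set.indicator_of_notMem hx, Set.indicator_of_notMem hx, norm_zero, mul_zero]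
  have h2 : (B - B ∘L W.starProjection) f = B (f - W.starProjection f) := by
    rw [map_sub]
    rfl
  rw [h2]
  refine h1.trans ?_
  have h3 : δ * ‖χ‖ ≤ ε := by
    rw [hδ, div_mul_eq_mul_div, div_le_iff₀ (by positivity)]
    nlinarith [norm_nonneg χ]
  nlinarith [norm_nonneg f]

namespace ComparablePotential

variable {α c C : ℝ} {V : ℝ → ℝ}

theorem exists_norm_truncWeight_resolvent_le (hV : ComparablePotential α c C V) :
    ∃ K, 0 ≤ K ∧ ∀ (f : L2R) (m : ℝ) (hm : 1 ≤ m),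
      ‖mulL ((bddMeas_truncWeight hV.exponent_pos hm).mul (bddMeas_truncWeight hV.exponent_pos hm))
        (hV.isNonnegSelfAdjoint.resolvent f)‖ ≤ K * ‖f‖ := by
  obtain ⟨K, hK0, hK⟩ := hV.exists_solution
  refine ⟨K, hK0, fun f m hm => ?_⟩
  obtain ⟨u, hd, hv, h, hb⟩ := hK f
  have h1 := hV.isNonnegSelfAdjoint.resolvent_apply_add ⟨u, hd, hv⟩
  rw [absDAdd_apply] at h1
  have h2 : hV.isNonnegSelfAdjoint.resolvent f = u := by
    rw [← h]
    exact h1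
  rw [h2]
  exact hb m hm

theorem exists_norm_resolvent_sub_indicator_le (hV : ComparablePotential α c C V) {ε : ℝ}
    (hε : 0 < ε) : ∃ M : ℝ, ‖hV.isNonnegSelfAdjoint.resolvent -
      mulL (bddMeas_indicator (measurableSet_Icc (a := -M) (b := M))) ∘L
        hV.isNonnegSelfAdjoint.resolvent‖ ≤ ε := by
  obtain ⟨K, hK0, hK⟩ := hV.exists_norm_truncWeight_resolvent_le
  -- Outside `[-M, M]` the truncated weight equals `m`, so the tail of `u` is at most `m⁻¹` times
  -- the weighted norm, that is `K / m * ‖f‖`, and `K ≤ ε m`.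
  set m := K / ε + 1 with hm
  have hm1 : 1 ≤ m := by
    rw [hm]
    linarith [div_nonneg hK0 hε.le]
  have hm0 : 0 < m := by linarith
  have hα := hV.exponent_pos
  set M := m ^ α⁻¹ with hM
  refine ⟨M, ContinuousLinearMap.opNorm_le_bound _ hε.le fun f => ?_⟩
  set u := hV.isNonnegSelfAdjoint.resolvent f with hu
  have h1 : ∀ᵐ x, ‖(u - mulL (bddMeas_indicator (measurableSet_Icc (a := -M) (b := M))) u : L2R) x‖
      ≤ m⁻¹ * ‖mulL ((bddMeas_truncWeight hα hm1).mul (bddMeas_truncWeight hα hm1)) u x‖ := by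
    filter_upwards [Lp.coeFn_sub u
        (mulL (bddMeas_indicator (measurableSet_Icc (a := -M) (b := M))) u),
      coeFn_mulL (bddMeas_indicator (measurableSet_Icc (a := -M) (b := M))) u,
      coeFn_mulL ((bddMeas_truncWeight hα hm1).mul (bddMeas_truncWeight hα hm1)) u] with x h2 h3 h4
    rw [h2, Pi.sub_apply, h3, h4]
    by_cases hx : x ∈ Set.Icc (-M) M
    · rw [Set.indicator_of_mem hx, Complex.ofReal_one, one_mul, sub_self, norm_zero]
      positivity
    · rw [Set.indicator_of_notMem hx, Complex.ofReal_zero, zero_mul, sub_zero, norm_mul,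
        Complex.norm_real]
      have h5 : M < |x| := by
        by_contra! h
        exact hx (abs_le.1 h)
      have h6 : truncWeight α m x = m := by
        refine min_eq_right ?_
        have h7 : m = M ^ α := by
          rw [hM, ← Real.rpow_mul hm0.le, inv_mul_cancel₀ hα.ne', Real.rpow_one]
        rw [h7, japaneseWeight]
        exact Real.rpow_le_rpow (Real.rpow_nonneg hm0.le _) (by linarith) hα.le
      rw [h6, Real.norm_of_nonneg (by positivity), ← mul_assoc, inv_mul_cancel_left₀ hm0.ne']
      exact le_mul_of_one_le_left (norm_nonneg _) hm1
  refine (Lp.norm_le_mul_norm_of_ae_le_mul h1).trans ?_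
  refine (mul_le_mul_of_nonneg_left (hK f m hm1) (by positivity)).trans ?_
  rw [← mul_assoc]
  refine mul_le_mul_of_nonneg_right ?_ (norm_nonneg f)
  rw [inv_mul_le_iff₀ hm0, hm, add_mul, div_mul_cancel₀ _ hε.ne']
  linarith

/-- For each `f` the quotient by `t` is bounded by `‖|D| R f‖`; the uniform boundedness principle
turns this into a norm bound, so boundedness of `|D| R` need not be shown. -/
theorem exists_norm_resolvent_sub_poissonOp_le (hV : ComparablePotential α c C V) :
    ∃ K : ℝ, ∀ (t : ℝ) (ht : 0 < t), ‖hV.isNonnegSelfAdjoint.resolvent -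
      poissonOp ht.le ∘L hV.isNonnegSelfAdjoint.resolvent‖ ≤ t * K := by
  obtain ⟨K, hK⟩ := banach_steinhaus (ι := {t : ℝ // 0 < t})
    (g := fun t => ((t : ℝ)⁻¹ : ℂ) • (hV.isNonnegSelfAdjoint.resolvent -
      poissonOp t.2.le ∘L hV.isNonnegSelfAdjoint.resolvent)) (fun f => by
      have hm := hV.isNonnegSelfAdjoint.resolvent_mem f
      refine ⟨‖absD ⟨_, hm.1⟩‖, fun t => ?_⟩
      have h := norm_sub_poissonOp_le t.2.le ⟨_, hm.1⟩
      rw [smul_apply, norm_smul, ← Complex.ofReal_inv, Complex.norm_real,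
        Real.norm_of_nonneg (inv_nonneg.2 t.2.le), inv_mul_le_iff₀ t.2]
      exact h)
  refine ⟨K, fun t ht => ?_⟩
  have h := hK ⟨t, ht⟩
  rwa [norm_smul, ← Complex.ofReal_inv, Complex.norm_real,
    Real.norm_of_nonneg (inv_nonneg.2 ht.le), inv_mul_le_iff₀ ht] at h

theorem isCompactOperator_resolvent (hV : ComparablePotential α c C V) :
    IsCompactOperator hV.isNonnegSelfAdjoint.resolvent := by
  refine isCompactOperator_of_forall_norm_sub_le fun ε hε => ?_
  obtain ⟨M, hM⟩ := hV.exists_norm_resolvent_sub_indicator_le (half_pos hε)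
  obtain ⟨K, hK⟩ := hV.exists_norm_resolvent_sub_poissonOp_le
  set t := ε / 2 / (|K| + 1) with ht
  have ht0 : 0 < t := by positivity
  set R := hV.isNonnegSelfAdjoint.resolvent
  set X := mulL (bddMeas_indicator (measurableSet_Icc (a := -M) (b := M))) with hX
  have hX1 : ‖X‖ ≤ 1 := ContinuousLinearMap.opNorm_le_bound _ zero_le_one fun u =>
    norm_mulL_le _ (fun x => by by_cases hx : x ∈ Set.Icc (-M) M <;> simp [Set.indicator, hx]) u
  refine ⟨X ∘L poissonOp ht0.le ∘L R, ?_, ?_⟩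
  · exact (isCompactOperator_indicator_poissonOp ht0 M).comp_clm R
  · have h1 : R - X ∘L poissonOp ht0.le ∘L R = (R - X ∘L R) + X ∘L (R - poissonOp ht0.le ∘L R) := by
      rw [ContinuousLinearMap.comp_sub]
      abel
    have h2 := (ContinuousLinearMap.opNorm_comp_le X (R - poissonOp ht0.le ∘L R)).trans
      (mul_le_mul hX1 (hK t ht0) (norm_nonneg _) zero_le_one)
    have h3 : t * K ≤ ε / 2 := by
      have h4 : t * (|K| + 1) = ε / 2 := div_mul_cancel₀ _ (by positivity)
      nlinarith [le_abs_self K]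
    rw [h1]
    exact (norm_add_le _ _).trans (by linarith)

end ComparablePotential

/-! ### The ground state. -/

theorem AEPos.ne_zero {u : L2R} (hu : AEPos u) : u ≠ 0 := by
  rintro rfl
  have h : ∀ᵐ _ : ℝ, False := by
    filter_upwards [hu, Lp.coeFn_zero ℂ 2 (volume : Measure ℝ)] with x h1 h2
    rw [h2] at h1
    exact lt_irrefl _ h1.1
  exact h.exists.choose_spec

instance : Nontrivial L2R := by
  obtain ⟨g, hg⟩ := exists_aePos
  exact nontrivial_of_ne g 0 hg.ne_zero

theorem ae_re_nonpos_of_rePosPart_eq_zero {u : L2R} (hu : rePosPart u = 0) :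
    ∀ᵐ x, (u x).re ≤ 0 := by
  have h := coeFn_rePosPart u
  rw [hu] at h
  filter_upwards [h, Lp.coeFn_zero ℂ 2 (volume : Measure ℝ)] with x h1 h2
  rw [h2, Pi.zero_apply, eq_comm, Complex.ofReal_eq_zero] at h1
  exact max_eq_right_iff.1 h1

/-- The rotations by `1`, `-1`, `i`, `-i` control both signs of the real and imaginary parts. This
lets complex eigenfunctions be treated without splitting them. -/
theorem eq_zero_of_forall_rePosPart {u : L2R} (h : ∀ a : ℂ, rePosPart (a • u) = 0) : u = 0 := by
  refine Lp.ext ?_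
  filter_upwards [ae_re_nonpos_of_rePosPart_eq_zero (h 1),
    ae_re_nonpos_of_rePosPart_eq_zero (h (-1)),
    ae_re_nonpos_of_rePosPart_eq_zero (h Complex.I),
    ae_re_nonpos_of_rePosPart_eq_zero (h (-Complex.I)),
    Lp.coeFn_smul (1 : ℂ) u, Lp.coeFn_smul (-1 : ℂ) u, Lp.coeFn_smul Complex.I u,
    Lp.coeFn_smul (-Complex.I) u, Lp.coeFn_zero ℂ 2 (volume : Measure ℝ)]
    with x h1 h2 h3 h4 e1 e2 e3 e4 e5
  rw [e1] at h1
  rw [e2] at h2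
  rw [e3] at h3
  rw [e4] at h4
  rw [e5]
  simp only [Pi.smul_apply, smul_eq_mul, one_mul, neg_mul, Complex.neg_re, Complex.I_mul_re,
    neg_neg] at h1 h2 h3 h4
  exact Complex.ext (by simpa using le_antisymm h1 (by linarith))
    (by simpa using le_antisymm h4 (by linarith))

section GroundState

variable {A : L2R →ₗ.[ℂ] L2R}

namespace IsNonnegSelfAdjoint

theorem aeNonneg_resolvent (hA : IsNonnegSelfAdjoint A)
    (hN : ∀ u : A.domain, 0 ≤ (inner ℂ ((u : L2R) - rePosPart u) (A u)).re) {f : L2R}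
    (hf : AENonneg f) : AENonneg (hA.resolvent f) := by
  have h1 := hN ⟨_, hA.resolvent_mem f⟩
  rw [hA.apply_resolvent, inner_sub_right, Complex.sub_re, re_inner_sub_rePosPart_self] at h1
  have h2 := re_inner_sub_rePosPart_le (hA.resolvent f) hf
  exact aeNonneg_of_norm_sub_rePosPart
    (pow_eq_zero_iff two_ne_zero |>.1 (le_antisymm (by linarith) (sq_nonneg _)))

theorem norm_resolvent_pos (hA : IsNonnegSelfAdjoint A) : 0 < ‖hA.resolvent‖ := by
  rw [norm_pos_iff]
  intro h
  obtain ⟨g, hg⟩ := exists_ne (0 : L2R)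
  exact hg (hA.resolvent_injective (by rw [h]; rfl))

/-- The norm of a positive operator is the supremum of its Rayleigh quotients. If it were in the
resolvent set, these would stay a fixed distance below it. For a compact operator a nonzero spectral
value is an eigenvalue. -/
theorem exists_resolvent_eq_norm_smul (hA : IsNonnegSelfAdjoint A)
    (hK : IsCompactOperator hA.resolvent) :
    ∃ ψ : L2R, ψ ≠ 0 ∧ hA.resolvent ψ = (‖hA.resolvent‖ : ℂ) • ψ := by
  have hpos := hA.norm_resolvent_pos
  have h1 : (‖hA.resolvent‖ : ℂ) ∈ spectrum ℂ hA.resolvent := by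
    by_contra h
    obtain ⟨ε, hε, h2⟩ := hA.resolvent.rayleighQuotient_le_of_norm_mem_resolventSet
      (𝕜 := ℂ) (not_not.1 h)
    have h3 := hA.resolvent.norm_eq_iSup_rayleighQuotient hA.isPositive_resolvent.1
    have h4 : ‖hA.resolvent‖ ≤ ‖hA.resolvent‖ - ε := by
      conv_lhs => rw [h3]
      refine ciSup_le fun x => ?_
      rw [abs_of_nonneg]
      · exact h2 x
      · exact div_nonneg (hA.isPositive_resolvent.2 x) (sq_nonneg _)
    linarith
  have h5 := (hK.hasEigenvalue_iff_mem_spectrum (Complex.ofReal_ne_zero.2 hpos.ne')).2 h1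
  obtain ⟨ψ, hψ⟩ := h5.exists_hasEigenvector
  exact ⟨ψ, hψ.2, hψ.apply_eq_smul⟩

/-- With `p` the positive part and `ρ = ‖R‖`, the projection inequalities give `ρ ‖p‖² ≤ ⟨p, R p⟩`.
So `p` is a maximiser of the Rayleigh quotient or zero, and expanding `‖R p - ρ p‖²` shows that it
vanishes. -/
theorem resolvent_rePosPart (hA : IsNonnegSelfAdjoint A)
    (hN : ∀ u : A.domain, 0 ≤ (inner ℂ ((u : L2R) - rePosPart u) (A u)).re) {ψ : L2R}
    (hψ : hA.resolvent ψ = (‖hA.resolvent‖ : ℂ) • ψ) :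
    hA.resolvent (rePosPart ψ) = (‖hA.resolvent‖ : ℂ) • rePosPart ψ := by
  set ρ := ‖hA.resolvent‖ with hρ
  set p := rePosPart ψ with hp
  have hρ0 : 0 < ρ := hA.norm_resolvent_pos
  have h1 : (inner ℂ (ψ - p) (hA.resolvent p)).re ≤ 0 :=
    re_inner_sub_rePosPart_le ψ (hA.aeNonneg_resolvent hN (aeNonneg_rePosPart ψ))
  have h2 : (inner ℂ (ψ - p) p).re = 0 := re_inner_sub_rePosPart_rePosPart ψ
  rw [inner_sub_left, Complex.sub_re, re_inner_self] at h2
  rw [inner_sub_left, Complex.sub_re, ← hA.inner_resolvent_left, hψ, inner_smul_left,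
    Complex.conj_ofReal, Complex.re_ofReal_mul] at h1
  have h3 : ‖hA.resolvent p‖ ≤ ρ * ‖p‖ := hA.resolvent.le_opNorm p
  have h4 : ‖hA.resolvent p - (ρ : ℂ) • p‖ ^ 2 =
      ‖hA.resolvent p‖ ^ 2 - 2 * (ρ * (inner ℂ p (hA.resolvent p)).re) + ρ ^ 2 * ‖p‖ ^ 2 := by
    rw [norm_sub_sq (𝕜 := ℂ), inner_smul_right, hA.inner_resolvent_left, norm_smul,
      Complex.norm_real, Real.norm_of_nonneg hρ0.le, mul_pow, RCLike.re_to_complex,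
      Complex.re_ofReal_mul]
  have h5 : ‖hA.resolvent p‖ ^ 2 ≤ ρ ^ 2 * ‖p‖ ^ 2 := by
    rw [← mul_pow]
    exact pow_le_pow_left₀ (norm_nonneg _) h3 2
  have h6 : ρ * (ρ * ‖p‖ ^ 2) ≤ ρ * (inner ℂ p (hA.resolvent p)).re :=
    mul_le_mul_of_nonneg_left (by nlinarith) hρ0.le
  have h7 : ‖hA.resolvent p - (ρ : ℂ) • p‖ ^ 2 ≤ 0 := by nlinarith
  exact sub_eq_zero.1 (norm_eq_zero.1 (pow_eq_zero_iff two_ne_zero |>.1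
    (le_antisymm h7 (sq_nonneg _))))

theorem mem_pmapEigenspace_iff (hA : IsNonnegSelfAdjoint A) {r : ℝ} (hr : r ≠ 0) {u : L2R} :
    u ∈ pmapEigenspace A ((r⁻¹ - 1 : ℝ) : ℂ) ↔ hA.resolvent u = (r : ℂ) • u := by
  have hr' : (r : ℂ) ≠ 0 := Complex.ofReal_ne_zero.2 hr
  constructor
  · rintro ⟨h, hu⟩
    have h1 := hA.resolvent_apply_add ⟨u, h⟩
    have h2 : A ⟨u, h⟩ + u = (r : ℂ)⁻¹ • u := by
      rw [hu]
      push_cast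
      rw [sub_smul, one_smul, sub_add_cancel]
    simp only [h2, map_smul] at h1
    exact (inv_smul_eq_iff₀ hr').1 h1
  · intro h
    have h1 : u = hA.resolvent ((r : ℂ)⁻¹ • u) := by rw [map_smul, h, inv_smul_smul₀ hr']
    have h2 := hA.apply_resolvent ((r : ℂ)⁻¹ • u)
    have h3 : u ∈ A.domain := h1 ▸ hA.resolvent_mem _
    refine ⟨h3, ?_⟩
    have h4 : (⟨_, hA.resolvent_mem ((r : ℂ)⁻¹ • u)⟩ : A.domain) = ⟨u, h3⟩ := Subtype.ext h1.symm
    rw [h4, ← h1] at h2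
    rw [h2]
    push_cast
    rw [sub_smul, one_smul]

theorem le_of_mem_realEigenvalues (hA : IsNonnegSelfAdjoint A) {μ : ℝ}
    (hμ : μ ∈ realEigenvalues A) : ‖hA.resolvent‖⁻¹ - 1 ≤ μ := by
  obtain ⟨u, ⟨hu, hu'⟩, hu0⟩ := (Submodule.ne_bot_iff _).1 hμ
  have h0 : 0 < ‖u‖ := norm_pos_iff.2 hu0
  have h1 : 0 ≤ μ := by
    have h2 := hA.nonneg ⟨u, hu⟩
    rw [hu', inner_smul_right, Complex.re_ofReal_mul, re_inner_self] at h2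
    by_contra! h
    nlinarith [pow_pos h0 2]
  have h2 := hA.resolvent_apply_add ⟨u, hu⟩
  have h3 : A ⟨u, hu⟩ + u = ((μ + 1 : ℝ) : ℂ) • u := by
    rw [hu']
    push_cast
    rw [add_smul, one_smul]
  simp only [h3, map_smul] at h2
  have h4 : ‖u‖ = (μ + 1) * ‖hA.resolvent u‖ := by
    conv_lhs => rw [← h2]
    rw [norm_smul, Complex.norm_real, Real.norm_of_nonneg (by linarith)]
  have h5 := mul_le_mul_of_nonneg_left (hA.resolvent.le_opNorm u) (by linarith : 0 ≤ μ + 1)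
  rw [← h4, ← mul_assoc] at h5
  have h6 : 1 ≤ (μ + 1) * ‖hA.resolvent‖ := by
    by_contra! h
    nlinarith
  rw [sub_le_iff_le_add, inv_le_iff_one_le_mul₀ hA.norm_resolvent_pos]
  exact h6

end IsNonnegSelfAdjoint

/-- A nonnegative nonzero `v` living on the zero set of `φ` would satisfy `⟨v, A φ⟩ = μ ⟨v, φ⟩ = 0`,
against the strict negativity from nonlocality. -/
theorem AENonneg.aePos_of_mem_pmapEigenspace {V : ℝ → ℝ} {μ : ℝ} {φ : L2R} (hφ : AENonneg φ)
    (h0 : φ ≠ 0) (h : φ ∈ pmapEigenspace (absDAdd V) (μ : ℂ)) : AEPos φ := by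
  by_contra hpos
  obtain ⟨v, hv, hv0, hvφ⟩ := hφ.exists_orthogonal hpos
  obtain ⟨hd, he⟩ := h
  have h1 := re_inner_absDAdd_neg ⟨φ, hd⟩ hv hφ hv0 h0 hvφ
  rw [he, inner_smul_right, Complex.re_ofReal_mul, hvφ, mul_zero] at h1
  exact lt_irrefl _ h1

theorem re_inner_pos_of_aePos_rePosPart {φ w : L2R} (hφ : AEPos φ) (hw : AEPos (rePosPart w)) :
    0 < (inner ℂ φ w).re := by
  have h1 : (inner ℂ φ w).re = (inner ℂ φ (rePosPart w)).re := by
    rw [re_inner_eq_integral, re_inner_eq_integral]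
    refine integral_congr_ae ?_
    filter_upwards [hφ, hw, coeFn_rePosPart w] with x h1 h2 h3
    rw [h3, Complex.ofReal_re] at h2
    have h4 : (w x).re = max (w x).re 0 := by
      rcases lt_max_iff.1 h2.1 with h | h
      · exact (max_eq_left h.le).symm
      · exact absurd h (lt_irrefl _)
    rw [h3, ← h4]
    simp [Complex.mul_re, h1.2]
  rw [h1]
  exact lt_of_le_of_ne (hφ.aeNonneg.re_inner_nonneg hw.aeNonneg)
    fun h => hφ.ne_zero (hφ.aeNonneg.eq_zero_of_inner_aePos hw h.symm)

theorem exists_ground_state {V : ℝ → ℝ} (hV : ∀ x, 0 ≤ V x) (hA : IsNonnegSelfAdjoint (absDAdd V))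
    (hK : IsCompactOperator hA.resolvent) :
    ∃ lam : ℝ, IsLeast (realEigenvalues (absDAdd V)) lam ∧
      Module.finrank ℂ (pmapEigenspace (absDAdd V) (lam : ℂ)) = 1 ∧
      ∃ φ ∈ pmapEigenspace (absDAdd V) (lam : ℂ), ‖φ‖ = 1 ∧ AEPos φ := by
  set lam : ℝ := ‖hA.resolvent‖⁻¹ - 1 with hlam
  have hρ := hA.norm_resolvent_pos
  have hN := re_inner_sub_rePosPart_absDAdd_nonneg hV
  have hmem : ∀ {u : L2R}, u ∈ pmapEigenspace (absDAdd V) (lam : ℂ) ↔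
      hA.resolvent u = (‖hA.resolvent‖ : ℂ) • u := hA.mem_pmapEigenspace_iff hρ.ne'
  have hpart : ∀ {u : L2R}, u ∈ pmapEigenspace (absDAdd V) (lam : ℂ) → rePosPart u ≠ 0 →
      AEPos (rePosPart u) := fun hu h0 =>
    (aeNonneg_rePosPart _).aePos_of_mem_pmapEigenspace h0
      (hmem.2 (hA.resolvent_rePosPart hN (hmem.1 hu)))
  obtain ⟨ψ, hψ0, hψ⟩ := hA.exists_resolvent_eq_norm_smul hK
  obtain ⟨φ, hφ, hφ1, hφp⟩ : ∃ φ ∈ pmapEigenspace (absDAdd V) (lam : ℂ), ‖φ‖ = 1 ∧ AEPos φ := by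
    obtain ⟨a, ha⟩ : ∃ a : ℂ, rePosPart (a • ψ) ≠ 0 := by
      by_contra! h
      exact hψ0 (eq_zero_of_forall_rePosPart h)
    have h1 : a • ψ ∈ pmapEigenspace (absDAdd V) (lam : ℂ) :=
      Submodule.smul_mem _ a (hmem.2 hψ)
    have h2 := hpart h1 ha
    have h3 : 0 < ‖rePosPart (a • ψ)‖ := norm_pos_iff.2 ha
    refine ⟨((‖rePosPart (a • ψ)‖⁻¹ : ℝ) : ℂ) • rePosPart (a • ψ),
      Submodule.smul_mem _ _ (hmem.2 (hA.resolvent_rePosPart hN (hmem.1 h1))), ?_, ?_⟩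
    · rw [norm_smul, Complex.norm_real, Real.norm_of_nonneg (inv_pos.2 h3).le,
        inv_mul_cancel₀ h3.ne']
    · filter_upwards [h2, Lp.coeFn_smul ((‖rePosPart (a • ψ)‖⁻¹ : ℝ) : ℂ) (rePosPart (a • ψ))]
        with x h4 h5
      rw [h5, Pi.smul_apply, smul_eq_mul, Complex.re_ofReal_mul, Complex.im_ofReal_mul, h4.2,
        mul_zero]
      exact ⟨mul_pos (inv_pos.2 h3) h4.1, rfl⟩
  refine ⟨lam, ⟨?_, fun μ hμ => hA.le_of_mem_realEigenvalues hμ⟩, ?_, φ, hφ, hφ1, hφp⟩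
  · exact (Submodule.ne_bot_iff _).2 ⟨φ, hφ, hφp.ne_zero⟩
  · refine finrank_eq_one (⟨φ, hφ⟩ : pmapEigenspace (absDAdd V) (lam : ℂ))
      (fun h => hφp.ne_zero (congrArg Subtype.val h)) fun w => ⟨inner ℂ φ (w : L2R), ?_⟩
    refine Subtype.ext (sub_eq_zero.1 ?_).symm
    -- Simplicity: the component of an eigenfunction orthogonal to `φ` must vanish. If some multiple
    -- `a • z` had nonzero positive part, that part would be positive almost everywhere, forcing `Re
    -- ⟨φ, a • z⟩ > 0`.
    set z : L2R := (w : L2R) - inner ℂ φ (w : L2R) • φ with hz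
    have hzm : z ∈ pmapEigenspace (absDAdd V) (lam : ℂ) :=
      Submodule.sub_mem _ w.2 (Submodule.smul_mem _ _ hφ)
    have hzφ : inner ℂ φ z = 0 := by
      rw [hz, inner_sub_right, inner_smul_right, inner_self_eq_norm_sq_to_K, hφ1]
      simp
    refine eq_zero_of_forall_rePosPart fun a => ?_
    by_contra h
    have h1 := re_inner_pos_of_aePos_rePosPart hφp (hpart (Submodule.smul_mem _ a hzm) h)
    rw [inner_smul_right, hzφ, mul_zero, Complex.zero_re] at h1
    exact lt_irrefl _ h1

end GroundState

/-! ### Homogeneous potentials and conclusion. -/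

theorem half_smul_mulOp (θ : ℝ → ℝ) : (1 / 2 : ℂ) • mulOp θ = mulOp fun x => θ x / 2 := by
  have hx : ∀ (u : L2R) (x : ℝ), ((θ x / 2 : ℝ) : ℂ) * u x = (1 / 2 : ℂ) * ((θ x : ℂ) * u x) := by
    intro u x
    push_cast
    ring
  refine LinearPMap.ext ?_ fun u hu hv => ?_
  · refine SetLike.ext fun u => ?_
    rw [LinearPMap.smul_domain, mem_mulOp_domain, mem_mulOp_domain]
    simp only [hx]
    refine ⟨fun h => h.const_smul (1 / 2 : ℂ), fun h => ?_⟩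
    refine (h.const_smul (2 : ℂ)).ae_eq (Eventually.of_forall fun x => ?_)
    simp
  · rw [LinearPMap.smul_apply]
    refine Lp.ext ?_
    filter_upwards [Lp.coeFn_smul (1 / 2 : ℂ) (mulOp θ ⟨u, hu⟩),
      coeFn_mulOp (⟨u, hu⟩ : (mulOp θ).domain),
      coeFn_mulOp (⟨u, hv⟩ : (mulOp fun x => θ x / 2).domain)] with x h1 h2 h3
    rw [h1, Pi.smul_apply, h2, h3, hx, smul_eq_mul]

theorem modelOperator_eq (θ : ℝ → ℝ) : modelOperator θ = absDAdd fun x => θ x / 2 := by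
  rw [modelOperator, half_smul_mulOp, absDAdd]

theorem one_add_abs_rpow_le {γ : ℝ} (hγ : 0 < γ) (x : ℝ) :
    (1 + |x|) ^ γ ≤ 2 ^ γ * (1 + |x| ^ γ) := by
  have h0 := abs_nonneg x
  rcases le_total |x| 1 with h | h
  · calc (1 + |x|) ^ γ ≤ 2 ^ γ := Real.rpow_le_rpow (by linarith) (by linarith) hγ.le
      _ ≤ _ := le_mul_of_one_le_right (by positivity) (by linarith [Real.rpow_nonneg h0 γ])
  · calc (1 + |x|) ^ γ ≤ (2 * |x|) ^ γ := Real.rpow_le_rpow (by linarith) (by linarith) hγ.le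
      _ = 2 ^ γ * |x| ^ γ := Real.mul_rpow zero_le_two h0
      _ ≤ _ := mul_le_mul_of_nonneg_left (by linarith) (by positivity)

/-- The exponent is `γ / 2` because the squared weight is compared with `V`. The `1` added to `V`
covers the zero of the potential at the origin. -/
theorem comparablePotential_of_homogeneous {γ : ℝ} (hγ : 0 < γ) {V : ℝ → ℝ} {a b : ℝ} (ha : 0 < a)
    (hb : 0 < b) (hpos : ∀ x, 0 ≤ x → V x = a * |x| ^ γ) (hneg : ∀ x, x < 0 → V x = b * |x| ^ γ) :
    ComparablePotential (γ / 2) (min 1 (min a b) / 2 ^ γ) (max a b) V := by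
  have hw : ∀ x, japaneseWeight (γ / 2) x * japaneseWeight (γ / 2) x = (1 + |x|) ^ γ := by
    intro x
    rw [japaneseWeight, ← Real.rpow_add (by positivity), add_halves]
  have hlow : ∀ x, min a b * |x| ^ γ ≤ V x := by
    intro x
    rcases le_or_gt 0 x with h | h
    · rw [hpos x h]
      exact mul_le_mul_of_nonneg_right (min_le_left _ _) (by positivity)
    · rw [hneg x h]
      exact mul_le_mul_of_nonneg_right (min_le_right _ _) (by positivity)
  have hup : ∀ x, V x ≤ max a b * |x| ^ γ := by
    intro x
    rcases le_or_gt 0 x with h | h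
    · rw [hpos x h]
      exact mul_le_mul_of_nonneg_right (le_max_left _ _) (by positivity)
    · rw [hneg x h]
      exact mul_le_mul_of_nonneg_right (le_max_right _ _) (by positivity)
  have hmin : 0 < min a b := lt_min ha hb
  refine ⟨half_pos hγ, by positivity, ?_, fun x => ?_, fun x => ?_, fun x => ?_⟩
  · have hV : V = fun x => if 0 ≤ x then a * |x| ^ γ else b * |x| ^ γ := by
      ext x
      split_ifs with h
      · exact hpos x h
      · exact hneg x (not_le.1 h)
    rw [hV]
    exact Measurable.ite measurableSet_Ici (by fun_prop) (by fun_prop)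
  · exact (by positivity : 0 ≤ min a b * |x| ^ γ).trans (hlow x)
  · rw [hw, div_mul_eq_mul_div, div_le_iff₀ (by positivity)]
    have h1 := one_add_abs_rpow_le hγ x
    have hx : 0 ≤ |x| ^ γ := by positivity
    calc min 1 (min a b) * (1 + |x|) ^ γ
        ≤ min 1 (min a b) * (2 ^ γ * (1 + |x| ^ γ)) :=
          mul_le_mul_of_nonneg_left h1 (le_min zero_le_one hmin.le)
      _ = (min 1 (min a b) * |x| ^ γ + min 1 (min a b)) * 2 ^ γ := by ring
      _ ≤ (V x + 1) * 2 ^ γ := by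
          refine mul_le_mul_of_nonneg_right (add_le_add ?_ (min_le_left _ _)) (by positivity)
          exact (mul_le_mul_of_nonneg_right (min_le_right _ _) hx).trans (hlow x)
  · rw [hw]
    refine (hup x).trans (mul_le_mul_of_nonneg_left ?_ (by positivity))
    exact Real.rpow_le_rpow (abs_nonneg x) (by linarith) hγ.le

/-- For `e = ±1` the diagonal point `(e, e)` is `√2` times a point of the unit circle. -/
theorem homogeneous_diagonal_pos {γ : ℝ} {Θ : ℝ → ℝ → ℝ}
    (hhom : ∀ x y t : ℝ, 0 < t → Θ (t * x) (t * y) = t ^ γ * Θ x y) {c : ℝ} (hc : 0 < c)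
    (hle : ∀ x y : ℝ, x ^ 2 + y ^ 2 = 1 → c ≤ Θ x y) {e : ℝ} (he : e ^ 2 = 1) : 0 < Θ e e := by
  have h2 : (0 : ℝ) < √2 := by positivity
  have h1 := hhom (e / √2) (e / √2) √2 h2
  rw [mul_div_cancel₀ _ h2.ne'] at h1
  rw [h1]
  refine mul_pos (by positivity) (hc.trans_le (hle _ _ ?_))
  rw [div_pow, he, Real.sq_sqrt zero_le_two]
  norm_num

theorem exists_comparablePotential {γ : ℝ} (hγ : 0 < γ) {Θ : ℝ → ℝ → ℝ}
    (hhom : ∀ x y t : ℝ, 0 < t → Θ (t * x) (t * y) = t ^ γ * Θ x y) {c : ℝ} (hc : 0 < c)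
    (hle : ∀ x y : ℝ, x ^ 2 + y ^ 2 = 1 → c ≤ Θ x y) :
    ∃ c' C' : ℝ, ComparablePotential (γ / 2) c' C' fun x => Θ x x / 2 := by
  refine ⟨_, _, comparablePotential_of_homogeneous hγ
    (half_pos (homogeneous_diagonal_pos hhom hc hle (e := 1) (by norm_num)))
    (half_pos (homogeneous_diagonal_pos hhom hc hle (e := -1) (by norm_num)))
    (fun x hx => ?_) (fun x hx => ?_)⟩
  · rcases hx.eq_or_lt with h | h
    · have h0 := hhom 0 0 2 two_pos
      have h1 : (1 : ℝ) < 2 ^ γ := Real.one_lt_rpow one_lt_two hγ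
      rw [mul_zero] at h0
      have h2 : Θ 0 0 = 0 := by
        have h3 : (2 ^ γ - 1) * Θ 0 0 = 0 := by linarith
        exact (mul_eq_zero.1 h3).resolve_left (by linarith)
      rw [← h, h2, abs_zero, Real.zero_rpow hγ.ne']
      simp
    · have h1 := hhom 1 1 x h
      rw [mul_one] at h1
      rw [h1, abs_of_pos h]
      ring
  · have h1 := hhom (-1) (-1) (-x) (neg_pos.2 hx)
    rw [neg_mul_neg, mul_one] at h1
    rw [h1, abs_of_neg hx]
    ring

theorem mainTheorem2 (γ : ℝ) (hγ : 0 < γ) (Θ : ℝ → ℝ → ℝ)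
    (hhom : ∀ x y t : ℝ, 0 < t → Θ (t * x) (t * y) = t ^ γ * Θ x y)
    (hbound : ∃ c C : ℝ, 0 < c ∧ ∀ x y : ℝ, x ^ 2 + y ^ 2 = 1 → c ≤ Θ x y ∧ Θ x y ≤ C)
    (hsymm : ∀ x y : ℝ, Θ x y = Θ y x)
    (A : L2R →ₗ.[ℂ] L2R) (hA : A = modelOperator (fun x => Θ x x)) :
    -- the semigroup `e^{-tA}` is well defined and positivity improving for all `t > 0`
    (∃! T : ℝ≥0 → L2R →L[ℂ] L2R, IsExpSemigroup A T) ∧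
    (∀ T : ℝ≥0 → L2R →L[ℂ] L2R, IsExpSemigroup A T →
      ∀ t : ℝ≥0, 0 < t → PositivityImproving (T t)) ∧
    -- the lowest eigenvalue is non-degenerate, with an eigenfunction that is positive a.e.
    ∃ lam : ℝ, IsLeast (realEigenvalues A) lam ∧
      Module.finrank ℂ (pmapEigenspace A (lam : ℂ)) = 1 ∧
      ∃ φ ∈ pmapEigenspace A (lam : ℂ), ‖φ‖ = 1 ∧ AEPos φ := by
  obtain ⟨c, C, hc, hcC⟩ := hbound
  obtain ⟨c', C', hV⟩ := exists_comparablePotential hγ hhom hc fun x y h => (hcC x y h).1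
  rw [modelOperator_eq] at hA
  subst hA
  have hS := hV.isNonnegSelfAdjoint
  refine ⟨hS.existsUnique_isExpSemigroup, fun T hT t ht => ?_,
    exists_ground_state hV.nonneg hS hV.isCompactOperator_resolvent⟩
  rw [hS.eq_heat hT]
  exact positivityImproving_heat hV.nonneg hS ht
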